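/- Let $M$ be an $n$-dimensional $C^\infty$ manifold (Hausdorff, second countable) and let $F\colon TM\to\mathbb R$ be a Finsler function: $F$ is continuous, smooth and positive on $\hat TM=TM\setminus\{0\}$, positively homogeneous of degree $1$ on each $T_xM$, and for every $x \in M$ and $0\neq y\in T_xM$ the bilinear form $g_{(x,y)}(u,v)=\frac12\frac{\partial^2F^2(x,y+su+tv)}{\partial s\,\partial t}\big|_{s=t=0}$ is positive definite. In the coordinates $(x^i,y^i)$ of $TM$ induced by a chart of $M$, put $$G^i=\tfrac14 g^{il}\Big(2\frac{\partial g_{jl}}{\partial x^k}-\frac{\partial g_{jk}}{\partial x^l}\Big)y^jy^k,\qquad G^i_j=\frac{\partial G^i}{\partial y^j},\qquad G^i_{jk}=\frac{\partial G^i_j}{\partial y^k},$$ $$R^i_{jk}=\frac{\partial G^i_j}{\partial x^k}-\frac{\partial G^i_k}{\partial x^j}+G^m_jG^i_{km}-G^m_kG^i_{jm}.$$ *Parallel translation and holonomy group.* A vector field $Y(t)\in T_{c(t)}M$ along a curve $c$ is parallel if $\dot Y^i+G^i_j(c,Y)\,\dot c^j=0$. Parallel translation along a smooth curve $c\colon[0,a]\to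 M$ preserves $F$, and so defines a diffeomorphism $\tau_c\colon\mathcal I_{c(0)}M\to\mathcal I_{c(a)}M$ between the indicatrices $\mathcal I_xM=\{y\in T_xM: F(x,y)=1\}$; for a piecewise smooth curve it is the composition of the translations along the smooth pieces. The holonomy group $\mathsf{Hol}(p)\subset\mathrm{Diff}^\infty(\mathcal I_pM)$ is the group determined by the parallel translations along piecewise smooth closed curves at $p$. *Holonomy algebra.* Let $\mathcal IM=\bigcup_x\mathcal I_xM$ be the indicatrix bundle, and identify vertical vectors at $y\in T_xM$ with elements of $T_xM$. For smooth vector fields $X,Y$ on $M$, the curvature vector field $r(X,Y)$ on $\mathcal IM$ has components $R^i_{jk}(x,y)X^j(x)Y^k(x)$; for a vertical vector field $\xi$ on $\mathcal IM$, extended to $\hat TM$ as a positively $1$-homogeneous field, the horizontal Berwald derivative $\nabla_X\xi$ has components $$\Big(\frac{\partial\xi^i}{\partial x^j}-G^k_j\frac{\partial\xi^i}{\partial y^k}+G^i_{jk}\xi^k\Big)X^j .$$ The fibred holonomy algebra $\mathfrak{hol_f}(M)$ is the smallest Lie algebra of vector fields on $\mathcal IM$ that contains all $r(X,Y)$ and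 contains $\nabla_X\xi$ whenever it contains $\xi$, for all smooth vector fields $X,Y$ on $M$. The infinitesimal holonomy algebra at $q\in M$ is $\mathfrak{hol}^*(q)=\{\xi|_{\mathcal I_qM}:\xi\in\mathfrak{hol_f}(M)\}$. For $p\in M$, the holonomy algebra $\mathfrak{hol}_p(M)$ is the smallest Lie algebra of vector fields on $\mathcal I_pM$ that contains the Berwald translates $(\tau_\gamma)_*\,\xi\circ\tau_\gamma^{-1}$ for all $q\in M$, all $\xi\in\mathfrak{hol}^*(q)$ and all (piecewise) smooth curves $\gamma$ from $q$ to $p$. **Theorem.** For every $p\in M$ the holonomy algebra $\mathfrak{hol}_p(M)$ is tangent to the holonomy group $\mathsf{Hol}(p)$. That is, every $\xi\in\mathfrak{hol}_p(M)$ is a smooth vector field on $\mathcal I_pM$, and there are $\varepsilon>0$ and a family $\phi_t\in\mathsf{Hol}(p)$, $t\in(-\varepsilon,\varepsilon)$, such that $(t,y)\mapsto\phi_t(y)$ is of class $C^1$, $\phi_0=\mathrm{Id}$ and $\frac{\partial\phi_t}{\partial t}\big|_{t=0}=\xi$. -/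

import Mathlib

open Set
open scoped Manifold ContDiff

noncomputable section

namespace Finsler

/-! ### Local coordinate expressions on an open subset of `ℝⁿ`

Below `L x y` is a Finsler function read in induced coordinates `(x, y)` of the tangent bundle. -/

/-- The model space `ℝⁿ`. -/
abbrev Coord (n : ℕ) : Type := EuclideanSpace ℝ (Fin n)

/-- The coordinate vector `∂/∂xⁱ`. -/
def basisVec {n : ℕ} (i : Fin n) : Coord n := EuclideanSpace.single i (1 : ℝ)

/-- The bilinear form `(u, v) ↦ ½ ∂²f²(y + s u + t v)/∂s∂t` at `s = t = 0`. -/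
def fundForm {n : ℕ} (f : Coord n → ℝ) (y u v : Coord n) : ℝ :=
  (1 / 2) * fderiv ℝ (fun y' => fderiv ℝ (fun y'' => f y'' ^ 2) y' v) y u

/-- The matrix `g_{ij}(x, y)` of the Finsler metric. -/
def metric {n : ℕ} (L : Coord n → Coord n → ℝ) (x y : Coord n) : Matrix (Fin n) (Fin n) ℝ :=
  Matrix.of fun i j => fundForm (L x) y (basisVec i) (basisVec j)

/-- The partial derivative `∂g_{ij}/∂xᵏ (x, y)`. -/
def metricDeriv {n : ℕ} (L : Coord n → Coord n → ℝ) (x y : Coord n) (i j k : Fin n) : ℝ :=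
  fderiv ℝ (fun x' => metric L x' y i j) x (basisVec k)

/-- The geodesic coefficients
`Gⁱ = ¼ gⁱˡ (2 ∂g_{jl}/∂xᵏ - ∂g_{jk}/∂xˡ) yʲ yᵏ`. -/
def spray {n : ℕ} (L : Coord n → Coord n → ℝ) (x y : Coord n) : Coord n :=
  WithLp.toLp 2 fun i => (1 / 4) * ∑ l : Fin n, ∑ j : Fin n, ∑ k : Fin n,
    (metric L x y)⁻¹ i l * (2 * metricDeriv L x y j l k - metricDeriv L x y j k l) * y j * y k

/-- The connection coefficients `Gⁱⱼ = ∂Gⁱ/∂yʲ`, as the linear map `u ↦ Gⁱⱼ(x, y) uʲ`. -/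
def conn {n : ℕ} (L : Coord n → Coord n → ℝ) (x y : Coord n) : Coord n →L[ℝ] Coord n :=
  fderiv ℝ (spray L x) y

/-- The curvature `Rⁱⱼₖ(x, y) uʲ wᵏ`, where
`Rⁱⱼₖ = ∂Gⁱⱼ/∂xᵏ - ∂Gⁱₖ/∂xʲ + Gᵐⱼ ∂Gⁱₖ/∂yᵐ - Gᵐₖ ∂Gⁱⱼ/∂yᵐ`. -/
def curv {n : ℕ} (L : Coord n → Coord n → ℝ) (x y u w : Coord n) : Coord n :=
  fderiv ℝ (fun x' => conn L x' y u) x w - fderiv ℝ (fun x' => conn L x' y w) x u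
    + fderiv ℝ (fun y' => conn L x y' w) y (conn L x y u)
    - fderiv ℝ (fun y' => conn L x y' u) y (conn L x y w)

/-- The horizontal Berwald derivative of `ξ = ξⁱ(x, y) ∂/∂yⁱ` in the direction `u`:
`(∂ξⁱ/∂xʲ - Gᵏⱼ ∂ξⁱ/∂yᵏ + ∂Gⁱⱼ/∂yᵏ ξᵏ) uʲ`. -/
def berwald {n : ℕ} (L : Coord n → Coord n → ℝ) (ξ : Coord n → Coord n → Coord n)
    (x y u : Coord n) : Coord n :=
  fderiv ℝ (fun x' => ξ x' y) x u - fderiv ℝ (ξ x) y (conn L x y u)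
    + fderiv ℝ (fun y' => conn L x y' u) y (ξ x y)

/-! ### Finsler manifolds -/

/-- A Finsler function on an `n`-dimensional smooth manifold `M`. -/
structure FinslerFunction (n : ℕ) (M : Type*) [TopologicalSpace M] [ChartedSpace (Coord n) M]
    [IsManifold (𝓡 n) ∞ M] where
  toFun : TangentBundle (𝓡 n) M → ℝ
  continuous_toFun : Continuous toFun
  smooth_toFun : ContMDiffOn (𝓡 n).tangent 𝓘(ℝ, ℝ) ∞ toFun {v | v.2 ≠ 0}
  pos : ∀ (p : M) (y : TangentSpace (𝓡 n) p), y ≠ 0 → 0 < toFun ⟨p, y⟩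
  homogeneous : ∀ (p : M) (y : TangentSpace (𝓡 n) p) (r : ℝ), 0 < r →
    toFun ⟨p, r • y⟩ = r * toFun ⟨p, y⟩
  posDef : ∀ (p : M) (y : Coord n), y ≠ 0 → ∀ u : Coord n, u ≠ 0 →
    0 < fundForm (fun y' : Coord n => toFun ⟨p, y'⟩) y u u

section

variable {n : ℕ} {M : Type*} [TopologicalSpace M] [ChartedSpace (Coord n) M]
  [IsManifold (𝓡 n) ∞ M] (F : FinslerFunction n M)

/-- The Finsler function on the fibre `T_pM` (which in Mathlib is `ℝⁿ`, by means of the preferred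
chart at `p`). -/
def FinslerFunction.fib (p : M) (y : Coord n) : ℝ := F.toFun ⟨p, y⟩

/-- The point of `M` with coordinates `x` in the chart around `x₀`. -/
def pointOf (x₀ : M) (x : Coord n) : M := (extChartAt (𝓡 n) x₀).symm x

/-- The tangent vector `yⁱ ∂/∂xⁱ` at `z`, where `(xⁱ)` are the coordinates of the chart around
`x₀`. -/
def vecOf (x₀ z : M) (y : Coord n) : Coord n := tangentCoordChange (𝓡 n) x₀ z z y

/-- The components of the tangent vector `v ∈ T_zM` in the coordinates of the chart around `x₀`. -/
def coordOf (x₀ z : M) (v : Coord n) : Coord n := tangentCoordChange (𝓡 n) z x₀ z v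

/-- The Finsler function in the coordinates `(x, y)` induced by the chart around `x₀`. -/
def FinslerFunction.inChart (x₀ : M) (x y : Coord n) : ℝ :=
  F.fib (pointOf x₀ x) (vecOf x₀ (pointOf x₀ x) y)

/-- The indicatrix `I_pM = {y ∈ T_pM | F(y) = 1}`. -/
def Indicatrix (p : M) : Type := {y : Coord n // F.fib p y = 1}

/-- The point `y / F(y)` of the indicatrix. -/
def normalize (p : M) (y : Coord n) (hy : y ≠ 0) : Indicatrix F p :=
  ⟨(F.fib p y)⁻¹ • y, by
    have h : 0 < F.fib p y := F.pos p y hy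
    have h2 : F.fib p ((F.fib p y)⁻¹ • y) = (F.fib p y)⁻¹ * F.fib p y :=
      F.homogeneous p y _ (inv_pos.mpr h)
    rw [h2, inv_mul_cancel₀ h.ne']⟩

open Classical in
/-- The positively `1`-homogeneous extension `y ↦ F(y) f(y / F(y))` to `T_pM ∖ {0}` of a map `f`
defined on the indicatrix `I_pM`, with values in a tangent space. Since `T_pM ∖ {0}` is the product
of `I_pM` and of the positive half-line, `f` is smooth on the hypersurface `I_pM` if and only if
this extension is smooth on `T_pM ∖ {0}`; and vector fields tangent to `I_pM` are bracketed
through their extensions. -/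
def homExt {p : M} (f : Indicatrix F p → Coord n) (y : Coord n) : Coord n :=
  if hy : y = 0 then 0 else F.fib p y • f (normalize F p y hy)

/-- Smoothness on the indicatrix. -/
def IsSmooth {p : M} (f : Indicatrix F p → Coord n) : Prop :=
  ContDiffOn ℝ ∞ (homExt F f) {0}ᶜ

theorem fib_zero (p : M) : F.fib p (0 : Coord n) = 0 := by
  have h : F.fib p ((2 : ℝ) • (0 : Coord n)) = 2 * F.fib p (0 : Coord n) :=
    F.homogeneous p _ 2 (by norm_num)
  rw [smul_zero] at h
  linarith

theorem indicatrix_ne_zero {p : M} (u : Indicatrix F p) : u.1 ≠ 0 := by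
  intro h
  have h1 := u.2
  rw [h, fib_zero] at h1
  exact zero_ne_one h1

theorem homExt_comp {p q r : M} (f : Indicatrix F q → Indicatrix F r)
    (g : Indicatrix F p → Indicatrix F q) (y : Coord n) :
    homExt F (fun u => (f (g u)).1) y
      = homExt F (fun u => (f u).1) (homExt F (fun u => (g u).1) y) := by
  by_cases hy : y = 0
  · simp [homExt, hy]
  · have h : 0 < F.fib p y := F.pos p y hy
    have hz : homExt F (fun u => (g u).1) y = F.fib p y • (g (normalize F p y hy)).1 := by
      simp [homExt, hy]
    have hne : F.fib p y • (g (normalize F p y hy)).1 ≠ 0 :=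
      smul_ne_zero h.ne' (indicatrix_ne_zero F _)
    have hF : F.fib q (F.fib p y • (g (normalize F p y hy)).1) = F.fib p y := by
      have h2 : F.fib q (F.fib p y • (g (normalize F p y hy)).1)
          = F.fib p y * F.fib q (g (normalize F p y hy)).1 := F.homogeneous q _ _ h
      rw [h2, (g (normalize F p y hy)).2, mul_one]
    have hn : normalize F q _ hne = g (normalize F p y hy) := by
      apply Subtype.ext
      change (F.fib q (F.fib p y • (g (normalize F p y hy)).1))⁻¹ •
        (F.fib p y • (g (normalize F p y hy)).1) = (g (normalize F p y hy)).1
      rw [hF, smul_smul, inv_mul_cancel₀ h.ne', one_smul]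
    rw [hz]
    simp only [homExt, hy, hne, dite_false, hn, hF]

theorem homExt_ne_zero {p q : M} (g : Indicatrix F p → Indicatrix F q) {y : Coord n}
    (hy : y ≠ 0) : homExt F (fun u => (g u).1) y ≠ 0 := by
  have h : 0 < F.fib p y := F.pos p y hy
  simp only [homExt, hy, dite_false]
  exact smul_ne_zero h.ne' (indicatrix_ne_zero F _)

theorem homExt_id {p : M} {y : Coord n} :
    homExt F (fun u : Indicatrix F p => u.1) y = y := by
  by_cases hy : y = 0
  · simp [homExt, hy]
  · have h : 0 < F.fib p y := F.pos p y hy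
    simp only [homExt, hy, dite_false, normalize]
    rw [smul_smul, mul_inv_cancel₀ h.ne', one_smul]

theorem isSmooth_id (p : M) : IsSmooth F (fun u : Indicatrix F p => u.1) :=
  contDiffOn_id.congr fun _ _ => homExt_id F

theorem IsSmooth.comp {p q r : M} {f : Indicatrix F q → Indicatrix F r}
    {g : Indicatrix F p → Indicatrix F q} (hf : IsSmooth F fun u => (f u).1)
    (hg : IsSmooth F fun u => (g u).1) : IsSmooth F fun u => (f (g u)).1 :=
  (ContDiffOn.comp hf hg fun _ hy => homExt_ne_zero F g hy).congr fun y _ => homExt_comp F f g y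

/-- The group of smooth diffeomorphisms of the indicatrix `I_pM`. -/
def IndicatrixDiffeo (p : M) : Subgroup (Equiv.Perm (Indicatrix F p)) where
  carrier := {φ | IsSmooth F (fun u => (φ u).1) ∧ IsSmooth F (fun u => (φ.symm u).1)}
  mul_mem' := fun ha hb => ⟨ha.1.comp F hb.1, hb.2.comp F ha.2⟩
  one_mem' := ⟨isSmooth_id F p, isSmooth_id F p⟩
  inv_mem' := fun ha => ⟨ha.2, ha.1⟩

/-- Smooth vector fields on `I_pM`: smooth maps `ξ : I_pM → T_pM` with `ξ(y)` in the tangent space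
`ker d_yF` of `I_pM` at `y`. -/
def IsVectorField {p : M} (ξ : Indicatrix F p → Coord n) : Prop :=
  IsSmooth F ξ ∧ ∀ y : Indicatrix F p, fderiv ℝ (F.fib p) y.1 (ξ y) = 0

/-- The Lie bracket of vector fields on `I_pM`. -/
def bracket {p : M} (ξ η : Indicatrix F p → Coord n) : Indicatrix F p → Coord n :=
  fun y => VectorField.lieBracket ℝ (homExt F ξ) (homExt F η) y.1

/-- The Lie algebra of vector fields on `I_pM` generated by a set `S` of vector fields, that is the
smallest one that contains `S`. -/
inductive LieHull {p : M} (S : Set (Indicatrix F p → Coord n)) :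
    (Indicatrix F p → Coord n) → Prop
  | of {ξ} : ξ ∈ S → LieHull S ξ
  | zero : LieHull S 0
  | add {ξ η} : LieHull S ξ → LieHull S η → LieHull S (ξ + η)
  | smul (r : ℝ) {ξ} : LieHull S ξ → LieHull S (r • ξ)
  | bracket {ξ η} : LieHull S ξ → LieHull S η → LieHull S (bracket F ξ η)

/-- Vertical vector fields on the indicatrix bundle `IM` (through the identification of the vertical
space at `y ∈ T_xM` with `T_xM`). -/
abbrev VertField : Type _ := ∀ x : M, Indicatrix F x → Coord n

/-- A smooth vector field on `M`. -/
def IsSmoothOnBase (X : ∀ x : M, TangentSpace (𝓡 n) x) : Prop :=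
  ContMDiff (𝓡 n) (𝓡 n).tangent ∞ fun x => (⟨x, X x⟩ : TangentBundle (𝓡 n) M)

/-- The curvature vector field `r(X, Y)(x, y) = R_{(x, y)}(X_x, Y_x)`. -/
def curvField (X Y : ∀ x : M, TangentSpace (𝓡 n) x) : VertField F :=
  fun p y => curv (F.inChart p) (extChartAt (𝓡 n) p p) y.1 (X p) (Y p)

/-- The (homogeneously extended) vertical field `ξ` in the coordinates `(x, y)` induced by the chart
around `x₀`. -/
def fieldInChart (ξ : VertField F) (x₀ : M) (x y : Coord n) : Coord n :=
  coordOf x₀ (pointOf x₀ x) (homExt F (ξ (pointOf x₀ x)) (vecOf x₀ (pointOf x₀ x) y))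

/-- The horizontal Berwald covariant derivative `∇_X ξ`. -/
def covDeriv (X : ∀ x : M, TangentSpace (𝓡 n) x) (ξ : VertField F) : VertField F :=
  fun p y => berwald (F.inChart p) (fieldInChart F ξ p) (extChartAt (𝓡 n) p p) y.1 (X p)

/-- The fibred holonomy algebra `hol_f(M)`: the smallest Lie algebra of vector fields on `IM` that
contains the curvature vector fields and is closed under horizontal Berwald derivatives. All these
fields are vertical, so that their bracket is taken in the fibres. -/
inductive FibredHolonomyAlgebra : VertField F → Prop
  | curv {X Y : ∀ x : M, TangentSpace (𝓡 n) x} : IsSmoothOnBase X → IsSmoothOnBase Y →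
      FibredHolonomyAlgebra (curvField F X Y)
  | cov {X : ∀ x : M, TangentSpace (𝓡 n) x} {ξ} : IsSmoothOnBase X → FibredHolonomyAlgebra ξ →
      FibredHolonomyAlgebra (covDeriv F X ξ)
  | zero : FibredHolonomyAlgebra 0
  | add {ξ η} : FibredHolonomyAlgebra ξ → FibredHolonomyAlgebra η → FibredHolonomyAlgebra (ξ + η)
  | smul (r : ℝ) {ξ} : FibredHolonomyAlgebra ξ → FibredHolonomyAlgebra (r • ξ)
  | bracket {ξ η} : FibredHolonomyAlgebra ξ → FibredHolonomyAlgebra η →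
      FibredHolonomyAlgebra (fun x => Finsler.bracket F (ξ x) (η x))

/-- The infinitesimal holonomy algebra `hol*(q) = {ξ_q | ξ ∈ hol_f(M)}`. -/
def infHolonomyAlgebra (q : M) : Set (Indicatrix F q → Coord n) :=
  {ζ | ∃ ξ : VertField F, FibredHolonomyAlgebra F ξ ∧ ζ = ξ q}

/-! ### Parallel translation and holonomy -/

/-- `Y` is a parallel vector field along the curve `c` on `[0, a]`: in the coordinates of every
chart, `dYⁱ/dt + Gⁱⱼ(c, Y) dcʲ/dt = 0`. -/
def IsParallel (c : ℝ → M) (a : ℝ) (Y : ℝ → TangentBundle (𝓡 n) M) : Prop :=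
  ∀ t ∈ Icc 0 a, (Y t).proj = c t ∧
    ∀ x₀ : M, c t ∈ (chartAt (Coord n) x₀).source →
      HasDerivWithinAt (fun s => coordOf x₀ (Y s).proj (Y s).2)
        (-(conn (F.inChart x₀) (extChartAt (𝓡 n) x₀ (c t)) (coordOf x₀ (Y t).proj (Y t).2)
          (derivWithin (fun s => extChartAt (𝓡 n) x₀ (c s)) (Icc 0 a) t)))
        (Icc 0 a) t

/-- `τ : I_qM → I_pM` is the parallel translation along the smooth curve `c : [0, a] → M` from `q`
to `p`. -/
def IsTranslation (c : ℝ → M) (a : ℝ) {q p : M} (τ : Indicatrix F q ≃ Indicatrix F p) : Prop :=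
  0 < a ∧ ContMDiffOn 𝓘(ℝ, ℝ) (𝓡 n) ∞ c (Icc 0 a) ∧ c 0 = q ∧ c a = p ∧
    ∀ y : Indicatrix F q, ∃ Y : ℝ → TangentBundle (𝓡 n) M,
      IsParallel F c a Y ∧ Y 0 = ⟨q, y.1⟩ ∧ Y a = ⟨p, (τ y).1⟩

/-- `τ : I_qM → I_pM` is the parallel translation along some piecewise smooth curve from `q` to `p`,
that is the composition of the parallel translations along finitely many consecutive smooth
curves. -/
inductive IsPiecewiseTranslation : ∀ q p : M, (Indicatrix F q ≃ Indicatrix F p) → Prop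
  | refl (p : M) : IsPiecewiseTranslation p p (Equiv.refl _)
  | step {q r p : M} {σ : Indicatrix F q ≃ Indicatrix F r} {τ : Indicatrix F r ≃ Indicatrix F p}
      {c : ℝ → M} {a : ℝ} : IsPiecewiseTranslation q r σ → IsTranslation F c a τ →
      IsPiecewiseTranslation q p (σ.trans τ)

/-- The holonomy group `Hol(p)`: the subgroup of the diffeomorphism group of the indicatrix `I_pM`
determined by the parallel translations along the piecewise smooth closed curves at `p`. -/
def Hol (p : M) : Subgroup (IndicatrixDiffeo F p) :=
  Subgroup.closure {φ | IsPiecewiseTranslation F p p φ.1}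

/-- The Berwald translate `τ_* ξ ∘ τ⁻¹` of a vector field `ξ` on `I_qM`. -/
def berwaldTranslate {q p : M} (τ : Indicatrix F q ≃ Indicatrix F p)
    (ξ : Indicatrix F q → Coord n) : Indicatrix F p → Coord n :=
  fun y => fderiv ℝ (homExt F fun u => (τ u).1) (τ.symm y).1 (ξ (τ.symm y))

/-- The holonomy algebra `hol_p(M)`: the smallest Lie algebra of vector fields on `I_pM` containing
the Berwald translates, along arbitrary curves from any point `q` to `p`, of the elements of
`hol*(q)`. -/
def holonomyAlgebra (p : M) : Set (Indicatrix F p → Coord n) :=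
  {ζ | LieHull F {η | ∃ (q : M) (τ : Indicatrix F q ≃ Indicatrix F p)
    (ξ : Indicatrix F q → Coord n), IsPiecewiseTranslation F q p τ ∧ ξ ∈ infHolonomyAlgebra F q ∧
      η = berwaldTranslate F τ ξ} ζ}

/-- The smooth vector field `ξ` on `I_pM` is tangent to the subgroup `H` of the diffeomorphism group
of `I_pM`: there is a `C¹` family `φ_t ∈ H`, `|t| < ε`, with `φ_0 = id` and
`∂φ_t/∂t = ξ` at `t = 0`. -/
def IsTangentTo {p : M} (H : Subgroup (IndicatrixDiffeo F p)) (ξ : Indicatrix F p → Coord n) :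
    Prop :=
  IsVectorField F ξ ∧ ∃ ε > (0 : ℝ), ∃ φ : ℝ → IndicatrixDiffeo F p,
    (∀ t ∈ Ioo (-ε) ε, φ t ∈ H) ∧ φ 0 = 1 ∧
    ContDiffOn ℝ 1 (fun z : ℝ × Coord n => homExt F (fun u => ((φ z.1).1 u).1) z.2)
      (Ioo (-ε) ε ×ˢ {0}ᶜ) ∧
    ∀ y : Indicatrix F p, HasDerivAt (fun t => ((φ t).1 y).1) (ξ y) 0

end

end Finsler

end

/-! Everything rests on one fact about commutators. If two smooth families of local diffeomorphisms
have the form id + tᵏ α + o(tᵏ) and id + tˡ β + o(tˡ), their group commutator is id + tᵏ⁺ˡ (Dα·β -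
Dβ·α) + o(tᵏ⁺ˡ) (`commutator_hasOrderAt`). It is applied to maps (x, y) ↦ (x + t u, Φ(t, x, y)) of
the slit tangent bundle in a chart, where Φ is a parallel translation that depends smoothly on t and
on the base point x.

Translation along the coordinate segment from x to x + t u has order 1, and its coefficient is the
horizontal lift (u, -G(x, y) u). The commutator of two segment families translates around a
parallelogram. Its coefficient is the bracket of two horizontal lifts, which is the curvature. The
commutator of a family of loops with a segment family is again a family of loops, and its
coefficient is the Berwald derivative of the previous one. Two families of loops give the Lie
bracket of their coefficients. The loops must be based at all points near a given one, since the
Berwald derivative also differentiates in x. Curvature and Berwald derivatives along non-constant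
vector fields are combinations of those along ∂/∂xⁱ with coefficients smooth in x, so the right
object is the module `LeadSpan` over smooth functions of x. By the Leibniz rule it inherits the
closure under commutators (`LeadSpan.comm_lead`, `LeadSpan.comm`). Hence it contains the local
expression of every element of the fibred holonomy algebra (`FibredHolonomyAlgebra.leadSpan`).
Conjugation by a translation from q to p carries loops at q to holonomy elements at p and leading
coefficients to Berwald translates (`LeadSpan.conj`), and over p the span is again closed under
brackets.

It remains to turn an element of the span into a C¹ family. A family id + tᵏ ζ + o(tᵏ) is
reparametrized by t = s^{1/k} for s ≥ 0 and continued by its inverse family for s < 0. By Hadamard's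
lemma it equals id + tᵏ A with A smooth, so the result is id + s A(|s|^{1/k}, ·), which is C¹ with
velocity ζ (`contDiffAt_rootFamily`). Sums and real multiples of velocities come from composing and
rescaling such families. This is done only at the very end: commutators need smooth families, and
the root destroys smoothness.

Two supporting theories are needed. Analytically, the smooth dependence of parallel translation on
curve and initial vector is obtained by solving the integral equation with the implicit function
theorem in spaces of continuous functions (`exists_local_flow`). Geometrically, the curvature and
the Berwald derivative are defined at each point in the chart centred there and must be moved to one
fixed chart. Their covariance is derived from the Euler–Lagrange characterization of the spray
(`FinslerNear.spray_char`). -/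

noncomputable section

namespace Finsler

open Filter Topology

set_option linter.unusedSectionVars false

/-! ### Smoothness in a neighbourhood of a point -/

section SmoothNear

variable {X Y Z : Type*} [NormedAddCommGroup X] [NormedSpace ℝ X]
  [NormedAddCommGroup Y] [NormedSpace ℝ Y] [NormedAddCommGroup Z] [NormedSpace ℝ Z]

/-- `f` is smooth at every point of a neighbourhood of `x`. -/
def SmoothNear (f : X → Y) (x : X) : Prop := ∀ᶠ x' in 𝓝 x, ContDiffAt ℝ ∞ f x'

theorem SmoothNear.contDiffAt {f : X → Y} {x : X} (h : SmoothNear f x) : ContDiffAt ℝ ∞ f x :=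
  h.self_of_nhds

/-- The point of the definition: the condition is open. The neighbourhoods implicit in `ContDiffAt ℝ
∞` may shrink as the order grows, so that condition at a single point does not spread to a
neighbourhood. -/
theorem SmoothNear.eventually {f : X → Y} {x : X} (h : SmoothNear f x) :
    ∀ᶠ x' in 𝓝 x, SmoothNear f x' :=
  eventually_eventually_nhds.mpr h

theorem SmoothNear.continuousAt {f : X → Y} {x : X} (h : SmoothNear f x) : ContinuousAt f x :=
  h.contDiffAt.continuousAt

theorem SmoothNear.differentiableAt {f : X → Y} {x : X} (h : SmoothNear f x) :
    DifferentiableAt ℝ f x :=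
  h.contDiffAt.differentiableAt (by simp)

theorem SmoothNear.hasStrictFDerivAt {f : X → Y} {x : X} (h : SmoothNear f x) :
    HasStrictFDerivAt f (fderiv ℝ f x) x :=
  h.contDiffAt.hasStrictFDerivAt (by simp)

theorem SmoothNear.comp {g : Y → Z} {f : X → Y} {x : X} (hg : SmoothNear g (f x))
    (hf : SmoothNear f x) : SmoothNear (fun x' => g (f x')) x := by
  filter_upwards [hf, hf.continuousAt.eventually hg] with x' h1 h2
  exact h2.comp x' h1

theorem SmoothNear.congr {f g : X → Y} {x : X} (hf : SmoothNear f x) (h : g =ᶠ[𝓝 x] f) :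
    SmoothNear g x := by
  filter_upwards [hf, h.eventuallyEq_nhds] with x' h1 h2
  exact h1.congr_of_eventuallyEq h2

theorem smoothNear_of_contDiff {f : X → Y} (hf : ContDiff ℝ ∞ f) (x : X) : SmoothNear f x :=
  Eventually.of_forall fun _ => hf.contDiffAt

theorem SmoothNear.prodMk {f : X → Y} {g : X → Z} {x : X} (hf : SmoothNear f x)
    (hg : SmoothNear g x) : SmoothNear (fun x' => (f x', g x')) x := by
  filter_upwards [hf, hg] with x' h1 h2
  exact h1.prodMk h2

theorem SmoothNear.fderiv {f : X → Y} {x : X} (hf : SmoothNear f x) :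
    SmoothNear (fderiv ℝ f) x := by
  filter_upwards [hf] with x' h1
  exact h1.fderiv_right (by simp)

end SmoothNear

/-! ### Composition operators on spaces of continuous functions -/

section Nemytskii

variable {K : Type*} {P G : Type} [TopologicalSpace K] [CompactSpace K]
  [NormedAddCommGroup P] [NormedSpace ℝ P] [NormedAddCommGroup G] [NormedSpace ℝ G]

open Classical in
/-- The composition operator `u ↦ f ∘ u` (and `0` where `f ∘ u` is not continuous). -/
def compMap (f : P → G) (u : C(K, P)) : C(K, G) :=
  if h : Continuous (fun k => f (u k)) then ⟨fun k => f (u k), h⟩ else 0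

theorem compMap_apply {f : P → G} {u : C(K, P)} (h : ∀ k, ContinuousAt f (u k)) (k : K) :
    compMap f u k = f (u k) := by
  have : Continuous (fun k => f (u k)) := continuous_iff_continuousAt.mpr fun k =>
    (h k).comp u.continuous.continuousAt
  simp [compMap, this]

/-- Pointwise application of continuous linear maps. -/
def pointwiseApply : C(K, P →L[ℝ] G) →L[ℝ] C(K, P) →L[ℝ] C(K, G) :=
  LinearMap.mkContinuous₂ (LinearMap.mk₂ ℝ
    (fun (A : C(K, P →L[ℝ] G)) (h : C(K, P)) =>
      (⟨fun k => A k (h k), A.continuous.clm_apply h.continuous⟩ : C(K, G)))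
    (fun A B h => by ext; simp) (fun r A h => by ext; simp)
    (fun A h k => by ext; simp) (fun r A h => by ext; simp)) 1 fun A h => by
      rw [one_mul]
      refine (ContinuousMap.norm_le _ (by positivity)).mpr fun k => ?_
      exact (A k).le_of_opNorm_le_of_le (A.norm_coe_le_norm k) (h.norm_coe_le_norm k)

@[simp] theorem pointwiseApply_apply (A : C(K, P →L[ℝ] G)) (h : C(K, P)) (k : K) :
    pointwiseApply A h k = A k (h k) := rfl

/-- By compactness of `K` the first-order Taylor estimate for `f` holds uniformly along the image of
`u`, and a uniform pointwise estimate is an estimate in the sup norm. -/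
theorem hasFDerivAt_compMap {f : P → G} {u : C(K, P)} (hf : ∀ k, SmoothNear f (u k)) :
    HasFDerivAt (compMap f) (pointwiseApply (compMap (fderiv ℝ f) u) : C(K, P) →L[ℝ] C(K, G))
      u := by
  rw [hasFDerivAt_iff_isLittleO_nhds_zero, Asymptotics.isLittleO_iff]
  intro c hc
  have key : ∀ᶠ v in 𝓝 (0 : P), ∀ k ∈ (univ : Set K), ContDiffAt ℝ ∞ f (u k + v) ∧
      ‖f (u k + v) - f (u k) - fderiv ℝ f (u k) v‖ ≤ c * ‖v‖ := by
    refine isCompact_univ.eventually_forall_of_forall_eventually fun k₀ _ => ?_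
    have hlim : Tendsto (fun z : P × K => (u z.2 + z.1, u z.2)) (𝓝 (0, k₀))
        (𝓝 (u k₀, u k₀)) := by
      have : Continuous (fun z : P × K => (u z.2 + z.1, u z.2)) := by fun_prop
      simpa using this.tendsto (0, k₀)
    -- Strict differentiability allows the base point `u z.2` to vary with the derivative frozen at
    -- `u k₀`. Continuity of the derivative then unfreezes it, at the cost of the other half of `c`.
    have h1 := (hf k₀).hasStrictFDerivAt.isLittleO.bound (half_pos hc)
    have h2 : ∀ᶠ q in 𝓝 (u k₀), ‖fderiv ℝ f q - fderiv ℝ f (u k₀)‖ < c / 2 := by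
      have := (hf k₀).fderiv.continuousAt
      simpa [dist_eq_norm] using Metric.tendsto_nhds.mp this (c / 2) (half_pos hc)
    filter_upwards [hlim.eventually h1,
      ((continuous_snd.tendsto _).comp hlim).eventually h2,
      ((continuous_fst.tendsto _).comp hlim).eventually (hf k₀)] with z hz1 hz2 hz3
    refine ⟨hz3, ?_⟩
    simp only [add_sub_cancel_left, Function.comp_apply] at hz1 hz2
    calc ‖f (u z.2 + z.1) - f (u z.2) - fderiv ℝ f (u z.2) z.1‖
        = ‖(f (u z.2 + z.1) - f (u z.2) - fderiv ℝ f (u k₀) z.1)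
            - (fderiv ℝ f (u z.2) - fderiv ℝ f (u k₀)) z.1‖ := by
          congr 1; rw [sub_apply]; abel
      _ ≤ c / 2 * ‖z.1‖ + c / 2 * ‖z.1‖ :=
          (norm_sub_le _ _).trans (add_le_add hz1
            (ContinuousLinearMap.le_of_opNorm_le _ hz2.le _))
      _ = c * ‖z.1‖ := by ring
  obtain ⟨δ, hδ, hδ'⟩ := Metric.eventually_nhds_iff.mp key
  filter_upwards [Metric.ball_mem_nhds (0 : C(K, P)) hδ] with h hh
  have hk : ∀ k, ‖h k‖ < δ := fun k =>
    (h.norm_coe_le_norm k).trans_lt (by simpa using hh)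
  refine (ContinuousMap.norm_le _ (by positivity)).mpr fun k => ?_
  have h1 : compMap f (u + h) k = f (u k + h k) := compMap_apply (u := u + h) (fun k =>
    (hδ' (by simpa using hk k) k (mem_univ k)).1.continuousAt) k
  have h2 : compMap f u k = f (u k) := compMap_apply (fun k => (hf k).continuousAt) k
  have h3 : compMap (fderiv ℝ f) u k = fderiv ℝ f (u k) :=
    compMap_apply (fun k => (hf k).fderiv.continuousAt) k
  simp only [ContinuousMap.sub_apply, h1, h2, pointwiseApply_apply, h3]
  exact ((hδ' (by simpa using hk k) k (mem_univ k)).2).trans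
    (mul_le_mul_of_nonneg_left (h.norm_coe_le_norm k) hc.le)

theorem eventually_smoothNear_comp {f : P → G} {u : C(K, P)} (hf : ∀ k, SmoothNear f (u k)) :
    ∀ᶠ u' in 𝓝 u, ∀ k : K, SmoothNear f (u' k) := by
  have hO : IsOpen {p | SmoothNear f p} := isOpen_iff_mem_nhds.mpr fun p hp => hp.eventually
  filter_upwards [(ContinuousMap.isOpen_setOfPred_mapsTo isCompact_univ hO).mem_nhds
    (fun k _ => hf k : MapsTo u univ {p | SmoothNear f p})] with u' h k
  exact h (mem_univ k)

/-- The derivative of a composition operator is the composition operator of `fderiv ℝ f`, followed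
by a bounded bilinear map. The codomain therefore changes from `G` to `P →L[ℝ] G`, and the induction
must range over all codomains. -/
theorem contDiffAt_compMap_nat (m : ℕ) : ∀ {G : Type} [NormedAddCommGroup G] [NormedSpace ℝ G]
    {f : P → G} {u : C(K, P)}, (∀ k, SmoothNear f (u k)) → ContDiffAt ℝ m (compMap f) u := by
  induction m with
  | zero =>
    intro G _ _ f u hf
    refine contDiffAt_zero.mpr ⟨_, eventually_smoothNear_comp hf, fun u' h => ?_⟩
    exact (hasFDerivAt_compMap h).continuousAt.continuousWithinAt
  | succ m ih =>
    intro G _ _ f u hf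
    refine contDiffAt_succ_iff_hasFDerivAt.mpr
      ⟨fun u' => pointwiseApply (compMap (fderiv ℝ f) u'),
        ⟨_, eventually_smoothNear_comp hf, fun u' h => hasFDerivAt_compMap h⟩, ?_⟩
    exact (pointwiseApply (K := K) (P := P) (G := G)).contDiff.contDiffAt.comp u
      (ih fun k => (hf k).fderiv)

theorem smoothNear_compMap {f : P → G} {u : C(K, P)} (hf : ∀ k, SmoothNear f (u k)) :
    SmoothNear (compMap f) u := by
  filter_upwards [eventually_smoothNear_comp hf] with u' h
  exact contDiffAt_infty.mpr fun m => contDiffAt_compMap_nat m h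

end Nemytskii

/-! ### A smooth implicit function theorem -/

section Implicit

variable {X Y : Type} [NormedAddCommGroup X] [NormedSpace ℝ X] [CompleteSpace X]
  [NormedAddCommGroup Y] [NormedSpace ℝ Y] [CompleteSpace Y]

/-- The inverse function theorem is applied to (x, y) ↦ (x, f(x, y)). The partial derivative in y is
assumed to be the identity, so the differential is a shear and invertible without further
hypotheses. -/
theorem exists_smooth_implicit {f : X × Y → Y} {x₀ : X} {y₀ : Y} (hf : SmoothNear f (x₀, y₀))
    (h0 : f (x₀, y₀) = 0) {L : X →L[ℝ] Y}
    (hd : HasFDerivAt f (L.comp (.fst ℝ X Y) + .snd ℝ X Y) (x₀, y₀)) :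
    ∃ g : X → Y, SmoothNear g x₀ ∧ g x₀ = y₀ ∧ ∀ᶠ x in 𝓝 x₀, f (x, g x) = 0 := by
  let Θ : X × Y → X × Y := fun z => (z.1, f z)
  have hΘ : SmoothNear Θ (x₀, y₀) := (smoothNear_of_contDiff contDiff_fst _).prodMk hf
  let e : (X × Y) ≃L[ℝ] X × Y := (ContinuousLinearEquiv.refl ℝ X).skewProd (.refl ℝ Y) L
  have hde : HasFDerivAt Θ (e : X × Y →L[ℝ] X × Y) (x₀, y₀) := by
    refine (hasFDerivAt_fst.prodMk hd).congr_fderiv ?_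
    ext z <;> simp [e]
  let φ := hΘ.contDiffAt.toOpenPartialHomeomorph Θ hde (by simp)
  have hcoe : ∀ z, φ z = Θ z := fun z => rfl
  have hsrc : (x₀, y₀) ∈ φ.source := hΘ.contDiffAt.mem_toOpenPartialHomeomorph_source hde (by simp)
  have hbase : φ (x₀, y₀) = (x₀, 0) := by rw [hcoe]; simp [Θ, h0]
  have htgt : (x₀, (0 : Y)) ∈ φ.target := hbase ▸ φ.map_source hsrc
  have hsymm : φ.symm (x₀, 0) = (x₀, y₀) := by rw [← hbase, φ.left_inv hsrc]
  have hcont : ContinuousAt φ.symm (x₀, 0) := φ.continuousAt_symm htgt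
  -- For smoothness of the inverse on a whole neighbourhood the differential must be invertible at
  -- nearby points too, and invertibility is an open condition.
  have hinv : ∀ᶠ z in 𝓝 (x₀, y₀), ∃ e' : (X × Y) ≃L[ℝ] X × Y,
      (e' : X × Y →L[ℝ] X × Y) = fderiv ℝ Θ z := by
    have h1 : range ((↑) : ((X × Y) ≃L[ℝ] X × Y) → X × Y →L[ℝ] X × Y)
        ∈ 𝓝 (fderiv ℝ Θ (x₀, y₀)) := by
      rw [hde.fderiv]; exact ContinuousLinearEquiv.nhds e
    exact hΘ.fderiv.continuousAt.eventually h1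
  have hsm : SmoothNear φ.symm (x₀, 0) := by
    have h2 : ∀ᶠ z in 𝓝 (φ.symm (x₀, 0)), ContDiffAt ℝ ∞ Θ z ∧ ∃ e' : (X × Y) ≃L[ℝ] X × Y,
      (e' : X × Y →L[ℝ] X × Y) = fderiv ℝ Θ z := by rw [hsymm]; exact hΘ.and hinv
    filter_upwards [hcont.eventually h2, φ.open_target.mem_nhds htgt] with z hz hzt
    obtain ⟨hz1, e', he'⟩ := hz
    refine φ.contDiffAt_symm hzt (f₀' := e') ?_ hz1
    rw [he']
    exact (hz1.differentiableAt (by simp)).hasFDerivAt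
  have hin : SmoothNear (fun x : X => (x, (0 : Y))) x₀ :=
    smoothNear_of_contDiff (by fun_prop) _
  refine ⟨fun x => (φ.symm (x, 0)).2, ?_, by simp [hsymm], ?_⟩
  · exact SmoothNear.comp (g := Prod.snd) (smoothNear_of_contDiff contDiff_snd _)
      (SmoothNear.comp (g := φ.symm) hsm hin)
  · filter_upwards [hin.continuousAt.eventually (φ.open_target.mem_nhds htgt)] with x hx
    have h3 : Θ (φ.symm (x, 0)) = (x, 0) := φ.right_inv hx
    have h4 : (φ.symm (x, 0)).1 = x := congrArg Prod.fst h3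
    have h5 : f (φ.symm (x, 0)) = 0 := congrArg Prod.snd h3
    have h6 : (x, (φ.symm (x, 0)).2) = φ.symm (x, 0) := Prod.ext h4.symm rfl
    exact (congrArg f h6).trans h5

end Implicit

/-! ### Ordinary differential equations -/

section ODE

variable {P E : Type} [NormedAddCommGroup P] [NormedSpace ℝ P]
  [NormedAddCommGroup E] [NormedSpace ℝ E] [CompleteSpace E]

open unitInterval

/-- The primitive `s ↦ ∫₀ˢ γ`. -/
def primitive : C(I, E) →L[ℝ] C(I, E) :=
  LinearMap.mkContinuous
    { toFun := fun γ => ⟨fun s => ∫ r in (0 : ℝ)..s, IccExtend zero_le_one γ r, by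
        have h : Continuous (IccExtend zero_le_one γ) := γ.continuous.Icc_extend'
        exact (intervalIntegral.continuous_primitive (fun a b => h.intervalIntegrable a b) 0).comp
          continuous_subtype_val⟩
      map_add' := fun γ η => by
        ext s
        have h : Continuous (IccExtend zero_le_one γ) := γ.continuous.Icc_extend'
        have h' : Continuous (IccExtend zero_le_one η) := η.continuous.Icc_extend'
        simpa [IccExtend] using
          intervalIntegral.integral_add (h.intervalIntegrable 0 s) (h'.intervalIntegrable 0 s)
      map_smul' := fun r γ => by
        ext s
        simp [IccExtend, intervalIntegral.integral_smul] } 1 fun γ => by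
    refine (ContinuousMap.norm_le _ (by positivity)).mpr fun s => ?_
    have h := intervalIntegral.norm_integral_le_of_norm_le_const (a := (0 : ℝ)) (b := s)
      (f := IccExtend zero_le_one γ) (C := ‖γ‖) fun x _ => γ.norm_coe_le_norm _
    refine h.trans ?_
    rw [sub_zero, abs_of_nonneg s.2.1, one_mul]
    exact mul_le_of_le_one_right (norm_nonneg _) s.2.2

theorem primitive_apply (γ : C(I, E)) (s : I) :
    primitive γ s = ∫ r in (0 : ℝ)..s, IccExtend zero_le_one γ r := rfl

theorem primitive_zero_right (γ : C(I, E)) : primitive γ 0 = 0 := by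
  simp [primitive_apply]

/-- `γ` solves `γ' = f(u, γ)`, with values in the domain where `f` is smooth. -/
structure Solves (f : P × E → E) (u : C(I, P)) (γ : C(I, E)) : Prop where
  smooth : ∀ s, SmoothNear f (u s, γ s)
  eq : γ = .const I (γ 0) + primitive (compMap f (u.prodMk γ))

theorem Solves.hasDerivWithinAt {f : P × E → E} {u : C(I, P)} {γ : C(I, E)} (h : Solves f u γ)
    {s : ℝ} (hs : s ∈ Icc (0 : ℝ) 1) :
    HasDerivWithinAt (IccExtend zero_le_one γ) (f (u ⟨s, hs⟩, γ ⟨s, hs⟩)) (Icc 0 1) s := by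
  have hc : Continuous (IccExtend zero_le_one (compMap f (u.prodMk γ))) :=
    (compMap f (u.prodMk γ)).continuous.Icc_extend'
  have h1 := (intervalIntegral.integral_hasDerivAt_right (hc.intervalIntegrable 0 s)
    (hc.stronglyMeasurableAtFilter _ _) hc.continuousAt).const_add (γ 0)
  have h2 : IccExtend zero_le_one (compMap f (u.prodMk γ)) s = f (u ⟨s, hs⟩, γ ⟨s, hs⟩) := by
    rw [IccExtend_of_mem _ _ hs]
    exact compMap_apply (u := u.prodMk γ) (fun k => (h.smooth k).continuousAt) _
  rw [h2] at h1
  refine h1.hasDerivWithinAt.congr_of_mem (fun r hr => ?_) hs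
  rw [IccExtend_of_mem _ _ hr]
  conv_lhs => rw [h.eq]
  rfl

/-- The equation γ = y + ∫ f(u, γ) is solved for γ in C([0, 1], E) as an implicit function of the
control u and the initial value y. At the constant control `p₀`, where f vanishes for all nearby y,
the linearization in γ is the identity. No short-time argument is needed: shortness is encoded by a
control close to a constant. -/
theorem exists_local_flow [CompleteSpace P] {f : P × E → E} {p₀ : P} {y₀ : E}
    (hf : SmoothNear f (p₀, y₀))
    (h0 : ∀ᶠ y in 𝓝 y₀, f (p₀, y) = 0) :
    ∃ S : C(I, P) × E → C(I, E), SmoothNear S (.const I p₀, y₀) ∧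
      S (.const I p₀, y₀) = .const I y₀ ∧
      ∀ᶠ z in 𝓝 ((.const I p₀, y₀) : C(I, P) × E), Solves f z.1 (S z) ∧ S z 0 = z.2 := by
  let pr : (C(I, P) × E) × C(I, E) →L[ℝ] C(I, P × E) := LinearMap.mkContinuous
    { toFun := fun z => z.1.1.prodMk z.2
      map_add' := fun _ _ => rfl
      map_smul' := fun _ _ => rfl } 1 fun z => by
        rw [one_mul]
        refine (ContinuousMap.norm_le _ (by positivity)).mpr fun s => ?_
        exact max_le (((z.1.1.norm_coe_le_norm s).trans (norm_fst_le z.1)).trans (norm_fst_le z))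
          ((z.2.norm_coe_le_norm s).trans (norm_snd_le z))
  let cst : E →L[ℝ] C(I, E) := LinearMap.mkContinuous
    { toFun := fun y => .const I y
      map_add' := fun _ _ => rfl
      map_smul' := fun _ _ => rfl } 1 fun y => by
        rw [one_mul]
        exact (ContinuousMap.norm_le _ (by positivity)).mpr fun s => le_rfl
  let Ξ : (C(I, P) × E) × C(I, E) → C(I, E) := fun z =>
    z.2 - cst z.1.2 - primitive (compMap f (pr z))
  let b : (C(I, P) × E) × C(I, E) := ((.const I p₀, y₀), .const I y₀)
  have hb : ∀ s, SmoothNear f (pr b s) := fun _ => hf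
  have hcomp : SmoothNear (fun z => compMap f (pr z)) b :=
    SmoothNear.comp (smoothNear_compMap hb) (smoothNear_of_contDiff pr.contDiff b)
  have hΞ : SmoothNear Ξ b := by
    filter_upwards [hcomp] with z hz
    exact (contDiffAt_snd.sub (cst.contDiff.contDiffAt.comp z
      (contDiffAt_snd.comp z contDiffAt_fst))).sub ((primitive (E := E)).contDiff.contDiffAt.comp z hz)
  have hzero : compMap f (pr b) = 0 := by
    ext s
    rw [compMap_apply fun k => (hb k).continuousAt]
    exact h0.self_of_nhds
  let A := pointwiseApply (compMap (fderiv ℝ f) (pr b))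
  -- Since `f (p₀, ·)` vanishes near `y₀`, so does its derivative. This removes the integral term
  -- from the γ-derivative of `Ξ`.
  have hfd : ∀ v : E, fderiv ℝ f (p₀, y₀) (0, v) = 0 := by
    intro v
    have h1 : HasFDerivAt (fun y => f (p₀, y)) ((fderiv ℝ f (p₀, y₀)).comp (.inr ℝ P E)) y₀ :=
      hf.differentiableAt.hasFDerivAt.comp y₀ (hasFDerivAt_prodMk_right p₀ y₀)
    have h2 : HasFDerivAt (fun y => f (p₀, y)) (0 : E →L[ℝ] E) y₀ :=
      (hasFDerivAt_const (0 : E) y₀).congr_of_eventuallyEq h0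
    have := DFunLike.congr_fun (h1.unique h2) v
    simpa using this
  have hA : ∀ v : C(I, E), A (pr (0, v)) = 0 := by
    intro v
    ext s
    change compMap (fderiv ℝ f) (pr b) s (pr (0, v) s) = 0
    rw [compMap_apply fun k => (hb k).fderiv.continuousAt]
    exact hfd (v s)
  let L : C(I, P) × E →L[ℝ] C(I, E) :=
    -(cst.comp (.snd ℝ _ _)) - primitive.comp (A.comp (pr.comp (.inl ℝ _ _)))
  have hd : HasFDerivAt Ξ (L.comp (.fst ℝ _ _) + .snd ℝ _ _) b := by
    have h1 : HasFDerivAt (fun z => compMap f (pr z)) (A.comp pr) b :=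
      (hasFDerivAt_compMap hb).comp b pr.hasFDerivAt
    have h2 := (hasFDerivAt_snd (𝕜 := ℝ) (p := b)).sub
      (cst.hasFDerivAt.comp b ((hasFDerivAt_snd (𝕜 := ℝ) (p := b.1)).comp b
        (hasFDerivAt_fst (𝕜 := ℝ) (p := b))))
    refine (h2.sub (primitive.hasFDerivAt.comp b h1)).congr_fderiv ?_
    refine ContinuousLinearMap.ext fun z => ?_
    have h3 : A (pr z) = A (pr (z.1, 0)) := by
      have : z = (z.1, 0) + (0, z.2) := by simp
      conv_lhs => rw [this, map_add, map_add, hA, add_zero]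
    simp only [L, ContinuousLinearMap.comp_apply, sub_apply, add_apply, neg_apply,
      ContinuousLinearMap.coe_fst', ContinuousLinearMap.coe_snd', ContinuousLinearMap.inl_apply, h3]
    abel
  obtain ⟨S, hS1, hS2, hS3⟩ := exists_smooth_implicit (x₀ := b.1) (y₀ := b.2) hΞ (by
    change b.2 - cst b.1.2 - primitive (compMap f (pr b)) = 0
    rw [hzero, map_zero, sub_zero]
    exact sub_self _) hd
  refine ⟨S, hS1, hS2, ?_⟩
  have hc : Tendsto (fun z => pr (z, S z)) (𝓝 b.1) (𝓝 (pr b)) := by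
    have : ContinuousAt (fun z => pr (z, S z)) b.1 :=
      pr.continuous.continuousAt.comp (continuousAt_id.prodMk hS1.continuousAt)
    have h4 : pr (b.1, S b.1) = pr b := by rw [hS2]
    simpa only [ContinuousAt, h4] using this
  filter_upwards [hS3, hc.eventually (eventually_smoothNear_comp hb)] with z hz1 hz2
  have h5 : S z = .const I z.2 + primitive (compMap f (z.1.prodMk (S z))) := by
    have : S z - cst z.2 - primitive (compMap f (pr (z, S z))) = 0 := hz1
    rw [sub_sub, sub_eq_zero] at this
    exact this
  have h6 : S z 0 = z.2 := by
    rw [h5, ContinuousMap.add_apply, primitive_zero_right]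
    simp
  exact ⟨⟨hz2, by rw [h6]; exact h5⟩, h6⟩

/-- Grönwall's inequality for γ - η. As `f` is only known to be smooth near the two curves, the
Lipschitz bound is required just between γ(s) and η(s). It is found locally in s and patched
together by compactness of the interval. -/
theorem ode_unique {f : P × E → E} {u : ℝ → P} {γ η : ℝ → E} {a b : ℝ}
    (hu : ContinuousOn u (Icc a b))
    (hγ : ∀ s ∈ Icc a b, HasDerivWithinAt γ (f (u s, γ s)) (Icc a b) s)
    (hη : ∀ s ∈ Icc a b, HasDerivWithinAt η (f (u s, η s)) (Icc a b) s)
    (hfγ : ∀ s ∈ Icc a b, SmoothNear f (u s, γ s))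
    (hfη : ∀ s ∈ Icc a b, SmoothNear f (u s, η s)) (h0 : γ a = η a) :
    EqOn γ η (Icc a b) := by
  have cγ : ContinuousOn γ (Icc a b) := fun s hs => (hγ s hs).continuousWithinAt
  have cη : ContinuousOn η (Icc a b) := fun s hs => (hη s hs).continuousWithinAt
  have hloc : ∃ C : ℝ, ∀ s ∈ Icc a b, ‖f (u s, γ s) - f (u s, η s)‖ ≤ C * ‖γ s - η s‖ := by
    refine isCompact_Icc.induction_on (p := fun t => ∃ C : ℝ, ∀ s ∈ t,
      ‖f (u s, γ s) - f (u s, η s)‖ ≤ C * ‖γ s - η s‖) ⟨0, by simp⟩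
      (fun t t' htt ⟨C, hC⟩ => ⟨C, fun s hs => hC s (htt hs)⟩) ?_ ?_
    · rintro t t' ⟨C, hC⟩ ⟨C', hC'⟩
      refine ⟨max C C', fun s hs => ?_⟩
      rcases hs with hs | hs
      · exact (hC s hs).trans (mul_le_mul_of_nonneg_right (le_max_left _ _) (norm_nonneg _))
      · exact (hC' s hs).trans (mul_le_mul_of_nonneg_right (le_max_right _ _) (norm_nonneg _))
    · intro s hs
      have c1 : ContinuousWithinAt (fun r => (u r, γ r)) (Icc a b) s := (hu s hs).prodMk (cγ s hs)
      have c2 : ContinuousWithinAt (fun r => (u r, η r)) (Icc a b) s := (hu s hs).prodMk (cη s hs)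
      -- Where the curves meet, `f` is locally Lipschitz. Where they differ, the quotient of the two
      -- norms is continuous, hence locally bounded.
      by_cases heq : γ s = η s
      · obtain ⟨C, t, ht, hC⟩ := (hfγ s hs).hasStrictFDerivAt.exists_lipschitzOnWith
        have m1 := c1.eventually_mem ht
        have m2 := c2.eventually_mem (heq ▸ ht)
        refine ⟨_, m1.and m2, C, fun r hr => ?_⟩
        have := hC.dist_le_mul _ hr.1 _ hr.2
        rwa [dist_eq_norm, dist_eq_norm, Prod.mk_sub_mk, sub_self, Prod.norm_mk, norm_zero,
          max_eq_right (norm_nonneg _)] at this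
      · have d1 : ContinuousWithinAt (fun r => f (u r, γ r)) (Icc a b) s :=
          (hfγ s hs).continuousAt.tendsto.comp c1
        have d2 : ContinuousWithinAt (fun r => f (u r, η r)) (Icc a b) s :=
          (hfη s hs).continuousAt.tendsto.comp c2
        have c3 : ContinuousWithinAt
            (fun r => ‖f (u r, γ r) - f (u r, η r)‖ / ‖γ r - η r‖) (Icc a b) s :=
          (d1.sub d2).norm.div ((cγ s hs).sub (cη s hs)).norm
            (by simpa [sub_eq_zero] using heq)
        have c4 := ((cγ s hs).sub (cη s hs)).norm
        set c := ‖f (u s, γ s) - f (u s, η s)‖ / ‖γ s - η s‖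
        refine ⟨_, (c3.eventually (gt_mem_nhds (lt_add_one c))).and
          (c4.eventually (lt_mem_nhds (norm_pos_iff.mpr (sub_ne_zero.mpr heq)))), c + 1,
          fun r hr => ?_⟩
        exact (div_le_iff₀ hr.2).mp hr.1.le
  obtain ⟨C, hC⟩ := hloc
  have := eq_zero_of_abs_deriv_le_mul_abs_self_of_eq_zero_right
    (f := fun s => γ s - η s) (f' := fun s => f (u s, γ s) - f (u s, η s)) (K := C)
    (cγ.sub cη) (fun s hs => ?_) (sub_eq_zero.mpr h0) fun s hs => hC s (Ico_subset_Icc_self hs)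
  · exact fun s hs => sub_eq_zero.mp (this s hs)
  · have hs' := Ico_subset_Icc_self hs
    exact ((hγ s hs').sub (hη s hs')).mono_of_mem_nhdsWithin (Icc_mem_nhdsGE_of_mem hs)

end ODE

/-! ### Division by powers of a real parameter -/

section Division

variable {Z G : Type} [NormedAddCommGroup Z] [NormedSpace ℝ Z]
  [NormedAddCommGroup G] [NormedSpace ℝ G] [CompleteSpace G]

open unitInterval

theorem eventually_slice {Q : ℝ × Z → Prop} {z₀ : Z} (h : ∀ᶠ p in 𝓝 ((0 : ℝ), z₀), Q p) :
    ∀ᶠ z in 𝓝 z₀, ∀ᶠ t in 𝓝 (0 : ℝ), Q (t, z) := by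
  have h1 : Tendsto (fun z : Z => ((0 : ℝ), z)) (𝓝 z₀) (𝓝 (0, z₀)) :=
    (Continuous.prodMk_right (0 : ℝ)).tendsto z₀
  filter_upwards [h1.eventually (eventually_eventually_nhds.mpr h)] with z hz
  exact ((Continuous.prodMk_left z).tendsto (0 : ℝ)).eventually hz

/-- The segment `s ↦ (s t, z)`. -/
def segmentMap : ℝ × Z →L[ℝ] C(I, ℝ × Z) :=
  LinearMap.mkContinuous
    { toFun := fun p => ⟨fun s => ((s : ℝ) * p.1, p.2), by fun_prop⟩
      map_add' := fun p q => by ext s <;> simp [mul_add]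
      map_smul' := fun r p => by
        ext s
        · simp; ring
        · simp } 1 fun p => by
    rw [one_mul]
    refine (ContinuousMap.norm_le _ (by positivity)).mpr fun s => ?_
    refine max_le ?_ (norm_snd_le p)
    change ‖(s : ℝ) * p.1‖ ≤ ‖p‖
    rw [norm_mul, Real.norm_eq_abs, abs_of_nonneg s.2.1]
    exact (mul_le_of_le_one_left (norm_nonneg _) s.2.2).trans (norm_fst_le p)

theorem segmentMap_apply (p : ℝ × Z) (s : I) : segmentMap p s = ((s : ℝ) * p.1, p.2) := rfl

/-- Hadamard's lemma: f(t, z) = t ∫₀¹ ∂ₜf(s t, z) ds. Writing the integrand as a composition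
operator along s ↦ (s t, z) reduces the smoothness of the parametric integral to
`smoothNear_compMap`. -/
theorem exists_smooth_div {f : ℝ × Z → G} {z₀ : Z} (hf : SmoothNear f (0, z₀))
    (h0 : ∀ᶠ z in 𝓝 z₀, f (0, z) = 0) :
    ∃ g : ℝ × Z → G, SmoothNear g (0, z₀) ∧ ∀ᶠ p in 𝓝 (0, z₀), f p = p.1 • g p := by
  let d : ℝ × Z → G := fun p => fderiv ℝ f p (1, 0)
  have hd : ∀ {p}, SmoothNear f p → SmoothNear d p := fun h => by
    filter_upwards [h.fderiv] with q hq
    exact hq.clm_apply contDiffAt_const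
  have hseg : ∀ s : I, segmentMap ((0 : ℝ), z₀) s = (0, z₀) := fun s => by simp [segmentMap_apply]
  have hfs : ∀ s : I, SmoothNear f (segmentMap ((0 : ℝ), z₀) s) := fun s => by rw [hseg]; exact hf
  let ev : C(I, G) →L[ℝ] G := ContinuousMap.evalCLM ℝ (1 : I)
  let Λ : C(I, G) →L[ℝ] G := ev.comp primitive
  refine ⟨fun p => Λ (compMap d (segmentMap p)), ?_, ?_⟩
  · exact SmoothNear.comp (smoothNear_of_contDiff Λ.contDiff _)
      (SmoothNear.comp (smoothNear_compMap fun s => hd (hfs s))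
        (smoothNear_of_contDiff (segmentMap (Z := Z)).contDiff _))
  · have h1 := (segmentMap (Z := Z)).continuous.continuousAt.eventually
      (eventually_smoothNear_comp hfs)
    have h2 : ∀ᶠ p in 𝓝 ((0 : ℝ), z₀), f (0, p.2) = 0 :=
      (continuous_snd.tendsto ((0 : ℝ), z₀)).eventually h0
    filter_upwards [h1, h2] with p hp hp0
    have h3 : ∀ s ∈ uIcc (0 : ℝ) 1, HasDerivAt (fun s : ℝ => f (s * p.1, p.2))
        (p.1 • d (s * p.1, p.2)) s := by
      intro s hs
      rw [uIcc_of_le zero_le_one] at hs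
      have h4 : HasDerivAt (fun s : ℝ => (s * p.1, p.2)) (p.1, (0 : Z)) s := by
        simpa using ((hasDerivAt_id s).mul_const p.1).prodMk (hasDerivAt_const s p.2)
      have h5 : HasFDerivAt f (fderiv ℝ f (s * p.1, p.2)) (s * p.1, p.2) :=
        (hp ⟨s, hs⟩).differentiableAt.hasFDerivAt
      have h6 := h5.comp_hasDerivAt s h4
      have h7 : (p.1, (0 : Z)) = p.1 • ((1 : ℝ), (0 : Z)) := by simp
      rw [h7, map_smul] at h6
      exact h6
    have hcd : ∀ s : I, ContinuousAt d (segmentMap p s) := fun s => (hd (hp s)).continuousAt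
    have h8 : Continuous (IccExtend (zero_le_one' ℝ) (compMap d (segmentMap p))) :=
      (compMap d (segmentMap p)).continuous.Icc_extend'
    have h9 : ∀ s ∈ uIcc (0 : ℝ) 1,
        IccExtend (zero_le_one' ℝ) (compMap d (segmentMap p)) s = d (s * p.1, p.2) := by
      intro s hs
      rw [uIcc_of_le zero_le_one] at hs
      rw [IccExtend_of_mem _ _ hs, compMap_apply hcd]
      rfl
    have h10 : IntervalIntegrable (fun s => p.1 • d (s * p.1, p.2)) MeasureTheory.volume 0 1 := by
      refine ((h8.continuousOn.congr fun s hs => (h9 s hs).symm).const_smul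
        p.1).intervalIntegrable
    have h11 := intervalIntegral.integral_eq_sub_of_hasDerivAt h3 h10
    simp only [one_mul, zero_mul, hp0, sub_zero, intervalIntegral.integral_smul] at h11
    rw [← h11]
    congr 1
    change _ = primitive (compMap d (segmentMap p)) 1
    rw [primitive_apply]
    exact (intervalIntegral.integral_congr h9).symm

/-- Hadamard's lemma is iterated. Existence of the pointwise limit of t⁻ᵏ f(t, z) suffices: for k ≥
1 it forces f(0, z) = 0, and it passes to the quotient f / t with exponent k - 1. -/
theorem exists_smooth_div_pow (k : ℕ) : ∀ {f : ℝ × Z → G} {z₀ : Z} {a : Z → G},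
    SmoothNear f (0, z₀) →
    (∀ᶠ z in 𝓝 z₀, Tendsto (fun t : ℝ => (t ^ k)⁻¹ • f (t, z)) (𝓝[≠] 0) (𝓝 (a z))) →
    ∃ g : ℝ × Z → G, SmoothNear g (0, z₀) ∧ (∀ᶠ p in 𝓝 (0, z₀), f p = p.1 ^ k • g p) ∧
      ∀ᶠ z in 𝓝 z₀, g (0, z) = a z := by
  induction k with
  | zero =>
    intro f z₀ a hf ha
    refine ⟨f, hf, by simp, ?_⟩
    filter_upwards [ha, eventually_slice (hf.eventually.mono fun p hp => hp.continuousAt)]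
      with z hz hc
    have h1 : Tendsto (fun t : ℝ => f (t, z)) (𝓝 0) (𝓝 (f (0, z))) :=
      hc.self_of_nhds.tendsto.comp ((Continuous.prodMk_left z).tendsto (0 : ℝ))
    simp only [pow_zero, inv_one, one_smul] at hz
    exact tendsto_nhds_unique (h1.mono_left nhdsWithin_le_nhds) hz
  | succ k ih =>
    intro f z₀ a hf ha
    have h0 : ∀ᶠ z in 𝓝 z₀, f (0, z) = 0 := by
      filter_upwards [ha, eventually_slice (hf.eventually.mono fun p hp => hp.continuousAt)]
        with z hz hc
      have h1 : Tendsto (fun t : ℝ => f (t, z)) (𝓝 0) (𝓝 (f (0, z))) :=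
        hc.self_of_nhds.tendsto.comp ((Continuous.prodMk_left z).tendsto (0 : ℝ))
      have h2 : Tendsto (fun t : ℝ => t ^ (k + 1)) (𝓝[≠] 0) (𝓝 0) :=
        ((continuous_pow (k + 1)).tendsto' 0 0 (by simp)).mono_left nhdsWithin_le_nhds
      have h3 := h2.smul hz
      rw [zero_smul] at h3
      refine tendsto_nhds_unique (h1.mono_left nhdsWithin_le_nhds) (h3.congr' ?_)
      filter_upwards [self_mem_nhdsWithin] with t ht
      rw [smul_smul, mul_inv_cancel₀ (pow_ne_zero _ ht), one_smul]
    obtain ⟨g₁, hg₁, hfg⟩ := exists_smooth_div hf h0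
    obtain ⟨g, hg, hgg, hga⟩ := ih (f := g₁) (z₀ := z₀) (a := a) hg₁ (by
      filter_upwards [ha, eventually_slice hfg] with z hz he
      refine hz.congr' ?_
      filter_upwards [he.filter_mono nhdsWithin_le_nhds, self_mem_nhdsWithin] with t ht ht0
      have ht0' : t ≠ 0 := ht0
      rw [ht, smul_smul]
      congr 1
      field_simp
      ring)
    refine ⟨g, hg, ?_, hga⟩
    filter_upwards [hfg, hgg] with p h1 h2
    rw [h1, h2, smul_smul, pow_succ']

end Division

/-! ### Commutators of families of local diffeomorphisms -/

section Commutator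

variable {Z G : Type} [NormedAddCommGroup Z] [NormedSpace ℝ Z] [CompleteSpace Z]
  [NormedAddCommGroup G] [NormedSpace ℝ G]

/-- `a(t, z) = z + tᵏ α(z) + o(tᵏ)` as `t → 0`. -/
def HasOrderAt (a : ℝ × Z → Z) (k : ℕ) (v : Z) (z : Z) : Prop :=
  Tendsto (fun t : ℝ => (t ^ k)⁻¹ • (a (t, z) - z)) (𝓝[≠] 0) (𝓝 v)

/-- Turns the pointwise expansion `HasOrderAt` into an exact factorization with smooth remainder,
the form in which expansions can be composed and differentiated. -/
theorem exists_smooth_coeff {a : ℝ × Z → Z} {k : ℕ} {α : Z → Z} {z₀ : Z}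
    (ha : SmoothNear a (0, z₀)) (hα : ∀ᶠ z in 𝓝 z₀, HasOrderAt a k (α z) z) :
    ∃ A : ℝ × Z → Z, SmoothNear A (0, z₀) ∧
      (∀ᶠ p in 𝓝 (0, z₀), a p = p.2 + p.1 ^ k • A p) ∧ ∀ᶠ z in 𝓝 z₀, A (0, z) = α z := by
  have h1 : SmoothNear (fun p : ℝ × Z => a p - p.2) (0, z₀) := by
    filter_upwards [ha] with p hp
    exact hp.sub contDiffAt_snd
  obtain ⟨A, hA, hA1, hA2⟩ := exists_smooth_div_pow k h1 hα
  refine ⟨A, hA, ?_, hA2⟩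
  filter_upwards [hA1] with p hp
  rw [← hp]; abel

/-- The base point `w t` moves with t, which is why strict differentiability at (0, z) is used. -/
theorem tendsto_difference {A : ℝ × Z → G} {A' : ℝ × Z →L[ℝ] G} {z v₀ : Z} {v w : ℝ → Z} {l : ℕ}
    (hA : HasStrictFDerivAt A A' (0, z)) (hl : 1 ≤ l) (hv : Tendsto v (𝓝[≠] 0) (𝓝 v₀))
    (hw : Tendsto w (𝓝[≠] 0) (𝓝 z)) :
    Tendsto (fun t : ℝ => (t ^ l)⁻¹ • (A (t, w t + t ^ l • v t) - A (t, w t))) (𝓝[≠] 0)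
      (𝓝 (A' (0, v₀))) := by
  have ht : Tendsto (fun t : ℝ => t) (𝓝[≠] 0) (𝓝 0) := nhdsWithin_le_nhds
  have hpow : Tendsto (fun t : ℝ => t ^ l) (𝓝[≠] 0) (𝓝 0) :=
    ((continuous_pow l).tendsto' 0 0 (by simp; omega)).mono_left nhdsWithin_le_nhds
  have hp : Tendsto (fun t : ℝ => ((t, w t + t ^ l • v t), (t, w t))) (𝓝[≠] 0)
      (𝓝 (((0 : ℝ), z), ((0 : ℝ), z))) := by
    have h1 : Tendsto (fun t : ℝ => w t + t ^ l • v t) (𝓝[≠] 0) (𝓝 z) := by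
      simpa using hw.add (hpow.smul hv)
    exact (ht.prodMk_nhds h1).prodMk_nhds (ht.prodMk_nhds hw)
  have h2 := hA.isLittleO.comp_tendsto hp
  have h3 : (fun t : ℝ => ((t, w t + t ^ l • v t) : ℝ × Z) - (t, w t)) =O[𝓝[≠] 0]
      (fun t : ℝ => t ^ l) := by
    have : (fun t : ℝ => ((t, w t + t ^ l • v t) : ℝ × Z) - (t, w t))
        = fun t => t ^ l • ((0 : ℝ), v t) := by
      ext t <;> simp
    rw [this]
    have h4 : (fun t : ℝ => ((0 : ℝ), v t)) =O[𝓝[≠] 0] (fun _ => (1 : ℝ)) :=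
      (tendsto_const_nhds.prodMk_nhds hv).isBigO_one ℝ
    simpa using (Asymptotics.isBigO_refl (fun t : ℝ => t ^ l) (𝓝[≠] 0)).smul h4
  have h5 := (h2.trans_isBigO h3).tendsto_inv_smul_nhds_zero
  have h6 : Tendsto (fun t : ℝ => A' (0, v t)) (𝓝[≠] 0) (𝓝 (A' (0, v₀))) :=
    (A'.continuous.tendsto _).comp (tendsto_const_nhds.prodMk_nhds hv)
  have h7 := h5.add h6
  rw [zero_add] at h7
  refine h7.congr' ?_
  filter_upwards [self_mem_nhdsWithin] with t ht0
  have ht0' : t ^ l ≠ 0 := pow_ne_zero _ ht0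
  have h8 : A' (((t, w t + t ^ l • v t) : ℝ × Z) - (t, w t)) = t ^ l • A' (0, v t) := by
    rw [← map_smul]; congr 1; ext <;> simp
  simp only [Function.comp_apply]
  rw [h8, smul_sub _ _ (t ^ l • A' (0, v t)), smul_smul, inv_mul_cancel₀ ht0', one_smul]
  abel

theorem HasOrderAt.apply_zero {a : ℝ × Z → Z} {k : ℕ} {v z : Z} (hk : 1 ≤ k)
    (h : HasOrderAt a k v z) (ha : ContinuousAt a (0, z)) : a (0, z) = z := by
  have h1 : Tendsto (fun t : ℝ => a (t, z)) (𝓝[≠] 0) (𝓝 (a (0, z))) :=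
    (ha.tendsto.comp ((Continuous.prodMk_left z).tendsto (0 : ℝ))).mono_left nhdsWithin_le_nhds
  have h2 : Tendsto (fun t : ℝ => t ^ k) (𝓝[≠] 0) (𝓝 0) :=
    ((continuous_pow k).tendsto' 0 0 (by simp; omega)).mono_left nhdsWithin_le_nhds
  have h3 := (h2.smul h).add_const z
  rw [zero_smul, zero_add] at h3
  refine tendsto_nhds_unique h1 (h3.congr' ?_)
  filter_upwards [self_mem_nhdsWithin] with t ht
  rw [smul_smul, mul_inv_cancel₀ (pow_ne_zero _ ht), one_smul, sub_add_cancel]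

theorem hasFDerivAt_slice {A : ℝ × Z → Z} {α : Z → Z} {z : Z} (hA : DifferentiableAt ℝ A (0, z))
    (h : ∀ᶠ z' in 𝓝 z, A (0, z') = α z') (v : Z) :
    fderiv ℝ α z v = fderiv ℝ A (0, z) (0, v) := by
  have h1 : HasFDerivAt (fun z' => A (0, z')) ((fderiv ℝ A (0, z)).comp (.inr ℝ ℝ Z)) z :=
    hA.hasFDerivAt.comp z (hasFDerivAt_prodMk_right (0 : ℝ) z)
  have h2 : HasFDerivAt α ((fderiv ℝ A (0, z)).comp (.inr ℝ ℝ Z)) z :=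
    h1.congr_of_eventuallyEq (h.mono fun _ h => h.symm)
  rw [h2.fderiv]; simp

/-- With a = id + tᵏ A and b = id + tˡ B, the displacements tᵏ A(t, z) and tˡ B(t, z) cancel in a∘b
- b∘a. What is left is tᵏ (A(t, b) - A(t, z)) - tˡ (B(t, a) - B(t, z)), and each increment
contributes one derivative with the complementary power of t. -/
theorem tendsto_commutator {a b : ℝ × Z → Z} {z : Z} {k l : ℕ} {α β : Z → Z}
    (hk : 1 ≤ k) (hl : 1 ≤ l) (ha : SmoothNear a (0, z)) (hb : SmoothNear b (0, z))
    (hα : ∀ᶠ z' in 𝓝 z, HasOrderAt a k (α z') z') (hβ : ∀ᶠ z' in 𝓝 z, HasOrderAt b l (β z') z') :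
    Tendsto (fun t : ℝ => (t ^ (k + l))⁻¹ • (a (t, b (t, z)) - b (t, a (t, z)))) (𝓝[≠] 0)
      (𝓝 (fderiv ℝ α z (β z) - fderiv ℝ β z (α z))) := by
  obtain ⟨A, hA, hA1, hA2⟩ := exists_smooth_coeff ha hα
  obtain ⟨B, hB, hB1, hB2⟩ := exists_smooth_coeff hb hβ
  have hin : Tendsto (fun t : ℝ => (t, z)) (𝓝[≠] 0) (𝓝 (0, z)) :=
    ((Continuous.prodMk_left z).tendsto (0 : ℝ)).mono_left nhdsWithin_le_nhds
  have vA : Tendsto (fun t : ℝ => A (t, z)) (𝓝[≠] 0) (𝓝 (α z)) := by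
    rw [← hA2.self_of_nhds]; exact hA.continuousAt.tendsto.comp hin
  have vB : Tendsto (fun t : ℝ => B (t, z)) (𝓝[≠] 0) (𝓝 (β z)) := by
    rw [← hB2.self_of_nhds]; exact hB.continuousAt.tendsto.comp hin
  have h1 := tendsto_difference hA.hasStrictFDerivAt hl vB tendsto_const_nhds
  have h2 := tendsto_difference hB.hasStrictFDerivAt hk vA tendsto_const_nhds
  rw [hasFDerivAt_slice hA.differentiableAt hA2, hasFDerivAt_slice hB.differentiableAt hB2]
  refine (h1.sub h2).congr' ?_
  have e1 : Tendsto (fun t : ℝ => (t, b (t, z))) (𝓝[≠] 0) (𝓝 (0, z)) := by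
    have := hb.continuousAt.tendsto.comp hin
    rw [hβ.self_of_nhds.apply_zero hl hb.continuousAt] at this
    exact (tendsto_nhds_of_tendsto_nhdsWithin tendsto_id).prodMk_nhds this
  have e2 : Tendsto (fun t : ℝ => (t, a (t, z))) (𝓝[≠] 0) (𝓝 (0, z)) := by
    have := ha.continuousAt.tendsto.comp hin
    rw [hα.self_of_nhds.apply_zero hk ha.continuousAt] at this
    exact (tendsto_nhds_of_tendsto_nhdsWithin tendsto_id).prodMk_nhds this
  filter_upwards [e1.eventually hA1, e2.eventually hB1, hin.eventually hA1, hin.eventually hB1,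
    self_mem_nhdsWithin] with t t1 t2 t3 t4 t0
  have t0' : t ≠ 0 := t0
  rw [t1, t2, ← t3, ← t4]
  have e3 : b (t, z) - a (t, z) = t ^ l • B (t, z) - t ^ k • A (t, z) := by rw [t3, t4]; abel
  have c1 : (t ^ l)⁻¹ = (t ^ (k + l))⁻¹ * t ^ k := by field_simp; ring
  have c2 : (t ^ k)⁻¹ = (t ^ (k + l))⁻¹ * t ^ l := by field_simp; ring
  rw [c1, c2, mul_smul, mul_smul, ← smul_sub]
  congr 1
  rw [smul_sub, smul_sub, add_sub_add_comm, e3]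
  abel

/-- The difference a∘b - b∘a equals tᵏ⁺ˡ g(t, ·) with g smooth. Evaluated at w = a⁻¹ b⁻¹ z, it
becomes the displacement of z under a b a⁻¹ b⁻¹, since b a w = z. As t → 0 the point w tends to z,
so only the continuity of the inverses matters. -/
theorem commutator_hasOrderAt {a a' b b' : ℝ × Z → Z} {z : Z} {k l : ℕ} {α β : Z → Z}
    (hk : 1 ≤ k) (hl : 1 ≤ l) (ha : SmoothNear a (0, z)) (hb : SmoothNear b (0, z))
    (ha' : ContinuousAt a' (0, z)) (hb' : ContinuousAt b' (0, z))
    (ha'0 : a' (0, z) = z) (hb'0 : b' (0, z) = z)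
    (haa' : ∀ᶠ p in 𝓝 ((0 : ℝ), z), a (p.1, a' p) = p.2)
    (hbb' : ∀ᶠ p in 𝓝 ((0 : ℝ), z), b (p.1, b' p) = p.2)
    (hα : ∀ᶠ z' in 𝓝 z, HasOrderAt a k (α z') z') (hβ : ∀ᶠ z' in 𝓝 z, HasOrderAt b l (β z') z') :
    HasOrderAt (fun p => a (p.1, b (p.1, a' (p.1, b' p)))) (k + l)
      (fderiv ℝ α z (β z) - fderiv ℝ β z (α z)) z := by
  have hb0 : b (0, z) = z := hβ.self_of_nhds.apply_zero hl hb.continuousAt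
  have ha0 : a (0, z) = z := hα.self_of_nhds.apply_zero hk ha.continuousAt
  have hf : SmoothNear (fun p : ℝ × Z => a (p.1, b p) - b (p.1, a p)) (0, z) := by
    have h1 : SmoothNear (fun p : ℝ × Z => a (p.1, b p)) (0, z) :=
      SmoothNear.comp (f := fun p : ℝ × Z => (p.1, b p)) (by simpa [hb0] using ha)
        ((smoothNear_of_contDiff contDiff_fst _).prodMk hb)
    have h2 : SmoothNear (fun p : ℝ × Z => b (p.1, a p)) (0, z) :=
      SmoothNear.comp (f := fun p : ℝ × Z => (p.1, a p)) (by simpa [ha0] using hb)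
        ((smoothNear_of_contDiff contDiff_fst _).prodMk ha)
    filter_upwards [h1, h2] with p p1 p2 using p1.sub p2
  obtain ⟨g, hg, hg1, hg2⟩ := exists_smooth_div_pow (k + l) (z₀ := z)
    (a := fun z => fderiv ℝ α z (β z) - fderiv ℝ β z (α z)) hf (by
      filter_upwards [eventually_slice ha.eventually, eventually_slice hb.eventually,
        eventually_eventually_nhds.mpr hα, eventually_eventually_nhds.mpr hβ] with z' h1 h2 h3 h4
      exact tendsto_commutator hk hl h1.self_of_nhds h2.self_of_nhds h3 h4)
  have hw : Tendsto (fun t : ℝ => (t, a' (t, b' (t, z)))) (𝓝[≠] 0) (𝓝 (0, z)) := by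
    have hid : Tendsto (fun t : ℝ => t) (𝓝 0) (𝓝 0) := tendsto_id
    have h1 : Tendsto (fun t : ℝ => b' (t, z)) (𝓝 0) (𝓝 z) := by
      have := hb'.tendsto.comp ((Continuous.prodMk_left z).tendsto (0 : ℝ))
      rwa [hb'0] at this
    have h2 : Tendsto (fun t : ℝ => a' (t, b' (t, z))) (𝓝 0) (𝓝 z) := by
      have := ha'.tendsto.comp (hid.prodMk_nhds h1)
      rwa [ha'0] at this
    exact (hid.prodMk_nhds h2).mono_left nhdsWithin_le_nhds
  have hbz : Tendsto (fun t : ℝ => (t, b' (t, z))) (𝓝[≠] 0) (𝓝 (0, z)) := by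
    have hid : Tendsto (fun t : ℝ => t) (𝓝 0) (𝓝 0) := tendsto_id
    have := hb'.tendsto.comp ((Continuous.prodMk_left z).tendsto (0 : ℝ))
    rw [hb'0] at this
    exact (hid.prodMk_nhds this).mono_left nhdsWithin_le_nhds
  have hin : Tendsto (fun t : ℝ => (t, z)) (𝓝[≠] 0) (𝓝 (0, z)) :=
    ((Continuous.prodMk_left z).tendsto (0 : ℝ)).mono_left nhdsWithin_le_nhds
  have hlim := hg.continuousAt.tendsto.comp hw
  rw [hg2.self_of_nhds] at hlim
  refine hlim.congr' ?_
  filter_upwards [hw.eventually hg1, hbz.eventually haa', hin.eventually hbb',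
    self_mem_nhdsWithin] with t t1 t2 t3 t0
  have t0' : t ≠ 0 := t0
  rw [t2, t3] at t1
  simp only [Function.comp_apply]
  rw [t1, smul_smul, inv_mul_cancel₀ (pow_ne_zero _ t0'), one_smul]

/-- Inserting a⁻¹(t, z) into a = id + tᵏ A gives z = a⁻¹(t, z) + tᵏ A(t, a⁻¹(t, z)). -/
theorem HasOrderAt.inverse {a a' : ℝ × Z → Z} {z : Z} {k : ℕ} {α : Z → Z}
    (ha : SmoothNear a (0, z))
    (ha' : ContinuousAt a' (0, z)) (ha'0 : a' (0, z) = z)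
    (haa' : ∀ᶠ p in 𝓝 ((0 : ℝ), z), a (p.1, a' p) = p.2)
    (hα : ∀ᶠ z' in 𝓝 z, HasOrderAt a k (α z') z') : HasOrderAt a' k (-α z) z := by
  obtain ⟨A, hA, hA1, hA2⟩ := exists_smooth_coeff ha hα
  have hw : Tendsto (fun t : ℝ => (t, a' (t, z))) (𝓝[≠] 0) (𝓝 (0, z)) := by
    have hid : Tendsto (fun t : ℝ => t) (𝓝 0) (𝓝 0) := tendsto_id
    have := ha'.tendsto.comp ((Continuous.prodMk_left z).tendsto (0 : ℝ))
    rw [ha'0] at this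
    exact (hid.prodMk_nhds this).mono_left nhdsWithin_le_nhds
  have hin : Tendsto (fun t : ℝ => (t, z)) (𝓝[≠] 0) (𝓝 (0, z)) :=
    ((Continuous.prodMk_left z).tendsto (0 : ℝ)).mono_left nhdsWithin_le_nhds
  have hlim := (hA.continuousAt.tendsto.comp hw).neg
  rw [hA2.self_of_nhds] at hlim
  refine hlim.congr' ?_
  filter_upwards [hw.eventually hA1, hin.eventually haa', self_mem_nhdsWithin] with t t1 t2 t0
  have t0' : t ≠ 0 := t0
  simp only [Function.comp_apply]
  rw [t2, ← sub_eq_iff_eq_add'] at t1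
  rw [← neg_sub z, t1, smul_neg, smul_smul, inv_mul_cancel₀ (pow_ne_zero _ t0'), one_smul]

end Commutator

/-! ### Reparametrization of families of higher order -/

section Root

variable {Z : Type} [NormedAddCommGroup Z] [NormedSpace ℝ Z] [CompleteSpace Z]

/-- The even root `|t| ^ (1 / k)`. -/
def absRoot (k : ℕ) (t : ℝ) : ℝ := |t| ^ (1 / k : ℝ)

theorem absRoot_pow {k : ℕ} (hk : 1 ≤ k) (t : ℝ) : absRoot k t ^ k = |t| := by
  rw [absRoot, one_div, Real.rpow_inv_natCast_pow (abs_nonneg t) (by omega)]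

theorem absRoot_zero {k : ℕ} (hk : 1 ≤ k) : absRoot k 0 = 0 := by
  have : (1 / k : ℝ) ≠ 0 := by positivity
  rw [absRoot, abs_zero, Real.zero_rpow this]

theorem continuous_absRoot {k : ℕ} : Continuous (absRoot k) :=
  continuous_abs.rpow_const fun _ => Or.inr (by positivity)

theorem contDiffAt_absRoot {k : ℕ} {t : ℝ} (ht : t ≠ 0) : ContDiffAt ℝ ∞ (absRoot k) t :=
  (contDiffAt_abs ht).rpow_const_of_ne (by simpa using ht)

theorem hasDerivAt_absRoot {k : ℕ} (hk : 1 ≤ k) {t : ℝ} (ht : t ≠ 0) :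
    HasDerivAt (absRoot k) (absRoot k t / k / t) t := by
  have h0 : |t| ≠ 0 := by simpa using ht
  have h := (hasDerivAt_abs ht).rpow_const (p := (1 / k : ℝ)) (Or.inl h0)
  refine h.congr_deriv ?_
  have hk' : (k : ℝ) ≠ 0 := by positivity
  rw [Real.rpow_sub_one h0, absRoot]
  rcases lt_or_gt_of_ne ht with h1 | h1
  · simp [h1, abs_of_neg h1]; field_simp
  · simp [h1, abs_of_pos h1]; field_simp

/-- The derivative of `(t, z) ↦ z + t A(|t|^{1/k}, z)`. -/
def rootDeriv (A : ℝ × Z → Z) (k : ℕ) (p : ℝ × Z) : ℝ × Z →L[ℝ] Z :=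
  .snd ℝ ℝ Z + ((ContinuousLinearMap.fst ℝ ℝ Z).smulRight
    (A (absRoot k p.1, p.2) + (absRoot k p.1 / k) • fderiv ℝ A (absRoot k p.1, p.2) (1, 0))
    + p.1 • (fderiv ℝ A (absRoot k p.1, p.2)).comp
      ((ContinuousLinearMap.inr ℝ ℝ Z).comp (.snd ℝ ℝ Z)))

/-- For r = |t|^{1/k} one has t · dr/dt = r / k, so the factor t in front of A compensates the
singularity of the root, and the derivative has a continuous extension to t = 0. -/
theorem hasFDerivAt_root {A : ℝ × Z → Z} {k : ℕ} (hk : 1 ≤ k) {p : ℝ × Z}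
    (hA : SmoothNear A (absRoot k p.1, p.2)) :
    HasFDerivAt (fun q : ℝ × Z => q.2 + q.1 • A (absRoot k q.1, q.2)) (rootDeriv A k p) p := by
  refine hasFDerivAt_snd.add ?_
  by_cases ht : p.1 = 0
  -- At t = 0 the root need not be differentiable, but the increment is q.1 times A, and continuity
  -- of A makes the remainder of smaller order.
  · have hc : ContinuousAt (fun q : ℝ × Z => A (absRoot k q.1, q.2)) p :=
      ContinuousAt.comp (f := fun q : ℝ × Z => (absRoot k q.1, q.2)) (g := A) hA.continuousAt
        ((continuous_absRoot.comp continuous_fst).prodMk continuous_snd).continuousAt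
    rw [ht, absRoot_zero hk, zero_smul, add_zero, zero_div, zero_smul, add_zero]
    rw [hasFDerivAt_iff_isLittleO]
    have h1 : (fun q : ℝ × Z => A (absRoot k q.1, q.2) - A (absRoot k p.1, p.2)) =o[𝓝 p]
        fun _ => (1 : ℝ) := by
      rw [Asymptotics.isLittleO_one_iff]
      simpa using hc.tendsto.sub_const (A (absRoot k p.1, p.2))
    have h2 : (fun q : ℝ × Z => q.1) =O[𝓝 p] fun q => ‖q - p‖ := by
      refine Asymptotics.isBigO_of_le _ fun q => ?_
      have : q.1 = (q - p).1 := by simp [ht]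
      rw [this, norm_norm]
      exact norm_fst_le _
    have h3 := h2.smul_isLittleO h1
    simp only [smul_eq_mul, mul_one] at h3
    rw [ht, absRoot_zero hk] at h3
    refine (h3.congr_left fun q => ?_).of_norm_right
    rw [ht, zero_smul, sub_zero, smul_sub]
    simp [ht]
  · have h1 : HasFDerivAt (fun q : ℝ × Z => (absRoot k q.1, q.2))
        ((((absRoot k p.1 / k / p.1) • ContinuousLinearMap.fst ℝ ℝ Z)).prod
          (.snd ℝ ℝ Z)) p := by
      refine HasFDerivAt.prodMk ?_ hasFDerivAt_snd
      exact (hasDerivAt_absRoot hk ht).comp_hasFDerivAt p hasFDerivAt_fst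
    have h2 : HasFDerivAt (fun q : ℝ × Z => A (absRoot k q.1, q.2)) _ p :=
      HasFDerivAt.comp (f := fun q : ℝ × Z => (absRoot k q.1, q.2)) p
        hA.differentiableAt.hasFDerivAt h1
    have h3 := (hasFDerivAt_fst (𝕜 := ℝ) (p := p)).smul h2
    refine h3.congr_fderiv (ContinuousLinearMap.ext fun v => ?_)
    have h4 : ((absRoot k p.1 / k / p.1 * v.1 : ℝ), v.2)
        = (absRoot k p.1 / k / p.1 * v.1) • ((1 : ℝ), (0 : Z)) + (0, v.2) := by simp
    simp only [ContinuousLinearMap.comp_apply, add_apply, smul_apply, smul_add,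
      ContinuousLinearMap.prod_apply, ContinuousLinearMap.smulRight_apply,
      ContinuousLinearMap.coe_fst', ContinuousLinearMap.coe_snd', ContinuousLinearMap.inr_apply,
      smul_eq_mul]
    rw [h4, map_add, map_smul, smul_add, smul_smul, smul_smul]
    have h5 : p.1 * (absRoot k p.1 / k / p.1 * v.1) = v.1 * (absRoot k p.1 / k) := by
      field_simp
    rw [h5]
    abel

theorem continuousAt_rootDeriv {A : ℝ × Z → Z} {k : ℕ} {p : ℝ × Z}
    (hA : SmoothNear A (absRoot k p.1, p.2)) : ContinuousAt (rootDeriv A k) p := by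
  have hr : ContinuousAt (fun q : ℝ × Z => (absRoot k q.1, q.2)) p :=
    ((continuous_absRoot.comp continuous_fst).prodMk continuous_snd).continuousAt
  have h1 : ContinuousAt (fun q : ℝ × Z => A (absRoot k q.1, q.2)) p :=
    ContinuousAt.comp (f := fun q : ℝ × Z => (absRoot k q.1, q.2)) (g := A) hA.continuousAt hr
  have h2 : ContinuousAt (fun q : ℝ × Z => fderiv ℝ A (absRoot k q.1, q.2)) p :=
    ContinuousAt.comp (f := fun q : ℝ × Z => (absRoot k q.1, q.2)) (g := fderiv ℝ A)
      hA.fderiv.continuousAt hr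
  have h3 : ContinuousAt (fun q : ℝ × Z => absRoot k q.1 / k) p :=
    ((continuous_absRoot.comp continuous_fst).div_const _).continuousAt
  have h4 : ContinuousAt (fun q : ℝ × Z => A (absRoot k q.1, q.2)
      + (absRoot k q.1 / k) • fderiv ℝ A (absRoot k q.1, q.2) (1, 0)) p :=
    h1.add (h3.smul (h2.clm_apply continuousAt_const))
  have h5 : ContinuousAt (fun q : ℝ × Z => (ContinuousLinearMap.fst ℝ ℝ Z).smulRight
      (A (absRoot k q.1, q.2)
        + (absRoot k q.1 / k) • fderiv ℝ A (absRoot k q.1, q.2) (1, 0))) p :=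
    ((ContinuousLinearMap.smulRightL ℝ (ℝ × Z) Z (.fst ℝ ℝ Z)).continuous.continuousAt).comp h4
  exact continuousAt_const.add (h5.add (continuousAt_fst.smul (h2.clm_comp continuousAt_const)))

open Classical in
/-- The family `Φ` in the parameter `t = rᵏ` for `t ≥ 0`, continued by the inverse family `Ψ`. -/
def rootFamily (Φ Ψ : ℝ × Z → Z) (k : ℕ) (p : ℝ × Z) : Z :=
  if 0 ≤ p.1 then Φ (absRoot k p.1, p.2) else Ψ (absRoot k p.1, p.2)

theorem contDiffAt_rootFamily_of_ne {Φ Ψ : ℝ × Z → Z} {k : ℕ} {p : ℝ × Z} (hp : p.1 ≠ 0)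
    (hΦ : ContDiffAt ℝ ∞ Φ (absRoot k p.1, p.2)) (hΨ : ContDiffAt ℝ ∞ Ψ (absRoot k p.1, p.2)) :
    ContDiffAt ℝ ∞ (rootFamily Φ Ψ k) p := by
  have hr : ContDiffAt ℝ ∞ (fun q : ℝ × Z => (absRoot k q.1, q.2)) p :=
    ((contDiffAt_absRoot hp).comp p contDiffAt_fst).prodMk contDiffAt_snd
  rcases lt_or_gt_of_ne hp with h | h
  · refine (hΨ.comp p hr).congr_of_eventuallyEq ?_
    filter_upwards [continuous_fst.continuousAt.eventually (gt_mem_nhds h)] with q hq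
    have : ¬ 0 ≤ q.1 := not_le.mpr hq
    simp [rootFamily, this]
  · refine (hΦ.comp p hr).congr_of_eventuallyEq ?_
    filter_upwards [continuous_fst.continuousAt.eventually (lt_mem_nhds h)] with q hq
    have : 0 ≤ q.1 := le_of_lt hq
    simp [rootFamily, this]

/-- The two halves are id + s A(|s|^{1/k}, ·) and id + s B(|s|^{1/k}, ·), both C¹. They fit together
to first order because A and B both equal ζ at s = 0. -/
theorem contDiffAt_rootFamily {Φ Ψ : ℝ × Z → Z} {k : ℕ} (hk : 1 ≤ k) {ζ : Z → Z} {z : Z}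
    (hΦ : SmoothNear Φ (0, z)) (hΨ : SmoothNear Ψ (0, z))
    (h1 : ∀ᶠ z' in 𝓝 z, HasOrderAt Φ k (ζ z') z')
    (h2 : ∀ᶠ z' in 𝓝 z, HasOrderAt Ψ k (-ζ z') z') :
    ContDiffAt ℝ 1 (rootFamily Φ Ψ k) (0, z) ∧
      HasDerivAt (fun t : ℝ => rootFamily Φ Ψ k (t, z)) (ζ z) 0 := by
  obtain ⟨A, hA, hA1, hA2⟩ := exists_smooth_coeff hΦ h1
  obtain ⟨B', hB', hB1', hB2'⟩ := exists_smooth_coeff hΨ h2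
  -- For negative s the inverse family is id + |s| B', and |s| = -s. The sign turns its coefficient
  -- -ζ into ζ.
  let B : ℝ × Z → Z := fun p => -B' p
  have hB : SmoothNear B (0, z) := hB'.mono fun p hp => hp.neg
  have hr : Tendsto (fun q : ℝ × Z => (absRoot k q.1, q.2)) (𝓝 (0, z)) (𝓝 (0, z)) := by
    exact ((continuous_absRoot.comp continuous_fst).prodMk
      continuous_snd : Continuous (fun q : ℝ × Z => (absRoot k q.1, q.2))).tendsto' _ _
        (by simp [absRoot_zero hk])
  let fA : ℝ × Z → Z := fun q => q.2 + q.1 • A (absRoot k q.1, q.2)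
  let fB : ℝ × Z → Z := fun q => q.2 + q.1 • B (absRoot k q.1, q.2)
  have eA : ∀ᶠ q in 𝓝 ((0 : ℝ), z), 0 ≤ q.1 → rootFamily Φ Ψ k q = fA q := by
    filter_upwards [hr.eventually hA1] with q hq h0
    simp only [rootFamily, h0, if_true, hq, fA, absRoot_pow hk, abs_of_nonneg h0]
  have eB : ∀ᶠ q in 𝓝 ((0 : ℝ), z), q.1 ≤ 0 → rootFamily Φ Ψ k q = fB q := by
    filter_upwards [hr.eventually hB1', eA] with q hq hqA h0
    rcases h0.lt_or_eq with h | h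
    · have : ¬ 0 ≤ q.1 := not_le.mpr h
      simp [rootFamily, this, hq, fB, B, absRoot_pow hk, abs_of_neg h]
    · rw [hqA h.ge]
      simp [fA, fB, h]
  -- On the hyperplane s = 0 the derivatives of the two branches coincide; this makes the glued
  -- derivative `D` well defined and continuous there.
  have hAB : ∀ᶠ q in 𝓝 ((0 : ℝ), z), q.1 = 0 → rootDeriv A k q = rootDeriv B k q := by
    filter_upwards [(continuous_snd.tendsto ((0 : ℝ), z)).eventually hA2,
      (continuous_snd.tendsto ((0 : ℝ), z)).eventually hB2'] with q q1 q2 q0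
    simp [rootDeriv, q0, absRoot_zero hk, q1, q2, B]
  let D : ℝ × Z → ℝ × Z →L[ℝ] Z := fun q => if 0 ≤ q.1 then rootDeriv A k q else rootDeriv B k q
  have hD : ∀ᶠ q in 𝓝 ((0 : ℝ), z), HasFDerivAt (rootFamily Φ Ψ k) (D q) q ∧
      ContinuousAt D q := by
    filter_upwards [eventually_eventually_nhds.mpr eA, eventually_eventually_nhds.mpr eB,
      eventually_eventually_nhds.mpr hAB, hr.eventually hA.eventually, hr.eventually hB.eventually]
      with q qA qB qAB sA sB
    have dA := hasFDerivAt_root hk sA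
    have dB := hasFDerivAt_root hk sB
    have cA := continuousAt_rootDeriv sA
    have cB := continuousAt_rootDeriv sB
    rcases lt_trichotomy q.1 0 with h | h | h
    · have hlt : ∀ᶠ q' in 𝓝 q, q'.1 < 0 := continuous_fst.continuousAt.eventually (gt_mem_nhds h)
      have hDB : D =ᶠ[𝓝 q] rootDeriv B k := by
        filter_upwards [hlt] with q' hq'
        simp [D, not_le.mpr hq']
      refine ⟨?_, cB.congr hDB.symm⟩
      rw [hDB.self_of_nhds]
      refine dB.congr_of_eventuallyEq ?_
      filter_upwards [hlt, qB] with q' h1 h2 using h2 h1.le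
    · have hDq : D q = rootDeriv A k q := by simp [D, h]
      have hDq' : D q = rootDeriv B k q := hDq.trans (qAB.self_of_nhds h)
      constructor
      · have w1 : HasFDerivWithinAt (rootFamily Φ Ψ k) (D q) {q' | 0 ≤ q'.1} q := by
          rw [hDq]
          refine dA.hasFDerivWithinAt.congr_of_eventuallyEq ?_ (qA.self_of_nhds h.ge)
          exact eventually_nhdsWithin_iff.mpr qA
        have w2 : HasFDerivWithinAt (rootFamily Φ Ψ k) (D q) {q' | q'.1 ≤ 0} q := by
          rw [hDq']
          refine dB.hasFDerivWithinAt.congr_of_eventuallyEq ?_ (qB.self_of_nhds h.le)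
          exact eventually_nhdsWithin_iff.mpr qB
        refine (w1.union w2).hasFDerivAt ?_
        refine Filter.univ_mem' fun q' => ?_
        exact le_total 0 q'.1
      · have t1 := cA.tendsto
        have t2 := cB.tendsto
        rw [← hDq] at t1
        rw [← hDq'] at t2
        exact Tendsto.if' t1 t2
    · have hlt : ∀ᶠ q' in 𝓝 q, 0 < q'.1 := continuous_fst.continuousAt.eventually (lt_mem_nhds h)
      have hDA : D =ᶠ[𝓝 q] rootDeriv A k := by
        filter_upwards [hlt] with q' hq'
        simp [D, hq'.le]
      refine ⟨?_, cA.congr hDA.symm⟩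
      rw [hDA.self_of_nhds]
      refine dA.congr_of_eventuallyEq ?_
      filter_upwards [hlt, qA] with q' h1 h2 using h2 h1.le
  have hmain : ContDiffAt ℝ 1 (rootFamily Φ Ψ k) (0, z) := by
    have := (contDiffAt_succ_iff_hasFDerivAt (𝕜 := ℝ) (n := 0) (f := rootFamily Φ Ψ k)
      (x := ((0 : ℝ), z))).mpr ⟨D, ⟨_, hD, fun q hq => hq.1⟩, by
        refine contDiffAt_zero.mpr ⟨_, hD, fun q hq => hq.2.continuousWithinAt⟩⟩
    simpa using this
  refine ⟨hmain, ?_⟩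
  have h3 := hD.self_of_nhds.1.comp_hasDerivAt (0 : ℝ)
    ((hasDerivAt_id (0 : ℝ)).prodMk (hasDerivAt_const (0 : ℝ) z))
  refine h3.congr_deriv ?_
  simp [D, rootDeriv, absRoot_zero hk, hA2.self_of_nhds]

end Root

/-! ### The spray and the connection of a Finsler function in coordinates -/

section Chart

variable {n : ℕ}

/-- `L` is a Finsler function on the fibre over `x`, and smooth around that fibre. -/
structure FinslerAt (L : Coord n → Coord n → ℝ) (x : Coord n) : Prop where
  smooth : ∀ y, y ≠ 0 → ContDiffAt ℝ ∞ (fun p : Coord n × Coord n => L p.1 p.2) (x, y)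
  homogeneous : ∀ (y : Coord n) (r : ℝ), 0 < r → L x (r • y) = r * L x y
  posDef : ∀ y, y ≠ 0 → ∀ u : Coord n, u ≠ 0 → 0 < fundForm (L x) y u u

/-- `L` is a Finsler function over a neighbourhood of `x`. -/
def FinslerNear (L : Coord n → Coord n → ℝ) (x : Coord n) : Prop :=
  ∀ᶠ x' in 𝓝 x, FinslerAt L x'

/-- The function `(x, y) ↦ L(x, y)²`. -/
def energy (L : Coord n → Coord n → ℝ) (p : Coord n × Coord n) : ℝ := L p.1 p.2 ^ 2

theorem eventually_fst_ne {Q : Coord n → Prop} {x y : Coord n} (h : ∀ᶠ x' in 𝓝 x, Q x')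
    (hy : y ≠ 0) : ∀ᶠ p in 𝓝 (x, y), Q p.1 ∧ p.2 ≠ 0 := by
  filter_upwards [(continuous_fst.tendsto (x, y)).eventually h,
    (continuous_snd.tendsto (x, y)).eventually (isOpen_ne.mem_nhds hy)] with p h1 h2
  exact ⟨h1, h2⟩

variable {L : Coord n → Coord n → ℝ} {x y : Coord n}

theorem FinslerNear.eventually (h : FinslerNear L x) : ∀ᶠ x' in 𝓝 x, FinslerNear L x' :=
  eventually_eventually_nhds.mpr h

theorem FinslerNear.smooth_energy (h : FinslerNear L x) (hy : y ≠ 0) :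
    SmoothNear (energy L) (x, y) := by
  filter_upwards [eventually_fst_ne h hy] with p hp
  exact (hp.1.smooth p.2 hp.2).pow 2

section Partial

variable {X Y G : Type} [NormedAddCommGroup X] [NormedSpace ℝ X]
  [NormedAddCommGroup Y] [NormedSpace ℝ Y] [NormedAddCommGroup G] [NormedSpace ℝ G]

theorem fderiv_partial_snd {f : X × Y → G} {x : X} {y : Y} (hf : DifferentiableAt ℝ f (x, y))
    (v : Y) : fderiv ℝ (fun y' => f (x, y')) y v = fderiv ℝ f (x, y) (0, v) := by
  have h1 : HasFDerivAt (fun y' => f (x, y')) ((fderiv ℝ f (x, y)).comp (.inr ℝ X Y)) y :=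
    hf.hasFDerivAt.comp y (hasFDerivAt_prodMk_right x y)
  rw [h1.fderiv]; simp

theorem fderiv_partial_fst {f : X × Y → G} {x : X} {y : Y} (hf : DifferentiableAt ℝ f (x, y))
    (v : X) : fderiv ℝ (fun x' => f (x', y)) x v = fderiv ℝ f (x, y) (v, 0) := by
  have h1 : HasFDerivAt (fun x' => f (x', y)) ((fderiv ℝ f (x, y)).comp (.inl ℝ X Y)) x :=
    hf.hasFDerivAt.comp x (hasFDerivAt_prodMk_left x y)
  rw [h1.fderiv]; simp

theorem differentiableAt_partial_fst {f : X × Y → G} {x : X} {y : Y}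
    (hf : DifferentiableAt ℝ f (x, y)) : DifferentiableAt ℝ (fun x' => f (x', y)) x :=
  (hf.hasFDerivAt.comp x (hasFDerivAt_prodMk_left x y)).differentiableAt

theorem differentiableAt_partial_snd {f : X × Y → G} {x : X} {y : Y}
    (hf : DifferentiableAt ℝ f (x, y)) : DifferentiableAt ℝ (fun y' => f (x, y')) y :=
  (hf.hasFDerivAt.comp y (hasFDerivAt_prodMk_right x y)).differentiableAt

theorem fderiv_apply_const {f : X → Y →L[ℝ] G} {x : X} (hf : DifferentiableAt ℝ f x) (v : Y)
    (u : X) : fderiv ℝ (fun x' => f x' v) x u = fderiv ℝ f x u v := by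
  have h := hf.hasFDerivAt.clm_apply (hasFDerivAt_const v x)
  rw [h.fderiv]; simp

/-- The chain rule for second derivatives. -/
theorem fderiv_fderiv_comp {f : X → G} {g : Y → G} {ψ : X → Y} {x : X}
    (hg : SmoothNear g (ψ x)) (hψ : SmoothNear ψ x) (hfg : ∀ᶠ x' in 𝓝 x, f x' = g (ψ x'))
    (a b : X) :
    fderiv ℝ (fderiv ℝ f) x a b
      = fderiv ℝ (fderiv ℝ g) (ψ x) (fderiv ℝ ψ x a) (fderiv ℝ ψ x b)
        + fderiv ℝ g (ψ x) (fderiv ℝ (fderiv ℝ ψ) x a b) := by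
  have h1 : fderiv ℝ f =ᶠ[𝓝 x] fun x' => (fderiv ℝ g (ψ x')).comp (fderiv ℝ ψ x') := by
    filter_upwards [eventually_eventually_nhds.mpr hfg, hψ, hψ.continuousAt.eventually hg]
      with x' q1 q2 q3
    have q4 : f =ᶠ[𝓝 x'] g ∘ ψ := q1
    rw [q4.fderiv_eq, fderiv_comp x' (q3.differentiableAt (by simp))
      (q2.differentiableAt (by simp))]
  have h2 : HasFDerivAt (fun x' => fderiv ℝ g (ψ x'))
      ((fderiv ℝ (fderiv ℝ g) (ψ x)).comp (fderiv ℝ ψ x)) x :=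
    hg.fderiv.differentiableAt.hasFDerivAt.comp x hψ.differentiableAt.hasFDerivAt
  have h3 := h2.clm_comp hψ.fderiv.differentiableAt.hasFDerivAt
  rw [h1.fderiv_eq, h3.fderiv]
  simp [add_comm]

end Partial

theorem FinslerNear.fundForm_eq (h : FinslerNear L x) (hy : y ≠ 0) (u v : Coord n) :
    fundForm (L x) y u v = (1 / 2) * fderiv ℝ (fderiv ℝ (energy L)) (x, y) (0, u) (0, v) := by
  have he := h.smooth_energy hy
  rw [fundForm]
  congr 1
  have h1 : (fun y' => fderiv ℝ (fun y'' => L x y'' ^ 2) y' v)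
      =ᶠ[𝓝 y] fun y' => fderiv ℝ (energy L) (x, y') (0, v) := by
    filter_upwards [(Continuous.prodMk_right x).continuousAt.eventually he] with y' hy'
    exact fderiv_partial_snd (f := energy L) (hy'.differentiableAt (by simp)) v
  rw [h1.fderiv_eq]
  have h2 := fderiv_partial_snd (f := fun p => fderiv ℝ (energy L) p (0, v)) (x := x) (y := y)
    (he.fderiv.differentiableAt.clm_apply (differentiableAt_const _)) u
  rw [h2, fderiv_apply_const he.fderiv.differentiableAt]

theorem FinslerNear.symm (h : FinslerNear L x) (hy : y ≠ 0) (a b : Coord n × Coord n) :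
    fderiv ℝ (fderiv ℝ (energy L)) (x, y) a b = fderiv ℝ (fderiv ℝ (energy L)) (x, y) b a :=
  ((h.smooth_energy hy).contDiffAt.isSymmSndFDerivAt (by
    rw [minSmoothness_of_isRCLikeNormedField]; exact ENat.LEInfty.out)) a b

/-- The dilatation `(x, y) ↦ (x, r y)`. -/
def dilate (n : ℕ) (r : ℝ) : Coord n × Coord n →L[ℝ] Coord n × Coord n :=
  (ContinuousLinearMap.fst ℝ _ _).prod (r • ContinuousLinearMap.snd ℝ _ _)

@[simp] theorem dilate_apply (r : ℝ) (p : Coord n × Coord n) : dilate n r p = (p.1, r • p.2) := rfl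

theorem FinslerNear.energy_dilate (h : FinslerNear L x) {r : ℝ} (hr : 0 < r) (y : Coord n) :
    ∀ᶠ p in 𝓝 (x, y), energy L (dilate n r p) = r ^ 2 * energy L p := by
  filter_upwards [(continuous_fst.tendsto (x, y)).eventually h] with p hp
  simp [energy, hp.homogeneous _ _ hr, mul_pow]

/-- Euler's relation, `∂e/∂yⁱ yⁱ = 2 e`. -/
theorem FinslerNear.euler (h : FinslerNear L x) (hy : y ≠ 0) :
    fderiv ℝ (energy L) (x, y) (0, y) = 2 * energy L (x, y) := by
  have h1 : HasDerivAt (fun r : ℝ => (x, r • y)) ((0 : Coord n), y) 1 := by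
    simpa using (hasDerivAt_const (1 : ℝ) x).prodMk ((hasDerivAt_id (1 : ℝ)).smul_const y)
  have h2 : HasFDerivAt (energy L) (fderiv ℝ (energy L) (x, y)) (x, (1 : ℝ) • y) := by
    rw [one_smul]; exact (h.smooth_energy hy).differentiableAt.hasFDerivAt
  have h3 := h2.comp_hasDerivAt (1 : ℝ) h1
  have h4 : HasDerivAt (fun r : ℝ => r ^ 2 * energy L (x, y)) (2 * energy L (x, y)) 1 := by
    simpa using (hasDerivAt_pow 2 (1 : ℝ)).mul_const (energy L (x, y))
  refine h3.unique (h4.congr_of_eventuallyEq ?_)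
  filter_upwards [lt_mem_nhds one_pos] with r hr
  simp [energy, h.self_of_nhds.homogeneous _ _ hr, mul_pow]

theorem FinslerNear.eventually_euler (h : FinslerNear L x) (hy : y ≠ 0) :
    ∀ᶠ p in 𝓝 (x, y), fderiv ℝ (energy L) p (0, p.2) = 2 * energy L p := by
  filter_upwards [eventually_fst_ne h.eventually hy] with p hp
  exact hp.1.euler hp.2

/-- Euler's relation is differentiated in the direction `a`. Contractions of second derivatives with
y thereby become first derivatives. -/
theorem FinslerNear.euler_second (h : FinslerNear L x) (hy : y ≠ 0) (a : Coord n × Coord n) :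
    fderiv ℝ (fderiv ℝ (energy L)) (x, y) a (0, y)
      = 2 * fderiv ℝ (energy L) (x, y) a - fderiv ℝ (energy L) (x, y) (0, a.2) := by
  have he := h.smooth_energy hy
  have h1 := he.fderiv.differentiableAt.hasFDerivAt.clm_apply
    ((ContinuousLinearMap.inr ℝ (Coord n) (Coord n)).hasFDerivAt.comp (x, y)
      (hasFDerivAt_snd (𝕜 := ℝ) (p := (x, y))))
  have h2 := (he.differentiableAt.hasFDerivAt.const_mul 2)
  have h3 := DFunLike.congr_fun (h1.unique (h2.congr_of_eventuallyEq (h.eventually_euler hy))) a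
  simp only [ContinuousLinearMap.comp_apply, add_apply, smul_apply, Function.comp_apply,
    ContinuousLinearMap.inr_apply, ContinuousLinearMap.flip_apply, ContinuousLinearMap.coe_snd',
    smul_eq_mul] at h3
  linarith

/-- Identities between tangent vectors are proved below by testing against the vertical Hessian,
which avoids the inverse matrix of the metric. -/
theorem FinslerNear.nondegenerate (h : FinslerNear L x) (hy : y ≠ 0) {u : Coord n}
    (hu : ∀ v, fderiv ℝ (fderiv ℝ (energy L)) (x, y) (0, u) (0, v) = 0) : u = 0 := by
  by_contra hne
  have h1 := h.self_of_nhds.posDef y hy u hne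
  rw [h.fundForm_eq hy, hu u] at h1
  simp at h1

theorem sum_basisVec (y : Coord n) : ∑ i, y i • basisVec i = y := by
  have := (EuclideanSpace.basisFun (Fin n) ℝ).sum_repr y
  simpa [basisVec] using this

theorem FinslerNear.metric_eq (h : FinslerNear L x) (hy : y ≠ 0) (i j : Fin n) :
    metric L x y i j
      = (1 / 2) * fderiv ℝ (fderiv ℝ (energy L)) (x, y) (0, basisVec i) (0, basisVec j) := by
  simp only [metric, Matrix.of_apply]
  exact h.fundForm_eq hy _ _

theorem FinslerNear.metric_symm (h : FinslerNear L x) (hy : y ≠ 0) (i j : Fin n) :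
    metric L x y i j = metric L x y j i := by
  rw [h.metric_eq hy, h.metric_eq hy, h.symm hy]

theorem FinslerNear.sum_metric (h : FinslerNear L x) (hy : y ≠ 0) (a : Coord n) (l : Fin n) :
    ∑ j, metric L x y j l * a j
      = (1 / 2) * fderiv ℝ (fderiv ℝ (energy L)) (x, y) (0, a) (0, basisVec l) := by
  conv_rhs => rw [← sum_basisVec a]
  have h1 : ((0 : Coord n), ∑ i, a i • basisVec i)
      = ∑ i, a i • ((0 : Coord n), (basisVec i : Coord n)) := by
    rw [Prod.ext_iff]
    simp [Prod.fst_sum, Prod.snd_sum]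
  rw [h1, map_sum, sum_apply, Finset.mul_sum]
  refine Finset.sum_congr rfl fun j _ => ?_
  rw [h.metric_eq hy, map_smul, smul_apply, smul_eq_mul]
  ring

theorem FinslerNear.det_ne_zero (h : FinslerNear L x) (hy : y ≠ 0) : (metric L x y).det ≠ 0 := by
  intro hdet
  obtain ⟨v, hv, hv0⟩ := Matrix.exists_vecMul_eq_zero_iff.mpr hdet
  let a : Coord n := WithLp.toLp 2 v
  refine hv ?_
  have ha : a = 0 := h.nondegenerate hy fun w => by
    have h1 : ∀ l, fderiv ℝ (fderiv ℝ (energy L)) (x, y) (0, a) (0, basisVec l) = 0 := fun l => by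
      have h2 := h.sum_metric hy a l
      have h3 : ∑ j, metric L x y j l * a j = 0 := by
        have := congrFun hv0 l
        simp only [Matrix.vecMul, dotProduct, Pi.zero_apply] at this
        rw [← this]
        exact Finset.sum_congr rfl fun j _ => mul_comm _ _
      rw [h3] at h2
      linarith
    conv_lhs => rw [← sum_basisVec w]
    have h4 : ((0 : Coord n), ∑ i, w i • basisVec i)
        = ∑ i, w i • ((0 : Coord n), (basisVec i : Coord n)) := by
      rw [Prod.ext_iff]
      simp [Prod.fst_sum, Prod.snd_sum]
    rw [h4, map_sum]
    exact Finset.sum_eq_zero fun i _ => by rw [map_smul, h1, smul_zero]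
  funext i
  exact congrFun (congrArg WithLp.ofLp ha) i

theorem FinslerNear.smooth_metric (h : FinslerNear L x) (hy : y ≠ 0) (i j : Fin n) :
    SmoothNear (fun p : Coord n × Coord n => metric L p.1 p.2 i j) (x, y) := by
  have he := (h.smooth_energy hy).fderiv.fderiv
  have h1 : SmoothNear (fun p => (1 / 2) * fderiv ℝ (fderiv ℝ (energy L)) p
      ((0 : Coord n), (basisVec i : Coord n)) ((0 : Coord n), (basisVec j : Coord n))) (x, y) := by
    filter_upwards [he] with p hp
    exact contDiffAt_const.mul ((hp.clm_apply contDiffAt_const).clm_apply contDiffAt_const)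
  refine h1.congr ?_
  filter_upwards [eventually_fst_ne h.eventually hy] with p hp
  exact hp.1.metric_eq hp.2 i j

theorem FinslerNear.differentiableAt_metric (h : FinslerNear L x) (hy : y ≠ 0) (i j : Fin n) :
    DifferentiableAt ℝ (fun x' => metric L x' y i j) x :=
  differentiableAt_partial_fst (f := fun p : Coord n × Coord n => metric L p.1 p.2 i j)
    (h.smooth_metric hy i j).differentiableAt

/-- Cramer's rule: each entry of the inverse is a quotient of polynomials in the entries. -/
theorem contDiffAt_matrix_inv {X : Type} [NormedAddCommGroup X] [NormedSpace ℝ X]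
    {A : X → Matrix (Fin n) (Fin n) ℝ} {p : X} (hA : ∀ i j, ContDiffAt ℝ ∞ (fun q => A q i j) p)
    (hd : (A p).det ≠ 0) (i j : Fin n) : ContDiffAt ℝ ∞ (fun q => (A q)⁻¹ i j) p := by
  have hdet : ∀ {B : X → Matrix (Fin n) (Fin n) ℝ},
      (∀ i j, ContDiffAt ℝ ∞ (fun q => B q i j) p) → ContDiffAt ℝ ∞ (fun q => (B q).det) p := by
    intro B hB
    simp only [Matrix.det_apply']
    exact ContDiffAt.sum fun σ _ => contDiffAt_const.mul (contDiffAt_prod fun i _ => hB _ _)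
  have h1 : (fun q => (A q)⁻¹ i j)
      = fun q => (A q).det⁻¹ * ((A q).updateRow j (Pi.single i 1)).det := by
    funext q
    rw [Matrix.inv_def, Matrix.smul_apply, Matrix.adjugate_apply, Ring.inverse_eq_inv', smul_eq_mul]
  rw [h1]
  refine ((hdet hA).inv hd).mul (hdet fun k l => ?_)
  by_cases hk : k = j
  · subst hk
    simp only [Matrix.updateRow_self]
    exact contDiffAt_const
  · simp only [Matrix.updateRow_ne hk]
    exact hA k l

/-- By homogeneity g_{jl} yʲ = ½ ∂E/∂yˡ with E = L². The contraction with yʲ commutes with ∂/∂x,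
since y is held fixed. -/
theorem FinslerNear.sum_metricDeriv (h : FinslerNear L x) (hy : y ≠ 0) (l : Fin n) :
    ∑ j, ∑ k, metricDeriv L x y j l k * y j * y k
      = (1 / 2) * fderiv ℝ (fderiv ℝ (energy L)) (x, y) (y, 0) (0, basisVec l) := by
  have hd := h.differentiableAt_metric hy
  have h1 : ∀ j, ∑ k, metricDeriv L x y j l k * y j * y k
      = fderiv ℝ (fun x' => metric L x' y j l) x y * y j := by
    intro j
    conv_rhs => rw [← sum_basisVec y]
    rw [map_sum, Finset.sum_mul]
    refine Finset.sum_congr rfl fun k _ => ?_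
    rw [map_smul, smul_eq_mul, metricDeriv, sum_basisVec]
    ring
  have h2 : HasFDerivAt (fun x' => ∑ j, metric L x' y j l * y j)
      (∑ j, y j • fderiv ℝ (fun x' => metric L x' y j l) x) x :=
    HasFDerivAt.fun_sum fun j _ => (hd j l).hasFDerivAt.mul_const (y j)
  have h3 : (fun x' => ∑ j, metric L x' y j l * y j)
      =ᶠ[𝓝 x] fun x' => (1 / 2) * fderiv ℝ (energy L) (x', y) (0, basisVec l) := by
    filter_upwards [h.eventually] with x' hx'
    rw [hx'.sum_metric hy, hx'.symm hy, hx'.euler_second hy]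
    ring
  have h4 := (fderiv_partial_fst (f := fun p => fderiv ℝ (energy L) p (0, basisVec l))
    (x := x) (y := y)
    ((h.smooth_energy hy).fderiv.differentiableAt.clm_apply (differentiableAt_const _)) y)
  rw [fderiv_apply_const (h.smooth_energy hy).fderiv.differentiableAt] at h4
  have h5 : DifferentiableAt ℝ (fun x' => fderiv ℝ (energy L) (x', y)
      ((0 : Coord n), (basisVec l : Coord n))) x :=
    differentiableAt_partial_fst (f := fun p => fderiv ℝ (energy L) p
      ((0 : Coord n), (basisVec l : Coord n)))
      ((h.smooth_energy hy).fderiv.differentiableAt.clm_apply (differentiableAt_const _))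
  have h6 := DFunLike.congr_fun ((h2.congr_of_eventuallyEq h3.symm).unique
    (h5.hasFDerivAt.const_mul (1 / 2))) y
  rw [smul_apply, h4, sum_apply, smul_eq_mul] at h6
  rw [← h6]
  refine Finset.sum_congr rfl fun j _ => ?_
  rw [h1, smul_apply, smul_eq_mul, mul_comm]

/-- By homogeneity g_{jk} yʲ yᵏ = E, and this is differentiated in x with y held fixed. -/
theorem FinslerNear.sum_metricDeriv' (h : FinslerNear L x) (hy : y ≠ 0) (l : Fin n) :
    ∑ j, ∑ k, metricDeriv L x y j k l * y j * y k
      = fderiv ℝ (energy L) (x, y) (basisVec l, 0) := by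
  have hd := h.differentiableAt_metric hy
  have h2 : HasFDerivAt (fun x' => ∑ j, ∑ k, metric L x' y j k * (y j * y k))
      (∑ j, ∑ k, (y j * y k) • fderiv ℝ (fun x' => metric L x' y j k) x) x :=
    HasFDerivAt.fun_sum fun j _ => HasFDerivAt.fun_sum fun k _ =>
      (hd j k).hasFDerivAt.mul_const (y j * y k)
  have h3 : (fun x' => ∑ j, ∑ k, metric L x' y j k * (y j * y k))
      =ᶠ[𝓝 x] fun x' => energy L (x', y) := by
    filter_upwards [h.eventually] with x' hx'
    rw [Finset.sum_comm]
    have h4 : ∀ k, ∑ j, metric L x' y j k * (y j * y k)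
        = (1 / 2) * fderiv ℝ (fderiv ℝ (energy L)) (x', y) (0, y) (0, basisVec k) * y k := by
      intro k
      rw [← hx'.sum_metric hy, Finset.sum_mul]
      exact Finset.sum_congr rfl fun j _ => by ring
    have h5 : fderiv ℝ (fderiv ℝ (energy L)) (x', y) (0, y) (0, y) = 2 * energy L (x', y) := by
      rw [hx'.euler_second hy]
      simp only
      rw [hx'.euler hy]
      ring
    have h6 : ((0 : Coord n), y) = ∑ i, y i • ((0 : Coord n), (basisVec i : Coord n)) := by
      rw [Prod.ext_iff]
      simp [Prod.fst_sum, Prod.snd_sum, sum_basisVec]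
    have h7 : fderiv ℝ (fderiv ℝ (energy L)) (x', y) (0, y) (0, y)
        = ∑ k, y k * fderiv ℝ (fderiv ℝ (energy L)) (x', y) (0, y) (0, basisVec k) := by
      have := congrArg (fderiv ℝ (fderiv ℝ (energy L)) (x', y) (0, y)) h6
      rw [this, map_sum]
      exact Finset.sum_congr rfl fun i _ => by rw [map_smul, smul_eq_mul]
    rw [Finset.sum_congr rfl fun k _ => h4 k]
    have h8 : energy L (x', y) = (1 / 2) * ∑ k, y k *
        fderiv ℝ (fderiv ℝ (energy L)) (x', y) (0, y) (0, basisVec k) := by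
      rw [← h7, h5]; ring
    rw [h8, Finset.mul_sum]
    exact Finset.sum_congr rfl fun k _ => by ring
  have h4 : DifferentiableAt ℝ (fun x' => energy L (x', y)) x :=
    differentiableAt_partial_fst (h.smooth_energy hy).differentiableAt
  have h6 := DFunLike.congr_fun ((h2.congr_of_eventuallyEq h3.symm).unique h4.hasFDerivAt)
    (basisVec l)
  rw [fderiv_partial_fst (h.smooth_energy hy).differentiableAt] at h6
  rw [← h6, sum_apply]
  refine Finset.sum_congr rfl fun j _ => ?_
  rw [sum_apply]
  refine Finset.sum_congr rfl fun k _ => ?_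
  rw [smul_apply, smul_eq_mul, metricDeriv]
  ring

theorem FinslerNear.spray_eq (h : FinslerNear L x) (hy : y ≠ 0) (i : Fin n) :
    spray L x y i = (1 / 4) * ∑ l, (metric L x y)⁻¹ i l *
      (fderiv ℝ (fderiv ℝ (energy L)) (x, y) (y, 0) (0, basisVec l)
        - fderiv ℝ (energy L) (x, y) (basisVec l, 0)) := by
  simp only [spray]
  congr 1
  refine Finset.sum_congr rfl fun l _ => ?_
  have h1 := h.sum_metricDeriv hy l
  have h2 := h.sum_metricDeriv' hy l
  have h3 : fderiv ℝ (fderiv ℝ (energy L)) (x, y) (y, 0) (0, basisVec l)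
      = 2 * ∑ j, ∑ k, metricDeriv L x y j l k * y j * y k := by rw [h1]; ring
  rw [h3, ← h2, Finset.mul_sum, ← Finset.sum_sub_distrib, Finset.mul_sum]
  refine Finset.sum_congr rfl fun j _ => ?_
  rw [Finset.mul_sum, ← Finset.sum_sub_distrib, Finset.mul_sum]
  exact Finset.sum_congr rfl fun k _ => by ring

/-- The Euler–Lagrange equation of the energy, free of indices. Together with
`FinslerNear.nondegenerate` it determines the spray, and both its transformation law and its
homogeneity are read off from it. -/
theorem FinslerNear.spray_char (h : FinslerNear L x) (hy : y ≠ 0) (v : Coord n) :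
    2 * fderiv ℝ (fderiv ℝ (energy L)) (x, y) (0, spray L x y) (0, v)
      = fderiv ℝ (fderiv ℝ (energy L)) (x, y) (y, 0) (0, v)
        - fderiv ℝ (energy L) (x, y) (v, 0) := by
  have hdet : IsUnit (metric L x y).det := isUnit_iff_ne_zero.mpr (h.det_ne_zero hy)
  have h1 : ∀ l, 2 * fderiv ℝ (fderiv ℝ (energy L)) (x, y) (0, spray L x y) (0, basisVec l)
      = fderiv ℝ (fderiv ℝ (energy L)) (x, y) (y, 0) (0, basisVec l)
        - fderiv ℝ (energy L) (x, y) (basisVec l, 0) := by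
    intro l
    set w : Fin n → ℝ := fun l => fderiv ℝ (fderiv ℝ (energy L)) (x, y) (y, 0) (0, basisVec l)
        - fderiv ℝ (energy L) (x, y) (basisVec l, 0) with hw
    have h2 := h.sum_metric hy (spray L x y) l
    have h3 : ∑ j, metric L x y j l * spray L x y j
        = (1 / 4) * ((metric L x y).mulVec ((metric L x y)⁻¹.mulVec w)) l := by
      simp only [Matrix.mulVec, dotProduct]
      rw [Finset.mul_sum]
      refine Finset.sum_congr rfl fun j _ => ?_
      rw [h.spray_eq hy, h.metric_symm hy j l]
      ring
    rw [Matrix.mulVec_mulVec, Matrix.mul_nonsing_inv _ hdet, Matrix.one_mulVec] at h3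
    have h4 : w l = fderiv ℝ (fderiv ℝ (energy L)) (x, y) (y, 0) (0, basisVec l)
        - fderiv ℝ (energy L) (x, y) (basisVec l, 0) := rfl
    linarith
  have e1 : ((0 : Coord n), v) = ∑ i, v i • ((0 : Coord n), (basisVec i : Coord n)) := by
    rw [Prod.ext_iff]
    simp [Prod.fst_sum, Prod.snd_sum, sum_basisVec]
  have e2 : (v, (0 : Coord n)) = ∑ i, v i • ((basisVec i : Coord n), (0 : Coord n)) := by
    rw [Prod.ext_iff]
    simp [Prod.fst_sum, Prod.snd_sum, sum_basisVec]
  rw [e1, e2, map_sum, map_sum, map_sum, Finset.mul_sum, ← Finset.sum_sub_distrib]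
  refine Finset.sum_congr rfl fun i _ => ?_
  simp only [map_smul, smul_eq_mul]
  linear_combination (v i) * h1 i

theorem FinslerNear.smooth_spray (h : FinslerNear L x) (hy : y ≠ 0) :
    SmoothNear (fun p : Coord n × Coord n => spray L p.1 p.2) (x, y) := by
  have hE := h.smooth_energy hy
  have hmet : ∀ i j, ∀ᶠ p in 𝓝 (x, y),
      ContDiffAt ℝ ∞ (fun p : Coord n × Coord n => metric L p.1 p.2 i j) p :=
    fun i j => h.smooth_metric hy i j
  have hmet' := eventually_all.mpr fun i => eventually_all.mpr (hmet i)
  filter_upwards [hE.fderiv, hE.fderiv.fderiv, hmet',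
    eventually_eventually_nhds.mpr (eventually_fst_ne h.eventually hy)] with p p1 p2 p3 p4
  have h1 : (fun p : Coord n × Coord n => spray L p.1 p.2) =ᶠ[𝓝 p]
      fun p => WithLp.toLp 2 fun i => (1 / 4) * ∑ l, (metric L p.1 p.2)⁻¹ i l *
      (fderiv ℝ (fderiv ℝ (energy L)) p (p.2, 0) (0, basisVec l)
        - fderiv ℝ (energy L) p (basisVec l, 0)) := by
    filter_upwards [p4] with q hq
    ext i
    exact hq.1.spray_eq hq.2 i
  refine ContDiffAt.congr_of_eventuallyEq ?_ h1
  refine contDiffAt_euclidean.mpr fun i => ?_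
  refine contDiffAt_const.mul (ContDiffAt.sum fun l _ => ?_)
  refine (contDiffAt_matrix_inv p3 (p4.self_of_nhds.1.det_ne_zero p4.self_of_nhds.2) i l).mul ?_
  refine ContDiffAt.sub ?_ (p1.clm_apply contDiffAt_const)
  exact (p2.clm_apply (contDiffAt_snd.prodMk contDiffAt_const)).clm_apply contDiffAt_const

end Chart

/-! ### The connection, its curvature and Berwald derivative; covariance and homogeneity. -/

section Connection

variable {n : ℕ} {L : Coord n → Coord n → ℝ} {x y : Coord n}

/-- The map `(x, y) ↦ (Gⁱⱼ(x, y))`. -/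
def connMap (L : Coord n → Coord n → ℝ) (p : Coord n × Coord n) : Coord n →L[ℝ] Coord n :=
  conn L p.1 p.2

theorem FinslerNear.smooth_conn (h : FinslerNear L x) (hy : y ≠ 0) :
    SmoothNear (connMap L) (x, y) := by
  filter_upwards [h.smooth_spray hy] with p hp
  have h1 : ContDiffAt ℝ ∞ (Function.uncurry fun (q : Coord n × Coord n) (y' : Coord n) =>
      spray L q.1 y') (p, p.2) :=
    ContDiffAt.comp (p, p.2) (g := fun p : Coord n × Coord n => spray L p.1 p.2)
      (f := fun q : (Coord n × Coord n) × Coord n => (q.1.1, q.2)) hp (by fun_prop)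
  exact ContDiffAt.fderiv (f := fun (q : Coord n × Coord n) (y' : Coord n) => spray L q.1 y')
    (g := Prod.snd) h1 contDiffAt_snd (by simp)

theorem FinslerNear.hasFDerivAt_spray (h : FinslerNear L x) (hy : y ≠ 0) :
    HasFDerivAt (spray L x) (conn L x y) y :=
  (differentiableAt_partial_snd (f := fun p : Coord n × Coord n => spray L p.1 p.2)
    (h.smooth_spray hy).differentiableAt).hasFDerivAt

/-- The curvature is written through derivatives of the connection along horizontal vectors, that
is, as the bracket of two horizontal lifts. In this form it appears as the leading coefficient of a
commutator. -/
theorem FinslerNear.curv_eq (h : FinslerNear L x) (hy : y ≠ 0) (u w : Coord n) :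
    curv L x y u w = fderiv ℝ (connMap L) (x, y) (w, -conn L x y w) u
      - fderiv ℝ (connMap L) (x, y) (u, -conn L x y u) w := by
  have hC := (h.smooth_conn hy).differentiableAt
  have h1 : ∀ a b : Coord n, fderiv ℝ (fun x' => conn L x' y a) x b
      = fderiv ℝ (connMap L) (x, y) (b, 0) a := fun a b => by
    have h2 := fderiv_partial_fst (f := fun p => connMap L p a) (x := x) (y := y)
      (hC.clm_apply (differentiableAt_const _)) b
    rw [fderiv_apply_const hC] at h2
    exact h2
  have h3 : ∀ a b : Coord n, fderiv ℝ (fun y' => conn L x y' a) y b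
      = fderiv ℝ (connMap L) (x, y) (0, b) a := fun a b => by
    have h2 := fderiv_partial_snd (f := fun p => connMap L p a) (x := x) (y := y)
      (hC.clm_apply (differentiableAt_const _)) b
    rw [fderiv_apply_const hC] at h2
    exact h2
  have h4 : ∀ a b : Coord n, fderiv ℝ (connMap L) (x, y) (a, -b)
      = fderiv ℝ (connMap L) (x, y) (a, 0) - fderiv ℝ (connMap L) (x, y) (0, b) := fun a b => by
    rw [← map_sub]; simp
  rw [curv, h1, h1, h3, h3, h4, h4, sub_apply, sub_apply]
  abel

/-- The Berwald derivative is the bracket with a horizontal lift: ξ is differentiated along the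
lift, and the connection along the vertical vector ξ. -/
theorem FinslerNear.berwald_eq (h : FinslerNear L x) (hy : y ≠ 0)
    {ξ : Coord n → Coord n → Coord n}
    (hξ : DifferentiableAt ℝ (fun p : Coord n × Coord n => ξ p.1 p.2) (x, y)) (u : Coord n) :
    berwald L ξ x y u
      = fderiv ℝ (fun p : Coord n × Coord n => ξ p.1 p.2) (x, y) (u, -conn L x y u)
        + fderiv ℝ (connMap L) (x, y) (0, ξ x y) u := by
  have hC := (h.smooth_conn hy).differentiableAt
  have h3 : fderiv ℝ (fun y' => conn L x y' u) y (ξ x y)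
      = fderiv ℝ (connMap L) (x, y) (0, ξ x y) u := by
    have h2 := fderiv_partial_snd (f := fun p => connMap L p u) (x := x) (y := y)
      (hC.clm_apply (differentiableAt_const _)) (ξ x y)
    rw [fderiv_apply_const hC] at h2
    exact h2
  have h1 := fderiv_partial_fst (f := fun p : Coord n × Coord n => ξ p.1 p.2) hξ u
  have h2 := fderiv_partial_snd (f := fun p : Coord n × Coord n => ξ p.1 p.2) hξ (conn L x y u)
  have h4 : ((u, -conn L x y u) : Coord n × Coord n) = (u, 0) - (0, conn L x y u) := by simp
  rw [berwald, h3, h4, map_sub, ← h1, ← h2]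

/-- The Finsler function is constant along horizontal curves. -/
theorem FinslerNear.horizontal_energy (h : FinslerNear L x) (hy : y ≠ 0) (u : Coord n) :
    fderiv ℝ (energy L) (x, y) (u, -conn L x y u) = 0 := by
  have he := h.smooth_energy hy
  -- The Euler–Lagrange equation contracted with y itself gives E_y(G) = ½ E_x(y). Differentiating
  -- in y along u and comparing with the Euler–Lagrange equation tested on u leaves E_y(G_j uʲ) =
  -- E_x(u).
  have key : ∀ᶠ y' in 𝓝 y, fderiv ℝ (energy L) (x, y') (0, spray L x y')
      = (1 / 2) * fderiv ℝ (energy L) (x, y') (y', 0) := by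
    filter_upwards [isOpen_ne.mem_nhds hy] with y' hy'
    have h1 := h.spray_char hy' y'
    have h2 := h.euler_second hy' (0, spray L x y')
    have h3 := h.euler_second hy' (y', 0)
    simp only at h2 h3
    have h4 : fderiv ℝ (energy L) (x, y') ((0 : Coord n), (0 : Coord n)) = 0 := map_zero _
    linarith
  have d1 : HasFDerivAt (fun y' => fderiv ℝ (energy L) (x, y')) _ y :=
    he.fderiv.differentiableAt.hasFDerivAt.comp y (hasFDerivAt_prodMk_right x y)
  have d2 := d1.clm_apply
    ((ContinuousLinearMap.inr ℝ (Coord n) (Coord n)).hasFDerivAt.comp y (h.hasFDerivAt_spray hy))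
  have d3 := (d1.clm_apply
    ((ContinuousLinearMap.inl ℝ (Coord n) (Coord n)).hasFDerivAt (x := y))).const_mul (1 / 2)
  have h5 := DFunLike.congr_fun (d2.unique (d3.congr_of_eventuallyEq key)) u
  simp only [ContinuousLinearMap.comp_apply, add_apply, smul_apply, Function.comp_apply,
    ContinuousLinearMap.inr_apply, ContinuousLinearMap.inl_apply, ContinuousLinearMap.flip_apply,
    smul_eq_mul] at h5
  have h6 := h.spray_char hy u
  have h7 := h.symm hy (0, u) (0, spray L x y)
  have h8 := h.symm hy (0, u) (y, 0)
  have h9 : ((u, -conn L x y u) : Coord n × Coord n) = (u, 0) - (0, conn L x y u) := by simp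
  rw [h9, map_sub]
  linarith

/-! #### Changes of coordinates -/

/-- The map of tangent bundles `(x, y) ↦ (ψ(x), Dψ(x) y)`. -/
def tangentLift (ψ : Coord n → Coord n) (p : Coord n × Coord n) : Coord n × Coord n :=
  (ψ p.1, fderiv ℝ ψ p.1 p.2)

/-- `ψ` is a change of coordinates around `x` that carries the Finsler function `L` to `L'`. -/
structure IsFinslerChange (ψ : Coord n → Coord n) (L L' : Coord n → Coord n → ℝ) (x : Coord n) :
    Prop where
  smooth : SmoothNear ψ x
  injective : ∀ u, fderiv ℝ ψ x u = 0 → u = 0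
  source : FinslerNear L x
  target : FinslerNear L' (ψ x)
  eq : ∀ᶠ x' in 𝓝 x, ∀ y, L x' y = L' (ψ x') (fderiv ℝ ψ x' y)

variable {ψ : Coord n → Coord n} {L' : Coord n → Coord n → ℝ}

theorem hasFDerivAt_tangentLift (hψ : SmoothNear ψ x) (y : Coord n) :
    HasFDerivAt (tangentLift ψ) (((fderiv ℝ ψ x).comp (.fst ℝ _ _)).prod
      ((fderiv ℝ ψ x).comp (.snd ℝ _ _)
        + ((fderiv ℝ (fderiv ℝ ψ) x).flip y).comp (.fst ℝ _ _))) (x, y) := by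
  refine HasFDerivAt.prodMk ?_ ?_
  · exact HasFDerivAt.comp (g := ψ) (x, y) hψ.differentiableAt.hasFDerivAt hasFDerivAt_fst
  · exact HasFDerivAt.clm_apply (c := fun p : Coord n × Coord n => fderiv ℝ ψ p.1)
      (HasFDerivAt.comp (g := fderiv ℝ ψ) (x, y)
        hψ.fderiv.differentiableAt.hasFDerivAt hasFDerivAt_fst) hasFDerivAt_snd

theorem fderiv_tangentLift (hψ : SmoothNear ψ x) (y a b : Coord n) :
    fderiv ℝ (tangentLift ψ) (x, y) (a, b)
      = (fderiv ℝ ψ x a, fderiv ℝ ψ x b + fderiv ℝ (fderiv ℝ ψ) x a y) := by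
  rw [(hasFDerivAt_tangentLift hψ y).fderiv]
  rfl

theorem smoothNear_tangentLift (hψ : SmoothNear ψ x) (y : Coord n) :
    SmoothNear (tangentLift ψ) (x, y) := by
  filter_upwards [(continuous_fst.tendsto (x, y)).eventually hψ,
    (continuous_fst.tendsto (x, y)).eventually hψ.fderiv] with p h1 h2
  exact (h1.comp p contDiffAt_fst).prodMk ((h2.comp p contDiffAt_fst).clm_apply contDiffAt_snd)

theorem second_symm (hψ : SmoothNear ψ x) (a b : Coord n) :
    fderiv ℝ (fderiv ℝ ψ) x a b = fderiv ℝ (fderiv ℝ ψ) x b a :=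
  (hψ.contDiffAt.isSymmSndFDerivAt (by
    rw [minSmoothness_of_isRCLikeNormedField]; exact ENat.LEInfty.out)) a b

theorem IsFinslerChange.eventually (h : IsFinslerChange ψ L L' x) :
    ∀ᶠ x' in 𝓝 x, IsFinslerChange ψ L L' x' := by
  have hinj : ∀ᶠ x' in 𝓝 x, Function.Injective (fderiv ℝ ψ x') := by
    have : Function.Injective (fderiv ℝ ψ x) :=
      (injective_iff_map_eq_zero _).mpr h.injective
    exact h.smooth.fderiv.continuousAt.eventually
      (ContinuousLinearMap.isOpen_injective.mem_nhds this)
  filter_upwards [h.smooth.eventually, hinj, h.source.eventually,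
    h.smooth.continuousAt.eventually h.target.eventually, eventually_eventually_nhds.mpr h.eq]
    with x' h1 h2 h3 h4 h5
  exact ⟨h1, fun u hu => h2 (by rw [hu, map_zero]), h3, h4, h5⟩

theorem IsFinslerChange.ne_zero (h : IsFinslerChange ψ L L' x) (hy : y ≠ 0) :
    fderiv ℝ ψ x y ≠ 0 := fun h0 => hy (h.injective y h0)

theorem IsFinslerChange.surjective (h : IsFinslerChange ψ L L' x) :
    Function.Surjective (fderiv ℝ ψ x) := by
  have : Function.Injective (fderiv ℝ ψ x).toLinearMap :=
    (injective_iff_map_eq_zero _).mpr h.injective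
  exact LinearMap.injective_iff_surjective.mp this

theorem IsFinslerChange.energy_eq (h : IsFinslerChange ψ L L' x) (y : Coord n) :
    ∀ᶠ p in 𝓝 (x, y), energy L p = energy L' (tangentLift ψ p) := by
  filter_upwards [(continuous_fst.tendsto (x, y)).eventually h.eq] with p hp
  simp only [energy, tangentLift]
  rw [hp]

theorem second_tangentLift (hψ : SmoothNear ψ x) (y v : Coord n) (a : Coord n × Coord n) :
    fderiv ℝ (fderiv ℝ (tangentLift ψ)) (x, y) a (0, v)
      = (0, fderiv ℝ (fderiv ℝ ψ) x a.1 v) := by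
  have h1 := fderiv_apply_const (smoothNear_tangentLift hψ y).fderiv.differentiableAt
    ((0 : Coord n), v) a
  rw [← h1]
  have h2 : (fun p => fderiv ℝ (tangentLift ψ) p ((0 : Coord n), v))
      =ᶠ[𝓝 (x, y)] fun p => ((0 : Coord n), fderiv ℝ ψ p.1 v) := by
    filter_upwards [(continuous_fst.tendsto (x, y)).eventually hψ.eventually] with p hp
    have := fderiv_tangentLift hp p.2 0 v
    simpa using this
  rw [h2.fderiv_eq]
  have h3 : HasFDerivAt (fun p : Coord n × Coord n => ((0 : Coord n), fderiv ℝ ψ p.1 v))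
      ((0 : Coord n × Coord n →L[ℝ] Coord n).prod
        (((fderiv ℝ (fderiv ℝ ψ) x).flip v).comp (.fst ℝ _ _))) (x, y) := by
    refine (hasFDerivAt_const (0 : Coord n) (x, y)).prodMk ?_
    have h4 : HasFDerivAt (fun x' => fderiv ℝ ψ x' v) ((fderiv ℝ (fderiv ℝ ψ) x).flip v) x := by
      have := hψ.fderiv.differentiableAt.hasFDerivAt.clm_apply (hasFDerivAt_const v x)
      simpa using this
    exact HasFDerivAt.comp (g := fun x' => fderiv ℝ ψ x' v) (x, y) h4 hasFDerivAt_fst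
  rw [h3.fderiv]
  rfl

/-- Both sprays satisfy the Euler–Lagrange equation. Pulling back the one for `L'` through the
tangent lift produces D²ψ(y, y) from the x-derivative of Dψ(x) y, and nondegeneracy identifies the
two vectors. -/
theorem IsFinslerChange.spray_eq (h : IsFinslerChange ψ L L' x) (hy : y ≠ 0) :
    fderiv ℝ ψ x (spray L x y) = spray L' (ψ x) (fderiv ℝ ψ x y)
      + (1 / 2 : ℝ) • fderiv ℝ (fderiv ℝ ψ) x y y := by
  have hy' := h.ne_zero hy
  have hE' := h.target.smooth_energy hy'
  have hT := smoothNear_tangentLift h.smooth y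
  have e1 : ∀ a v, fderiv ℝ (fderiv ℝ (energy L)) (x, y) a (0, v)
      = fderiv ℝ (fderiv ℝ (energy L')) (ψ x, fderiv ℝ ψ x y)
          (fderiv ℝ (tangentLift ψ) (x, y) a) (0, fderiv ℝ ψ x v)
        + fderiv ℝ (energy L') (ψ x, fderiv ℝ ψ x y) (0, fderiv ℝ (fderiv ℝ ψ) x a.1 v) := by
    intro a v
    rw [fderiv_fderiv_comp (f := energy L) (g := energy L') (ψ := tangentLift ψ) (x := (x, y)) hE' hT
      (h.energy_eq y), second_tangentLift h.smooth, fderiv_tangentLift h.smooth y 0 v]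
    simp [tangentLift]
  have e2 : ∀ a, fderiv ℝ (energy L) (x, y) a
      = fderiv ℝ (energy L') (ψ x, fderiv ℝ ψ x y) (fderiv ℝ (tangentLift ψ) (x, y) a) := by
    intro a
    have h1 : energy L =ᶠ[𝓝 (x, y)] energy L' ∘ tangentLift ψ := h.energy_eq y
    rw [h1.fderiv_eq, fderiv_comp (x, y) hE'.differentiableAt hT.differentiableAt]
    rfl
  rw [← sub_eq_zero]
  refine h.target.nondegenerate hy' fun v' => ?_
  obtain ⟨v, rfl⟩ := h.surjective v'
  have c1 := h.source.spray_char hy v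
  have c2 := h.target.spray_char hy' (fderiv ℝ ψ x v)
  rw [e1, e1, e2, fderiv_tangentLift h.smooth, fderiv_tangentLift h.smooth,
    fderiv_tangentLift h.smooth] at c1
  simp only [add_zero, zero_add, map_zero, zero_apply, Prod.mk_zero_zero] at c1
  have s1 : ∀ a b : Coord n, ((a, b) : Coord n × Coord n) = (a, 0) + (0, b) := fun a b => by simp
  rw [s1 (fderiv ℝ ψ x y) _, s1 (fderiv ℝ ψ x v) _, map_add, map_add, add_apply] at c1
  have s2 : ((0 : Coord n), fderiv ℝ ψ x (spray L x y) - (spray L' (ψ x) (fderiv ℝ ψ x y)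
      + (1 / 2 : ℝ) • fderiv ℝ (fderiv ℝ ψ) x y y))
      = (0, fderiv ℝ ψ x (spray L x y)) - ((0, spray L' (ψ x) (fderiv ℝ ψ x y))
        + (1 / 2 : ℝ) • ((0 : Coord n), fderiv ℝ (fderiv ℝ ψ) x y y)) := by simp
  rw [s2, map_sub, map_add, map_smul, sub_apply, add_apply, smul_apply, smul_eq_mul]
  rw [second_symm h.smooth y v] at c1
  linarith

/-- The law for the spray is differentiated in y. The quadratic term D²ψ(y, y) contributes twice by
symmetry, which absorbs the factor ½. -/
theorem IsFinslerChange.conn_eq (h : IsFinslerChange ψ L L' x) (hy : y ≠ 0) (u : Coord n) :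
    fderiv ℝ ψ x (conn L x y u) = conn L' (ψ x) (fderiv ℝ ψ x y) (fderiv ℝ ψ x u)
      + fderiv ℝ (fderiv ℝ ψ) x y u := by
  have d1 := (fderiv ℝ ψ x).hasFDerivAt.comp y (h.source.hasFDerivAt_spray hy)
  have d2 := (h.target.hasFDerivAt_spray (h.ne_zero hy)).comp y (fderiv ℝ ψ x).hasFDerivAt
  have d3 := ((fderiv ℝ (fderiv ℝ ψ) x).hasFDerivAt.clm_apply
    (hasFDerivAt_id (𝕜 := ℝ) y)).const_smul (1 / 2 : ℝ)
  have h1 : (fderiv ℝ ψ x ∘ spray L x) =ᶠ[𝓝 y] fun y' =>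
      (spray L' (ψ x) ∘ fderiv ℝ ψ x) y' + (1 / 2 : ℝ) • (fderiv ℝ (fderiv ℝ ψ) x y' (id y')) := by
    filter_upwards [isOpen_ne.mem_nhds hy] with y' hy'
    exact h.spray_eq hy'
  have h2 := DFunLike.congr_fun (d1.unique ((d2.add d3).congr_of_eventuallyEq h1)) u
  simp only [ContinuousLinearMap.comp_apply, add_apply, smul_apply, ContinuousLinearMap.flip_apply,
    ContinuousLinearMap.id_apply, id_eq] at h2
  rw [h2, second_symm h.smooth u y]
  congr 1
  rw [← two_smul ℝ, smul_smul]
  norm_num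

theorem IsFinslerChange.fderiv_conn (h : IsFinslerChange ψ L L' x) (hy : y ≠ 0)
    (a : Coord n × Coord n) (u : Coord n) :
    fderiv ℝ (fderiv ℝ ψ) x a.1 (conn L x y u) + fderiv ℝ ψ x (fderiv ℝ (connMap L) (x, y) a u)
      = fderiv ℝ (connMap L') (ψ x, fderiv ℝ ψ x y)
          (fderiv ℝ (tangentLift ψ) (x, y) a) (fderiv ℝ ψ x u)
        + conn L' (ψ x) (fderiv ℝ ψ x y) (fderiv ℝ (fderiv ℝ ψ) x a.1 u)
        + (fderiv ℝ (fderiv ℝ (fderiv ℝ ψ)) x a.1 y u + fderiv ℝ (fderiv ℝ ψ) x a.2 u) := by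
  have hψ := h.smooth
  have p1 : HasFDerivAt (fun p : Coord n × Coord n => fderiv ℝ ψ p.1)
      ((fderiv ℝ (fderiv ℝ ψ) x).comp (.fst ℝ _ _)) (x, y) :=
    HasFDerivAt.comp (g := fderiv ℝ ψ) (x, y) hψ.fderiv.differentiableAt.hasFDerivAt
      hasFDerivAt_fst
  have p2 : HasFDerivAt (fun p : Coord n × Coord n => fderiv ℝ (fderiv ℝ ψ) p.1)
      ((fderiv ℝ (fderiv ℝ (fderiv ℝ ψ)) x).comp (.fst ℝ _ _)) (x, y) :=
    HasFDerivAt.comp (g := fderiv ℝ (fderiv ℝ ψ)) (f := (Prod.fst : Coord n × Coord n → Coord n))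
      (x, y) hψ.fderiv.fderiv.differentiableAt.hasFDerivAt hasFDerivAt_fst
  have p3 : HasFDerivAt (fun p => connMap L' (tangentLift ψ p))
      ((fderiv ℝ (connMap L') (ψ x, fderiv ℝ ψ x y)).comp (fderiv ℝ (tangentLift ψ) (x, y)))
      (x, y) :=
    HasFDerivAt.comp (g := connMap L') (x, y)
      (h.target.smooth_conn (h.ne_zero hy)).differentiableAt.hasFDerivAt
      (smoothNear_tangentLift hψ y).differentiableAt.hasFDerivAt
  have d1 := p1.clm_apply ((h.source.smooth_conn hy).differentiableAt.hasFDerivAt.clm_apply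
    (hasFDerivAt_const u (x, y)))
  have d2 := (p3.clm_apply (p1.clm_apply (hasFDerivAt_const u (x, y)))).add
    ((p2.clm_apply (hasFDerivAt_snd (𝕜 := ℝ))).clm_apply (hasFDerivAt_const u (x, y)))
  have h1 : (fun p : Coord n × Coord n => fderiv ℝ ψ p.1 (connMap L p u)) =ᶠ[𝓝 (x, y)] fun p =>
      connMap L' (tangentLift ψ p) (fderiv ℝ ψ p.1 u) + fderiv ℝ (fderiv ℝ ψ) p.1 p.2 u := by
    filter_upwards [eventually_fst_ne h.eventually hy] with p hp
    exact hp.1.conn_eq hp.2 u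
  have h2 := DFunLike.congr_fun (d1.unique (d2.congr_of_eventuallyEq h1)) a
  simp only [ContinuousLinearMap.comp_apply, add_apply, ContinuousLinearMap.flip_apply,
    ContinuousLinearMap.coe_fst', ContinuousLinearMap.coe_snd', zero_apply, map_zero, zero_add,
    connMap, tangentLift] at h2
  rw [add_comm, h2]
  abel

/-- Horizontal lifts correspond to horizontal lifts: the inhomogeneous term of the connection
cancels the second derivative of ψ in the tangent lift. -/
theorem IsFinslerChange.fderiv_tangentLift_horizontal (h : IsFinslerChange ψ L L' x) (hy : y ≠ 0)
    (w : Coord n) :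
    fderiv ℝ (tangentLift ψ) (x, y) (w, -conn L x y w)
      = (fderiv ℝ ψ x w, -conn L' (ψ x) (fderiv ℝ ψ x y) (fderiv ℝ ψ x w)) := by
  rw [fderiv_tangentLift h.smooth, map_neg, h.conn_eq hy, second_symm h.smooth w y]
  congr 1
  abel

/-- The law for the connection is differentiated along two horizontal vectors and antisymmetrized.
All second and third derivatives of ψ drop out by their symmetry (`s1`, `s2`, `s3`). -/
theorem IsFinslerChange.curv_eq (h : IsFinslerChange ψ L L' x) (hy : y ≠ 0) (u w : Coord n) :
    fderiv ℝ ψ x (curv L x y u w)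
      = curv L' (ψ x) (fderiv ℝ ψ x y) (fderiv ℝ ψ x u) (fderiv ℝ ψ x w) := by
  have hψ := h.smooth
  rw [h.source.curv_eq hy, h.target.curv_eq (h.ne_zero hy), map_sub,
    ← h.fderiv_tangentLift_horizontal hy, ← h.fderiv_tangentLift_horizontal hy]
  have h1 := h.fderiv_conn hy (w, -conn L x y w) u
  have h2 := h.fderiv_conn hy (u, -conn L x y u) w
  simp only [map_neg, neg_apply] at h1 h2
  have s1 : ∀ a b c : Coord n, fderiv ℝ (fderiv ℝ (fderiv ℝ ψ)) x a b c
      = fderiv ℝ (fderiv ℝ (fderiv ℝ ψ)) x a c b := by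
    intro a b c
    have e1 : ∀ b c, fderiv ℝ (fun x' => fderiv ℝ (fderiv ℝ ψ) x' b c) x a
        = fderiv ℝ (fderiv ℝ (fderiv ℝ ψ)) x a b c := fun b c => by
      rw [fderiv_apply_const (hψ.fderiv.fderiv.differentiableAt.clm_apply
        (differentiableAt_const _)), fderiv_apply_const hψ.fderiv.fderiv.differentiableAt]
    rw [← e1, ← e1]
    refine congrFun (congrArg DFunLike.coe (EventuallyEq.fderiv_eq ?_)) a
    filter_upwards [hψ.eventually] with x' hx'
    exact second_symm hx' b c
  have s2 : ∀ a b c : Coord n, fderiv ℝ (fderiv ℝ (fderiv ℝ ψ)) x a b c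
      = fderiv ℝ (fderiv ℝ (fderiv ℝ ψ)) x b a c := by
    intro a b c
    exact DFunLike.congr_fun ((hψ.fderiv.contDiffAt.isSymmSndFDerivAt (by
      rw [minSmoothness_of_isRCLikeNormedField]; exact ENat.LEInfty.out)) a b) c
  have s3 : fderiv ℝ (fderiv ℝ (fderiv ℝ ψ)) x w y u
      = fderiv ℝ (fderiv ℝ (fderiv ℝ ψ)) x u y w := by
    rw [s1 w y u, s2 w u y, s1 u w y]
  rw [second_symm hψ w u, second_symm hψ w (conn L x y u), s3,
    second_symm hψ (conn L x y w) u] at h1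
  rw [second_symm hψ (conn L x y u) w, second_symm hψ w (conn L x y u)] at h2
  rw [← sub_eq_zero] at h1 h2 ⊢
  have h3 := congrArg₂ (· - ·) h1 h2
  simp only [sub_self] at h3
  rw [← h3]
  abel

/-- Differentiating the relation between ξ and ξ' along a horizontal vector produces a term D²ψ(u,
ξ). The same term arises, with the opposite effect, when the connection is differentiated along ξ.
-/
theorem IsFinslerChange.berwald_eq (h : IsFinslerChange ψ L L' x) (hy : y ≠ 0)
    {ξ ξ' : Coord n → Coord n → Coord n}
    (hξ : DifferentiableAt ℝ (fun p : Coord n × Coord n => ξ p.1 p.2) (x, y))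
    (hξ' : DifferentiableAt ℝ (fun p : Coord n × Coord n => ξ' p.1 p.2) (ψ x, fderiv ℝ ψ x y))
    (hξξ' : ∀ᶠ p in 𝓝 (x, y), fderiv ℝ ψ p.1 (ξ p.1 p.2) = ξ' (ψ p.1) (fderiv ℝ ψ p.1 p.2))
    (u : Coord n) :
    fderiv ℝ ψ x (berwald L ξ x y u)
      = berwald L' ξ' (ψ x) (fderiv ℝ ψ x y) (fderiv ℝ ψ x u) := by
  have hψ := h.smooth
  rw [h.source.berwald_eq hy hξ, h.target.berwald_eq (h.ne_zero hy) hξ', map_add,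
    ← h.fderiv_tangentLift_horizontal hy]
  have p1 : HasFDerivAt (fun p : Coord n × Coord n => fderiv ℝ ψ p.1)
      ((fderiv ℝ (fderiv ℝ ψ) x).comp (.fst ℝ _ _)) (x, y) :=
    HasFDerivAt.comp (g := fderiv ℝ ψ) (x, y) hψ.fderiv.differentiableAt.hasFDerivAt
      hasFDerivAt_fst
  have d1 := p1.clm_apply hξ.hasFDerivAt
  have d2 : HasFDerivAt (fun p => ξ' (ψ p.1) (fderiv ℝ ψ p.1 p.2)) _ (x, y) :=
    HasFDerivAt.comp (g := fun p : Coord n × Coord n => ξ' p.1 p.2) (f := tangentLift ψ) (x, y)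
      hξ'.hasFDerivAt (smoothNear_tangentLift hψ y).differentiableAt.hasFDerivAt
  have h1 := DFunLike.congr_fun (d1.unique (d2.congr_of_eventuallyEq hξξ')) (u, -conn L x y u)
  simp only [ContinuousLinearMap.comp_apply, add_apply, ContinuousLinearMap.flip_apply,
    ContinuousLinearMap.coe_fst'] at h1
  have h2 := h.fderiv_conn hy (0, ξ x y) u
  have h3 : fderiv ℝ ψ x (ξ x y) = ξ' (ψ x) (fderiv ℝ ψ x y) := hξξ'.self_of_nhds
  simp only [map_zero, zero_apply, zero_add, add_zero, fderiv_tangentLift hψ, h3] at h2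
  rw [h2, ← h1, second_symm hψ u (ξ x y)]
  abel

/-! #### Homogeneity -/

/-- The energy is multiplied by r² under the dilatation, so each term of the Euler–Lagrange equation
scales by a known power of r. Nondegeneracy at r y gives the conclusion. -/
theorem FinslerNear.spray_smul (h : FinslerNear L x) (hy : y ≠ 0) {r : ℝ} (hr : 0 < r) :
    spray L x (r • y) = r ^ 2 • spray L x y := by
  have hy' : r • y ≠ 0 := smul_ne_zero hr.ne' hy
  have hE := h.smooth_energy hy
  have hE' := h.smooth_energy hy'
  have hd : SmoothNear (dilate n r) (x, y) := smoothNear_of_contDiff (dilate n r).contDiff _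
  have e2 : ∀ a, fderiv ℝ (energy L) (x, r • y) (dilate n r a)
      = r ^ 2 * fderiv ℝ (energy L) (x, y) a := by
    intro a
    have d1 : HasFDerivAt (fun p => energy L (dilate n r p)) _ (x, y) :=
      HasFDerivAt.comp (g := energy L) (x, y) hE'.differentiableAt.hasFDerivAt
        (dilate n r).hasFDerivAt
    have d2 := hE.differentiableAt.hasFDerivAt.const_mul (r ^ 2)
    exact DFunLike.congr_fun (d1.unique (d2.congr_of_eventuallyEq (h.energy_dilate hr y))) a
  have e1 : ∀ a b, fderiv ℝ (fderiv ℝ (energy L)) (x, r • y) (dilate n r a) (dilate n r b)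
      = r ^ 2 * fderiv ℝ (fderiv ℝ (energy L)) (x, y) a b := by
    intro a b
    have e3 : ∀ᶠ p in 𝓝 (x, y), fderiv ℝ (energy L) (dilate n r p) (dilate n r b)
        = r ^ 2 * fderiv ℝ (energy L) p b := by
      filter_upwards [eventually_fst_ne h.eventually hy] with p hp
      have d1 : HasFDerivAt (fun p => energy L (dilate n r p)) _ p :=
        HasFDerivAt.comp (g := energy L) p
          (hp.1.smooth_energy (smul_ne_zero hr.ne' hp.2)).differentiableAt.hasFDerivAt
          (dilate n r).hasFDerivAt
      have d2 := (hp.1.smooth_energy hp.2).differentiableAt.hasFDerivAt.const_mul (r ^ 2)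
      exact DFunLike.congr_fun (d1.unique (d2.congr_of_eventuallyEq (hp.1.energy_dilate hr p.2))) b
    have d1 : HasFDerivAt (fun p => fderiv ℝ (energy L) (dilate n r p) (dilate n r b)) _ (x, y) :=
      (HasFDerivAt.comp (g := fderiv ℝ (energy L)) (x, y)
        hE'.fderiv.differentiableAt.hasFDerivAt (dilate n r).hasFDerivAt).clm_apply
        (hasFDerivAt_const _ _)
    have d2 := (hE.fderiv.differentiableAt.hasFDerivAt.clm_apply
      (hasFDerivAt_const b (x, y))).const_mul (r ^ 2)
    have := DFunLike.congr_fun (d1.unique (d2.congr_of_eventuallyEq e3)) a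
    simpa using this
  rw [← sub_eq_zero]
  refine h.nondegenerate hy' fun v' => ?_
  obtain ⟨v, rfl⟩ : ∃ v, v' = r • v := ⟨r⁻¹ • v', by rw [smul_smul, mul_inv_cancel₀ hr.ne', one_smul]⟩
  have c1 := h.spray_char hy' (r • v)
  have c2 := h.spray_char hy v
  have f1 := e1 (y, 0) (0, v)
  have f2 := e1 (0, spray L x y) (0, v)
  have f3 := e2 (v, 0)
  simp only [dilate_apply, smul_zero] at f1 f2 f3
  have g1 : fderiv ℝ (energy L) (x, r • y) (r • v, 0)
      = r * fderiv ℝ (energy L) (x, r • y) (v, 0) := by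
    rw [← smul_eq_mul, ← map_smul]; simp
  have g2 : fderiv ℝ (fderiv ℝ (energy L)) (x, r • y) (r • y, 0) (0, r • v)
      = r * fderiv ℝ (fderiv ℝ (energy L)) (x, r • y) (y, 0) (0, r • v) := by
    rw [← smul_eq_mul, ← smul_apply, ← map_smul]; simp
  have g3 : fderiv ℝ (fderiv ℝ (energy L)) (x, r • y) (0, r ^ 2 • spray L x y) (0, r • v)
      = r * fderiv ℝ (fderiv ℝ (energy L)) (x, r • y) (0, r • spray L x y) (0, r • v) := by
    rw [← smul_eq_mul, ← smul_apply, ← map_smul]; simp [smul_smul, sq]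
  have g4 : ((0 : Coord n), spray L x (r • y) - r ^ 2 • spray L x y)
      = (0, spray L x (r • y)) - (0, r ^ 2 • spray L x y) := by simp
  rw [g4, map_sub, sub_apply, g3, f2]
  rw [g2, f1, g1, f3] at c1
  linear_combination (1 / 2) * c1 - (r ^ 3 / 2) * c2

theorem FinslerNear.conn_smul (h : FinslerNear L x) (hy : y ≠ 0) {r : ℝ} (hr : 0 < r) :
    conn L x (r • y) = r • conn L x y := by
  have d1 := (h.hasFDerivAt_spray (smul_ne_zero hr.ne' hy)).comp y
    ((hasFDerivAt_id (𝕜 := ℝ) y).const_smul r)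
  have d2 := (h.hasFDerivAt_spray hy).const_smul (r ^ 2)
  have h1 : (spray L x ∘ (r • id)) =ᶠ[𝓝 y] r ^ 2 • spray L x := by
    filter_upwards [isOpen_ne.mem_nhds hy] with y' hy'
    exact h.spray_smul hy' hr
  have h2 := d1.unique (d2.congr_of_eventuallyEq h1)
  refine ContinuousLinearMap.ext fun v => ?_
  have h3 := DFunLike.congr_fun h2 v
  simp only [ContinuousLinearMap.comp_apply, smul_apply, ContinuousLinearMap.id_apply,
    map_smul] at h3
  have h4 : r • conn L x (r • y) v = r • (r • conn L x y v) := by rw [h3, smul_smul, sq]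
  exact smul_right_injective _ hr.ne' h4

theorem fderiv_dilate {G : Type} [NormedAddCommGroup G] [NormedSpace ℝ G]
    {f : Coord n × Coord n → G} {r : ℝ} (hf : DifferentiableAt ℝ f (x, y))
    (hf' : DifferentiableAt ℝ f (x, r • y))
    (hr : ∀ᶠ p in 𝓝 (x, y), f (dilate n r p) = r • f p) (a : Coord n × Coord n) :
    fderiv ℝ f (x, r • y) (dilate n r a) = r • fderiv ℝ f (x, y) a := by
  have d1 : HasFDerivAt (fun p => f (dilate n r p)) _ (x, y) :=
    HasFDerivAt.comp (g := f) (x, y) hf'.hasFDerivAt (dilate n r).hasFDerivAt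
  exact DFunLike.congr_fun (d1.unique ((hf.hasFDerivAt.const_smul r).congr_of_eventuallyEq hr)) a

theorem FinslerNear.fderiv_conn_smul (h : FinslerNear L x) (hy : y ≠ 0) {r : ℝ} (hr : 0 < r)
    (a : Coord n × Coord n) :
    fderiv ℝ (connMap L) (x, r • y) (dilate n r a) = r • fderiv ℝ (connMap L) (x, y) a := by
  refine fderiv_dilate (h.smooth_conn hy).differentiableAt
    (h.smooth_conn (smul_ne_zero hr.ne' hy)).differentiableAt ?_ a
  filter_upwards [eventually_fst_ne h.eventually hy] with p hp
  exact hp.1.conn_smul hp.2 hr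

theorem FinslerNear.curv_smul (h : FinslerNear L x) (hy : y ≠ 0) {r : ℝ} (hr : 0 < r)
    (u w : Coord n) : curv L x (r • y) u w = r • curv L x y u w := by
  have h1 := h.fderiv_conn_smul hy hr (w, -conn L x y w)
  have h2 := h.fderiv_conn_smul hy hr (u, -conn L x y u)
  rw [h.curv_eq (smul_ne_zero hr.ne' hy), h.curv_eq hy, h.conn_smul hy hr, smul_sub]
  simp only [dilate_apply, smul_neg] at h1 h2
  rw [smul_apply, smul_apply, h1, h2, smul_apply, smul_apply]

theorem FinslerNear.berwald_smul (h : FinslerNear L x) (hy : y ≠ 0)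
    {ξ : Coord n → Coord n → Coord n}
    (hξ : ∀ y, y ≠ 0 → DifferentiableAt ℝ (fun p : Coord n × Coord n => ξ p.1 p.2) (x, y))
    {r : ℝ} (hr : 0 < r) (hξr : ∀ x y, ξ x (r • y) = r • ξ x y)
    (u : Coord n) : berwald L ξ x (r • y) u = r • berwald L ξ x y u := by
  have h1 := h.fderiv_conn_smul hy hr (0, ξ x y)
  have h2 := fderiv_dilate (r := r) (hξ y hy) (hξ _ (smul_ne_zero hr.ne' hy))
    (Eventually.of_forall fun p => hξr p.1 p.2) (u, -conn L x y u)
  rw [h.berwald_eq (smul_ne_zero hr.ne' hy) (hξ _ (smul_ne_zero hr.ne' hy)),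
    h.berwald_eq hy (hξ y hy), h.conn_smul hy hr, hξr, smul_add]
  simp only [dilate_apply, smul_neg] at h1 h2
  rw [smul_apply, h1, h2, smul_apply]

end Connection

/-! ### Finsler functions in the charts of the manifold -/

section Manifold

variable {n : ℕ} {M : Type*} [TopologicalSpace M] [ChartedSpace (Coord n) M]
  [IsManifold (𝓡 n) ∞ M] (F : FinslerFunction n M)

/-- The domain of the chart around `x₀`. -/
abbrev chartDom (n : ℕ) {M : Type*} [TopologicalSpace M] [ChartedSpace (Coord n) M] (x₀ : M) : Set M := (extChartAt (𝓡 n) x₀).source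

/-- The image of the chart around `x₀`. -/
abbrev chartRan (n : ℕ) {M : Type*} [TopologicalSpace M] [ChartedSpace (Coord n) M] (x₀ : M) : Set (Coord n) := (extChartAt (𝓡 n) x₀).target

theorem isOpen_chartRan (x₀ : M) : IsOpen (chartRan n x₀) := isOpen_extChartAt_target x₀

theorem mem_chartDom_self (x₀ : M) : x₀ ∈ chartDom n x₀ := mem_extChartAt_source x₀

theorem pointOf_mem {x₀ : M} {x : Coord n} (hx : x ∈ chartRan n x₀) : pointOf x₀ x ∈ chartDom n x₀ :=
  (extChartAt (𝓡 n) x₀).map_target hx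

theorem extChartAt_pointOf {x₀ : M} {x : Coord n} (hx : x ∈ chartRan n x₀) :
    extChartAt (𝓡 n) x₀ (pointOf x₀ x) = x :=
  (extChartAt (𝓡 n) x₀).right_inv hx

theorem pointOf_extChartAt {x₀ z : M} (hz : z ∈ chartDom n x₀) :
    pointOf x₀ (extChartAt (𝓡 n) x₀ z) = z :=
  (extChartAt (𝓡 n) x₀).left_inv hz

theorem vecOf_coordOf {x₀ z : M} (hz : z ∈ chartDom n x₀) (v : Coord n) :
    vecOf x₀ z (coordOf x₀ z v) = v := by
  rw [vecOf, coordOf, tangentCoordChange_comp ⟨⟨mem_chartDom_self (n := n) z, hz⟩, mem_chartDom_self (n := n) z⟩,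
    tangentCoordChange_self (mem_chartDom_self (n := n) z)]

theorem coordOf_vecOf {x₀ z : M} (hz : z ∈ chartDom n x₀) (y : Coord n) :
    coordOf x₀ z (vecOf x₀ z y) = y := by
  rw [vecOf, coordOf, tangentCoordChange_comp ⟨⟨hz, mem_chartDom_self (n := n) z⟩, hz⟩,
    tangentCoordChange_self hz]

/-- The isomorphism `y ↦ yⁱ ∂/∂xⁱ` of `ℝⁿ` onto `T_zM`. -/
def vecEquiv {x₀ z : M} (hz : z ∈ chartDom n x₀) : Coord n ≃L[ℝ] Coord n :=
  .equivOfInverse (tangentCoordChange (𝓡 n) x₀ z z) (tangentCoordChange (𝓡 n) z x₀ z)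
    (coordOf_vecOf hz) (vecOf_coordOf hz)

theorem vecEquiv_apply {x₀ z : M} (hz : z ∈ chartDom n x₀) (y : Coord n) :
    vecEquiv hz y = vecOf x₀ z y := rfl

theorem vecOf_ne_zero {x₀ z : M} (hz : z ∈ chartDom n x₀) {y : Coord n} (hy : y ≠ 0) :
    vecOf x₀ z y ≠ 0 := (vecEquiv hz).map_ne_zero_iff.mpr hy

theorem coordOf_ne_zero {x₀ z : M} (hz : z ∈ chartDom n x₀) {v : Coord n} (hv : v ≠ 0) :
    coordOf x₀ z v ≠ 0 := (vecEquiv hz).symm.map_ne_zero_iff.mpr hv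

theorem vecOf_smul (x₀ z : M) (r : ℝ) (y : Coord n) : vecOf x₀ z (r • y) = r • vecOf x₀ z y :=
  map_smul (tangentCoordChange (𝓡 n) x₀ z z) r y

theorem coordOf_smul (x₀ z : M) (r : ℝ) (y : Coord n) :
    coordOf x₀ z (r • y) = r • coordOf x₀ z y :=
  map_smul (tangentCoordChange (𝓡 n) z x₀ z) r y

theorem coordOf_self (z : M) (v : Coord n) : coordOf z z v = v :=
  tangentCoordChange_self (mem_chartDom_self (n := n) z)

theorem vecOf_self (z : M) (v : Coord n) : vecOf z z v = v :=
  tangentCoordChange_self (mem_chartDom_self (n := n) z)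

theorem fib_smul (p : M) {r : ℝ} (hr : 0 < r) (y : Coord n) : F.fib p (r • y) = r * F.fib p y :=
  F.homogeneous p y r hr

theorem fib_pos (p : M) {y : Coord n} (hy : y ≠ 0) : 0 < F.fib p y := F.pos p y hy

theorem inChart_extChartAt {x₀ z : M} (hz : z ∈ chartDom n x₀) (v : Coord n) :
    F.inChart x₀ (extChartAt (𝓡 n) x₀ z) (coordOf x₀ z v) = F.fib z v := by
  rw [FinslerFunction.inChart, pointOf_extChartAt hz, vecOf_coordOf hz]

/-- The tangent vector with the coordinates `(x, y)`. -/
def bundlePoint (x₀ : M) (p : Coord n × Coord n) : TangentBundle (𝓡 n) M :=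
  ⟨pointOf x₀ p.1, vecOf x₀ (pointOf x₀ p.1) p.2⟩

theorem contMDiffOn_bundlePoint (x₀ : M) :
    ContMDiffOn 𝓘(ℝ, Coord n × Coord n) (𝓡 n).tangent ∞ (bundlePoint x₀)
      (chartRan n x₀ ×ˢ univ) := by
  have h1 := contMDiffOn_extChartAt_symm (I := (𝓡 n).tangent) (n := ∞)
    (⟨x₀, (0 : Coord n)⟩ : TangentBundle (𝓡 n) M)
  have h2 : (extChartAt (𝓡 n).tangent (⟨x₀, (0 : Coord n)⟩ : TangentBundle (𝓡 n) M)).target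
      = chartRan n x₀ ×ˢ univ := by
    rw [FiberBundle.extChartAt_target]
    congr 1
    refine inter_eq_left.mpr fun x hx => ?_
    have := pointOf_mem hx
    simp only [chartDom, extChartAt_source] at this
    exact this
  rw [h2] at h1
  refine h1.congr fun p hp => ?_
  rw [FiberBundle.extChartAt]
  rfl

theorem continuousAt_inChart {x₀ : M} {x : Coord n} (hx : x ∈ chartRan n x₀) (y : Coord n) :
    ContinuousAt (fun p : Coord n × Coord n => F.inChart x₀ p.1 p.2) (x, y) := by
  have h1 : (chartRan n x₀ ×ˢ (univ : Set (Coord n))) ∈ 𝓝 (x, y) :=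
    ((isOpen_chartRan x₀).prod isOpen_univ).mem_nhds ⟨hx, mem_univ _⟩
  exact F.continuous_toFun.continuousAt.comp
    ((contMDiffOn_bundlePoint x₀).continuousOn.continuousAt h1)

theorem contDiffAt_inChart {x₀ : M} {x y : Coord n} (hx : x ∈ chartRan n x₀) (hy : y ≠ 0) :
    ContDiffAt ℝ ∞ (fun p : Coord n × Coord n => F.inChart x₀ p.1 p.2) (x, y) := by
  have hO : IsOpen (chartRan n x₀ ×ˢ ({0}ᶜ : Set (Coord n))) :=
    (isOpen_chartRan x₀).prod isOpen_compl_singleton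
  have h1 : ContMDiffOn 𝓘(ℝ, Coord n × Coord n) 𝓘(ℝ, ℝ) ∞ (F.toFun ∘ bundlePoint x₀)
      (chartRan n x₀ ×ˢ ({0}ᶜ : Set (Coord n))) := by
    refine F.smooth_toFun.comp ((contMDiffOn_bundlePoint x₀).mono
      (prod_mono_right (subset_univ _))) fun p hp => ?_
    exact vecOf_ne_zero (pointOf_mem hp.1) hp.2
  exact (contMDiffOn_iff_contDiffOn.mp h1).contDiffAt (hO.mem_nhds ⟨hx, hy⟩)

/-- No differentiability of `f` is required: composition with a linear isomorphism commutes with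
`fderiv` unconditionally. -/
theorem fundForm_comp_equiv (f : Coord n → ℝ) (A : Coord n ≃L[ℝ] Coord n) (y u v : Coord n) :
    fundForm (fun y' => f (A y')) y u v = fundForm f (A y) (A u) (A v) := by
  unfold fundForm
  congr 1
  have h1 : (fun y' => fderiv ℝ (fun y'' => f (A y'') ^ 2) y' v)
      = (fun z => fderiv ℝ (fun y'' => f y'' ^ 2) z (A v)) ∘ A := by
    funext y'
    have := A.comp_right_fderiv (f := fun y'' => f y'' ^ 2) (x := y')
    have h2 := DFunLike.congr_fun this v
    exact h2
  rw [h1, A.comp_right_fderiv]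
  rfl

theorem finslerAt_inChart {x₀ : M} {x : Coord n} (hx : x ∈ chartRan n x₀) :
    FinslerAt (F.inChart x₀) x where
  smooth y hy := contDiffAt_inChart F hx hy
  homogeneous y r hr := by
    rw [FinslerFunction.inChart, vecOf_smul, fib_smul F _ hr]
    rfl
  posDef y hy u hu := by
    have h1 := fundForm_comp_equiv (F.fib (pointOf x₀ x)) (vecEquiv (pointOf_mem hx)) y u u
    have h2 : F.inChart x₀ x = fun y' => F.fib (pointOf x₀ x) (vecEquiv (pointOf_mem hx) y') := rfl
    rw [h2, h1]
    exact F.posDef _ _ ((vecEquiv (pointOf_mem hx)).map_ne_zero_iff.mpr hy) _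
      ((vecEquiv (pointOf_mem hx)).map_ne_zero_iff.mpr hu)

theorem finslerNear_inChart {x₀ : M} {x : Coord n} (hx : x ∈ chartRan n x₀) :
    FinslerNear (F.inChart x₀) x := by
  filter_upwards [(isOpen_chartRan x₀).mem_nhds hx] with x' hx' using finslerAt_inChart F hx'

/-- The change of coordinates from the chart around `x₁` to the chart around `x₀`. -/
def chartChange (n : ℕ) {M : Type*} [TopologicalSpace M] [ChartedSpace (Coord n) M] (x₁ x₀ : M) :
    Coord n → Coord n :=
  extChartAt (𝓡 n) x₀ ∘ (extChartAt (𝓡 n) x₁).symm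

theorem chartChange_apply (x₁ x₀ : M) (x : Coord n) :
    chartChange n x₁ x₀ x = extChartAt (𝓡 n) x₀ (pointOf x₁ x) := rfl

theorem eventually_pointOf_mem {x₁ x₀ : M} {x : Coord n} (hx : x ∈ chartRan n x₁)
    (h0 : pointOf x₁ x ∈ chartDom n x₀) :
    ∀ᶠ x' in 𝓝 x, x' ∈ chartRan n x₁ ∧ pointOf x₁ x' ∈ chartDom n x₀ := by
  have h1 : ContinuousAt (pointOf (n := n) x₁) x := continuousAt_extChartAt_symm'' hx
  filter_upwards [(isOpen_chartRan x₁).mem_nhds hx,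
    h1.eventually ((isOpen_extChartAt_source x₀).mem_nhds h0)] with x' h2 h3 using ⟨h2, h3⟩

theorem smoothNear_chartChange {x₁ x₀ : M} {x : Coord n} (hx : x ∈ chartRan n x₁)
    (h0 : pointOf x₁ x ∈ chartDom n x₀) : SmoothNear (chartChange n x₁ x₀) x := by
  filter_upwards [eventually_pointOf_mem hx h0] with x' hx'
  have h1 : x' ∈ ((extChartAt (𝓡 n) x₁).symm ≫ extChartAt (𝓡 n) x₀).source := by
    rw [PartialEquiv.trans_source]
    exact ⟨hx'.1, hx'.2⟩
  have h2 := contDiffWithinAt_ext_coord_change (I := 𝓡 n) (n := ∞) x₀ x₁ h1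
  rw [ModelWithCorners.range_eq_univ, contDiffWithinAt_univ] at h2
  exact h2

theorem fderiv_chartChange {x₁ x₀ : M} {x : Coord n} (hx : x ∈ chartRan n x₁) :
    fderiv ℝ (chartChange n x₁ x₀) x = tangentCoordChange (𝓡 n) x₁ x₀ (pointOf x₁ x) := by
  rw [tangentCoordChange_def, extChartAt_pointOf hx]
  simp [chartChange]

theorem coordOf_chartChange {x₁ x₀ : M} {x : Coord n} (hx : x ∈ chartRan n x₁)
    (h0 : pointOf x₁ x ∈ chartDom n x₀) (v : Coord n) :
    fderiv ℝ (chartChange n x₁ x₀) x (coordOf x₁ (pointOf x₁ x) v)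
      = coordOf x₀ (pointOf x₁ x) v := by
  rw [fderiv_chartChange hx, coordOf, coordOf,
    tangentCoordChange_comp ⟨⟨mem_chartDom_self (n := n) _, pointOf_mem hx⟩, h0⟩]

theorem vecOf_chartChange {x₁ x₀ : M} {x : Coord n} (hx : x ∈ chartRan n x₁)
    (h0 : pointOf x₁ x ∈ chartDom n x₀) (y : Coord n) :
    vecOf x₀ (pointOf x₁ x) (fderiv ℝ (chartChange n x₁ x₀) x y) = vecOf x₁ (pointOf x₁ x) y := by
  have h1 := coordOf_chartChange hx h0 (vecOf x₁ (pointOf x₁ x) y)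
  rw [coordOf_vecOf (pointOf_mem hx)] at h1
  rw [h1, vecOf_coordOf h0]

theorem isFinslerChange_chartChange {x₁ x₀ : M} {x : Coord n} (hx : x ∈ chartRan n x₁)
    (h0 : pointOf x₁ x ∈ chartDom n x₀) :
    IsFinslerChange (chartChange n x₁ x₀) (F.inChart x₁) (F.inChart x₀) x where
  smooth := smoothNear_chartChange hx h0
  injective u hu := by
    have h1 := vecOf_chartChange hx h0 u
    rw [hu] at h1
    by_contra hne
    refine vecOf_ne_zero (pointOf_mem hx) hne ?_
    rw [← h1]
    exact map_zero (tangentCoordChange (𝓡 n) x₀ _ _)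
  source := finslerNear_inChart F hx
  target := finslerNear_inChart F ((extChartAt (𝓡 n) x₀).map_source h0)
  eq := by
    filter_upwards [eventually_pointOf_mem hx h0] with x' hx' y
    rw [FinslerFunction.inChart, FinslerFunction.inChart, chartChange_apply,
      pointOf_extChartAt hx'.2, vecOf_chartChange hx'.1 hx'.2]

end Manifold

/-! ### Parallel vector fields along curves -/

section Parallel

variable {n : ℕ} {M : Type*} [TopologicalSpace M] [ChartedSpace (Coord n) M]
  [IsManifold (𝓡 n) ∞ M] (F : FinslerFunction n M)

/-- The right-hand side `-Gⁱⱼ(x, y) wʲ` of the equation of parallel translation in the chart around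
`x₀`, at `q = ((x, w), y)`. -/
def transportField (x₀ : M) (q : (Coord n × Coord n) × Coord n) : Coord n :=
  -(conn (F.inChart x₀) q.1.1 q.2 q.1.2)

theorem smoothNear_transportField {x₀ : M} {x : Coord n} (hx : x ∈ chartRan n x₀) (w : Coord n)
    {y : Coord n} (hy : y ≠ 0) : SmoothNear (transportField F x₀) ((x, w), y) := by
  have h1 : SmoothNear (fun q : (Coord n × Coord n) × Coord n => connMap (F.inChart x₀) (q.1.1, q.2))
      ((x, w), y) :=
    SmoothNear.comp (g := connMap (F.inChart x₀))
      (f := fun q : (Coord n × Coord n) × Coord n => (q.1.1, q.2))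
      ((finslerNear_inChart F hx).smooth_conn hy) (smoothNear_of_contDiff (by fun_prop) _)
  filter_upwards [h1] with q hq
  exact (hq.clm_apply (contDiffAt_snd.comp q contDiffAt_fst)).neg

/-- `v` is a parallel vector field along the curve `c` on `[0, a]`. -/
def IsParallelVec (c : ℝ → M) (a : ℝ) (v : ℝ → Coord n) : Prop :=
  ∀ t ∈ Icc 0 a, ∀ x₀ : M, c t ∈ chartDom n x₀ →
    HasDerivWithinAt (fun s => coordOf x₀ (c s) (v s))
      (transportField F x₀ ((extChartAt (𝓡 n) x₀ (c t),
        derivWithin (fun s => extChartAt (𝓡 n) x₀ (c s)) (Icc 0 a) t), coordOf x₀ (c t) (v t)))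
      (Icc 0 a) t

theorem IsParallel.isParallelVec {c : ℝ → M} {a : ℝ} {Y : ℝ → TangentBundle (𝓡 n) M}
    (h : IsParallel F c a Y) : IsParallelVec F c a fun s => (Y s).2 := by
  intro t ht x₀ hx₀
  have hproj : ∀ s ∈ Icc 0 a, (Y s).proj = c s := fun s hs => (h s hs).1
  have h1 := (h t ht).2 x₀ (by simpa [chartDom, extChartAt_source] using hx₀)
  have h2 : ∀ s ∈ Icc 0 a, coordOf x₀ (c s) (Y s).2 = coordOf x₀ (Y s).proj (Y s).2 :=
    fun s hs => congrArg (fun z => coordOf x₀ z (Y s).2) (hproj s hs).symm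
  rw [← h2 t ht] at h1
  exact h1.congr_of_mem h2 ht

theorem IsParallelVec.isParallel {c : ℝ → M} {a : ℝ} {v : ℝ → Coord n}
    (h : IsParallelVec F c a v) : IsParallel F c a fun s => ⟨c s, v s⟩ := by
  intro t ht
  refine ⟨rfl, fun x₀ hx₀ => ?_⟩
  exact h t ht x₀ (by simpa [chartDom, extChartAt_source] using hx₀)

theorem hasDerivWithinAt_fderiv_apply {E E' : Type*} [NormedAddCommGroup E] [NormedSpace ℝ E]
    [NormedAddCommGroup E'] [NormedSpace ℝ E'] {ψ : E → E'} {x y : ℝ → E} {u z : E} {S : Set ℝ}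
    {t : ℝ} (hψ : SmoothNear ψ (x t)) (hx : HasDerivWithinAt x u S t)
    (hy : HasDerivWithinAt y z S t) :
    HasDerivWithinAt (fun s => fderiv ℝ ψ (x s) (y s))
      (fderiv ℝ (fderiv ℝ ψ) (x t) u (y t) + fderiv ℝ ψ (x t) z) S t := by
  have h1 : HasDerivWithinAt (fun s => fderiv ℝ ψ (x s)) (fderiv ℝ (fderiv ℝ ψ) (x t) u) S t :=
    (SmoothNear.differentiableAt hψ.fderiv).hasFDerivAt.comp_hasDerivWithinAt t hx
  exact h1.clm_apply hy

theorem hasDerivWithinAt_comp_smooth {E E' : Type*} [NormedAddCommGroup E] [NormedSpace ℝ E]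
    [NormedAddCommGroup E'] [NormedSpace ℝ E'] {ψ : E → E'} {x : ℝ → E} {u : E} {S : Set ℝ}
    {t : ℝ} (hψ : SmoothNear ψ (x t)) (hx : HasDerivWithinAt x u S t) :
    HasDerivWithinAt (fun s => ψ (x s)) (fderiv ℝ ψ (x t) u) S t :=
  hψ.differentiableAt.hasFDerivAt.comp_hasDerivWithinAt t hx

/-- Differentiating Dψ(x(s)) y(s) yields D²ψ(u, y), which is exactly cancelled by the inhomogeneous
term of the connection. The vector must be nonzero, because the connection is controlled only off
the zero section. -/
theorem transport_change {c : ℝ → M} {S : Set ℝ} {v : ℝ → Coord n} {t : ℝ} {x₁ x₀ : M}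
    {u : Coord n} (ht : t ∈ S)
    (hc : ContinuousWithinAt c S t) (h1 : c t ∈ chartDom n x₁) (h0 : c t ∈ chartDom n x₀)
    (hv : v t ≠ 0)
    (hu : HasDerivWithinAt (fun s => extChartAt (𝓡 n) x₁ (c s)) u S t)
    (hY : HasDerivWithinAt (fun s => coordOf x₁ (c s) (v s))
      (transportField F x₁ ((extChartAt (𝓡 n) x₁ (c t), u), coordOf x₁ (c t) (v t))) S t) :
    ∃ u' : Coord n, HasDerivWithinAt (fun s => extChartAt (𝓡 n) x₀ (c s)) u' S t ∧
      HasDerivWithinAt (fun s => coordOf x₀ (c s) (v s))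
        (transportField F x₀ ((extChartAt (𝓡 n) x₀ (c t), u'), coordOf x₀ (c t) (v t))) S t := by
  have hx : extChartAt (𝓡 n) x₁ (c t) ∈ chartRan n x₁ := (extChartAt (𝓡 n) x₁).map_source h1
  have hp : pointOf x₁ (extChartAt (𝓡 n) x₁ (c t)) = c t := pointOf_extChartAt h1
  have hch := isFinslerChange_chartChange F hx (x₀ := x₀) (by rw [hp]; exact h0)
  have hψ := hch.smooth
  set ψ := chartChange n x₁ x₀
  have hev : ∀ᶠ s in 𝓝[S] t, c s ∈ chartDom n x₁ ∧ c s ∈ chartDom n x₀ :=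
    (hc.eventually ((isOpen_extChartAt_source x₁).mem_nhds h1)).and
      (hc.eventually ((isOpen_extChartAt_source x₀).mem_nhds h0))
  have e1 : ∀ s, c s ∈ chartDom n x₁ ∧ c s ∈ chartDom n x₀ →
      extChartAt (𝓡 n) x₀ (c s) = ψ (extChartAt (𝓡 n) x₁ (c s)) := fun s hs => by
    change _ = extChartAt (𝓡 n) x₀ (pointOf x₁ (extChartAt (𝓡 n) x₁ (c s)))
    rw [pointOf_extChartAt hs.1]
  have e2 : ∀ s, c s ∈ chartDom n x₁ ∧ c s ∈ chartDom n x₀ →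
      coordOf x₀ (c s) (v s)
        = fderiv ℝ ψ (extChartAt (𝓡 n) x₁ (c s)) (coordOf x₁ (c s) (v s)) := fun s hs => by
    have hp' := pointOf_extChartAt hs.1
    have := coordOf_chartChange (x₁ := x₁) (x₀ := x₀)
      ((extChartAt (𝓡 n) x₁).map_source hs.1) (by rw [hp']; exact hs.2) (v s)
    rw [hp'] at this
    exact this.symm
  refine ⟨fderiv ℝ ψ (extChartAt (𝓡 n) x₁ (c t)) u, ?_, ?_⟩
  · refine HasDerivWithinAt.congr_of_eventuallyEq_of_mem ?_ (hev.mono e1) ht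
    exact hψ.differentiableAt.hasFDerivAt.comp_hasDerivWithinAt t hu
  · have d1 := hasDerivWithinAt_fderiv_apply (x := fun s => extChartAt (𝓡 n) x₁ (c s)) hψ hu hY
    refine HasDerivWithinAt.congr_of_eventuallyEq_of_mem (d1.congr_deriv ?_) (hev.mono e2) ht
    have hy := coordOf_ne_zero h1 hv
    have h3 := hch.conn_eq hy u
    simp only [transportField]
    rw [e1 t ⟨h1, h0⟩, e2 t ⟨h1, h0⟩, map_neg, h3, second_symm hψ u]
    abel

theorem curve_contDiffWithinAt {c : ℝ → M} {a : ℝ} (hc : ContMDiffOn 𝓘(ℝ, ℝ) (𝓡 n) ∞ c (Icc 0 a))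
    {t : ℝ} (ht : t ∈ Icc 0 a) {x₀ : M} (h0 : c t ∈ chartDom n x₀) :
    ContDiffWithinAt ℝ ∞ (fun s => extChartAt (𝓡 n) x₀ (c s)) (Icc 0 a) t := by
  have h1 : ContMDiffAt (𝓡 n) 𝓘(ℝ, Coord n) ∞ (extChartAt (𝓡 n) x₀) (c t) :=
    contMDiffAt_extChartAt' (by simpa [chartDom, extChartAt_source] using h0)
  exact (h1.comp_contMDiffWithinAt t (hc t ht)).contDiffWithinAt

theorem IsParallelVec.of_chart {c : ℝ → M} {a : ℝ} (ha : 0 < a) {v : ℝ → Coord n} (x₁ : M)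
    (hc : ContMDiffOn 𝓘(ℝ, ℝ) (𝓡 n) ∞ c (Icc 0 a)) (hdom : ∀ t ∈ Icc 0 a, c t ∈ chartDom n x₁)
    (hv : ∀ t ∈ Icc 0 a, v t ≠ 0)
    (h : ∀ t ∈ Icc 0 a, HasDerivWithinAt (fun s => coordOf x₁ (c s) (v s))
      (transportField F x₁ ((extChartAt (𝓡 n) x₁ (c t),
        derivWithin (fun s => extChartAt (𝓡 n) x₁ (c s)) (Icc 0 a) t), coordOf x₁ (c t) (v t)))
      (Icc 0 a) t) : IsParallelVec F c a v := by
  intro t ht x₀ h0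
  have hd := ((curve_contDiffWithinAt hc ht (hdom t ht)).differentiableWithinAt
    (by simp)).hasDerivWithinAt
  obtain ⟨u', hu', hY⟩ := transport_change F ht (hc t ht).continuousWithinAt (hdom t ht) h0
    (hv t ht) hd (h t ht)
  rwa [hu'.derivWithin (uniqueDiffOn_Icc ha t ht)]

theorem IsParallelVec.smul {c : ℝ → M} {a : ℝ} {v : ℝ → Coord n} (h : IsParallelVec F c a v)
    (hv : ∀ t ∈ Icc 0 a, v t ≠ 0) {r : ℝ} (hr : 0 < r) :
    IsParallelVec F c a fun s => r • v s := by
  intro t ht x₀ h0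
  have h1 := (h t ht x₀ h0).const_smul r
  have hx := (extChartAt (𝓡 n) x₀).map_source h0
  simp only [coordOf_smul]
  refine h1.congr_deriv ?_
  simp only [transportField]
  rw [(finslerNear_inChart F hx).conn_smul (coordOf_ne_zero h0 (hv t ht)) hr, smul_apply, smul_neg]

theorem continuousWithinAt_fib {c : ℝ → M} {v : ℝ → Coord n} {S : Set ℝ} {t : ℝ} {x₀ : M}
    (ht : t ∈ S) (hdom : c t ∈ chartDom n x₀) (hc : ContinuousWithinAt c S t)
    (hv : ContinuousWithinAt (fun s => coordOf x₀ (c s) (v s)) S t) :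
    ContinuousWithinAt (fun s => F.fib (c s) (v s)) S t := by
  have hloc : ∀ᶠ s in 𝓝[S] t, c s ∈ chartDom n x₀ :=
    hc.eventually ((isOpen_extChartAt_source x₀).mem_nhds hdom)
  have hx : ContinuousWithinAt (fun s => extChartAt (𝓡 n) x₀ (c s)) S t :=
    ContinuousAt.comp_continuousWithinAt (g := extChartAt (𝓡 n) x₀)
      (continuousAt_extChartAt' (by simpa [chartDom] using hdom)) hc
  have h1 : ContinuousWithinAt (fun s => F.inChart x₀ (extChartAt (𝓡 n) x₀ (c s))
      (coordOf x₀ (c s) (v s))) S t :=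
    ContinuousAt.comp_continuousWithinAt
      (g := fun q : Coord n × Coord n => F.inChart x₀ q.1 q.2)
      (f := fun s => (extChartAt (𝓡 n) x₀ (c s), coordOf x₀ (c s) (v s)))
      (continuousAt_inChart F ((extChartAt (𝓡 n) x₀).map_source hdom) _) (hx.prodMk hv)
  exact h1.congr_of_eventuallyEq_of_mem
    (hloc.mono fun s hs => (inChart_extChartAt F hs (v s)).symm) ht

theorem hasDerivWithinAt_fib_sq {c : ℝ → M} {v : ℝ → Coord n} {S : Set ℝ} {t : ℝ} {x₀ : M}
    (ht : t ∈ S) (hdom : c t ∈ chartDom n x₀) (hc : ContinuousWithinAt c S t) (hvt : v t ≠ 0)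
    {u : Coord n} (hu : HasDerivWithinAt (fun s => extChartAt (𝓡 n) x₀ (c s)) u S t)
    (hv : HasDerivWithinAt (fun s => coordOf x₀ (c s) (v s))
      (transportField F x₀ ((extChartAt (𝓡 n) x₀ (c t), u), coordOf x₀ (c t) (v t))) S t) :
    HasDerivWithinAt (fun s => F.fib (c s) (v s) ^ 2) 0 S t := by
  have hloc : ∀ᶠ s in 𝓝[S] t, c s ∈ chartDom n x₀ :=
    hc.eventually ((isOpen_extChartAt_source x₀).mem_nhds hdom)
  have hx := (extChartAt (𝓡 n) x₀).map_source hdom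
  have hy := coordOf_ne_zero hdom hvt
  have d2 : HasDerivWithinAt (fun s => energy (F.inChart x₀)
      (extChartAt (𝓡 n) x₀ (c s), coordOf x₀ (c s) (v s)))
      (fderiv ℝ (energy (F.inChart x₀)) (extChartAt (𝓡 n) x₀ (c t), coordOf x₀ (c t) (v t))
        (u, transportField F x₀ ((extChartAt (𝓡 n) x₀ (c t), u), coordOf x₀ (c t) (v t)))) S t :=
    hasDerivWithinAt_comp_smooth
      (x := fun s => (extChartAt (𝓡 n) x₀ (c s), coordOf x₀ (c s) (v s)))
      ((finslerNear_inChart F hx).smooth_energy hy) (hu.prodMk hv)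
  rw [transportField, (finslerNear_inChart F hx).horizontal_energy hy] at d2
  refine d2.congr_of_eventuallyEq_of_mem (hloc.mono fun s hs => ?_) ht
  simp only [energy]
  rw [inChart_extChartAt F hs (v s)]

/-- F² has zero derivative along a parallel field as long as the field does not vanish. A parallel
field could a priori reach the zero section, where the equation carries no information, so a
continuity argument from the left end of the interval is used. -/
theorem IsParallelVec.fib_eq_one {c : ℝ → M} {a : ℝ} {v : ℝ → Coord n}
    (hc : ContMDiffOn 𝓘(ℝ, ℝ) (𝓡 n) ∞ c (Icc 0 a)) (h : IsParallelVec F c a v)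
    (h0 : F.fib (c 0) (v 0) = 1) : ∀ t ∈ Icc 0 a, F.fib (c t) (v t) = 1 := by
  have hcont : ContinuousOn (fun s => F.fib (c s) (v s)) (Icc 0 a) := fun t ht =>
    continuousWithinAt_fib F ht (mem_chartDom_self (n := n) _) (hc t ht).continuousWithinAt
      (h t ht (c t) (mem_chartDom_self (n := n) _)).continuousWithinAt
  have hclosed : IsClosed ({t | F.fib (c t) (v t) = 1} ∩ Icc 0 a) := by
    rw [inter_comm]
    exact hcont.preimage_isClosed_of_isClosed isClosed_Icc (isClosed_singleton (x := (1 : ℝ)))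
  -- The set where F = 1 is closed. It is enough to extend it slightly to the right of each of its
  -- points, and there F stays positive by continuity.
  refine fun t ht => hclosed.Icc_subset_of_forall_mem_nhdsWithin h0 (fun t ht => ?_) ht
  have htI : t ∈ Icc 0 a := Ico_subset_Icc_self ht.2
  have hFt : F.fib (c t) (v t) = 1 := ht.1
  have hne : ∀ᶠ s in 𝓝[Icc 0 a] t, 0 < F.fib (c s) (v s) :=
    (hcont t htI).eventually (lt_mem_nhds (hFt.symm ▸ one_pos : (0 : ℝ) < F.fib (c t) (v t)))
  obtain ⟨ε, hε, hall⟩ := Metric.mem_nhdsWithin_iff.mp hne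
  set b := min (t + ε / 2) a with hb
  have htb : t < b := lt_min (by linarith) ht.2.2
  have hsub : Icc t b ⊆ Icc 0 a := Icc_subset_Icc htI.1 (min_le_right _ _)
  have hpos : ∀ s ∈ Icc t b, 0 < F.fib (c s) (v s) := fun s hs => by
    refine hall ⟨?_, hsub hs⟩
    rw [Metric.mem_ball, Real.dist_eq, abs_of_nonneg (by linarith [hs.1])]
    linarith [hs.2, min_le_left (t + ε / 2) a]
  have hconst : ∀ s ∈ Icc t b, F.fib (c s) (v s) ^ 2 = F.fib (c t) (v t) ^ 2 := by
    refine constant_of_has_deriv_right_zero ((hcont.mono hsub).pow 2) fun s hs => ?_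
    have hsI := Ico_subset_Icc_self hs
    have hs0 := hsub hsI
    have hvs : v s ≠ 0 := fun h1 => by
      have := hpos s hsI
      rw [h1, fib_zero] at this
      exact this.false
    have d1 := ((curve_contDiffWithinAt hc hs0
      (mem_chartDom_self (n := n) (c s))).differentiableWithinAt (by simp)).hasDerivWithinAt
    have d3 := hasDerivWithinAt_fib_sq F hs0 (mem_chartDom_self (n := n) (c s))
      (hc s hs0).continuousWithinAt hvs d1 (h s hs0 (c s) (mem_chartDom_self (n := n) _))
    exact (d3.mono hsub).mono_of_mem_nhdsWithin (Icc_mem_nhdsGE_of_mem hs)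
  filter_upwards [Icc_mem_nhdsGT htb] with s hs
  have h1 := hconst s hs
  have h3 := hpos s hs
  rw [hFt] at h1
  change F.fib (c s) (v s) = 1
  nlinarith

theorem IsParallelVec.ne_zero {c : ℝ → M} {a : ℝ} {v : ℝ → Coord n}
    (hc : ContMDiffOn 𝓘(ℝ, ℝ) (𝓡 n) ∞ c (Icc 0 a)) (h : IsParallelVec F c a v)
    (h0 : F.fib (c 0) (v 0) = 1) {t : ℝ} (ht : t ∈ Icc 0 a) : v t ≠ 0 := by
  intro h1
  have h2 := h.fib_eq_one F hc h0 t ht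
  rw [h1, fib_zero] at h2
  exact zero_ne_one h2

end Parallel

/-! ### Smooth dependence of parallel translation on the initial vector -/


section LocalTransport

open unitInterval

variable {E : Type} [NormedAddCommGroup E] [NormedSpace ℝ E]

/-- Reparametrizing [t₁, t₂] by [0, 1] multiplies the velocity by t₂ - t₁. On short intervals the
rescaled curve and velocity are thus uniformly close to the constant control (x(t₀), 0), at which
`exists_local_flow` applies to fields linear in the velocity. -/
theorem exists_control {J : Set ℝ} {t₀ : ℝ} {x x' : ℝ → E} {ρ : ℝ} (hρ : 0 < ρ) (hJ : Convex ℝ J)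
    (ht₀ : t₀ ∈ J) (hx : ContinuousOn x (J ∩ Metric.ball t₀ ρ))
    (hx' : ContinuousOn x' (J ∩ Metric.ball t₀ ρ)) {U : Set C(I, E × E)}
    (hU : U ∈ 𝓝 (.const I (x t₀, 0))) :
    ∃ δ > 0, δ ≤ ρ ∧ ∀ t₁ ∈ J ∩ Metric.ball t₀ δ, ∀ t₂ ∈ J ∩ Metric.ball t₀ δ, ∃ u ∈ U,
      ∀ s : I, t₁ + s * (t₂ - t₁) ∈ J ∩ Metric.ball t₀ δ ∧
        u s = (x (t₁ + s * (t₂ - t₁)), (t₂ - t₁) • x' (t₁ + s * (t₂ - t₁))) := by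
  obtain ⟨ε, hε, hεU⟩ := Metric.mem_nhds_iff.mp hU
  have hmem : t₀ ∈ J ∩ Metric.ball t₀ ρ := ⟨ht₀, Metric.mem_ball_self hρ⟩
  have e1 : ∀ᶠ t in 𝓝[J ∩ Metric.ball t₀ ρ] t₀, dist (x t) (x t₀) < ε / 2 :=
    (hx t₀ hmem).eventually (Metric.ball_mem_nhds _ (half_pos hε))
  set C := ‖x' t₀‖ + 1 with hC
  have hCpos : 0 < C := by positivity
  have e2 : ∀ᶠ t in 𝓝[J ∩ Metric.ball t₀ ρ] t₀, ‖x' t‖ < C :=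
    (hx' t₀ hmem).norm.eventually (gt_mem_nhds (lt_add_one _))
  obtain ⟨δ₁, hδ₁, h12⟩ := Metric.mem_nhdsWithin_iff.mp (e1.and e2)
  -- Two points of the ball are at distance at most 2 · ε / (4C). With velocities bounded by `C`,
  -- the second component of the control is then at most ε / 2.
  refine ⟨min ρ (min δ₁ (ε / (4 * C))), by positivity, min_le_left _ _, ?_⟩
  set δ := min ρ (min δ₁ (ε / (4 * C)))
  have hconv : Convex ℝ (J ∩ Metric.ball t₀ δ) := hJ.inter (convex_ball _ _)
  have hsub : J ∩ Metric.ball t₀ δ ⊆ J ∩ Metric.ball t₀ ρ :=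
    inter_subset_inter_right _ (Metric.ball_subset_ball (min_le_left _ _))
  intro t₁ h1 t₂ h2
  have hmem : ∀ s : I, t₁ + s * (t₂ - t₁) ∈ J ∩ Metric.ball t₀ δ := fun s => by
    have := hconv.add_smul_sub_mem h1 h2 s.2
    simpa using this
  have hcont : Continuous fun s : I => t₁ + s * (t₂ - t₁) := by fun_prop
  let u : C(I, E × E) :=
    ⟨fun s => (x (t₁ + s * (t₂ - t₁)), (t₂ - t₁) • x' (t₁ + s * (t₂ - t₁))),
      (hx.comp_continuous hcont fun s => hsub (hmem s)).prodMk
        ((hx'.comp_continuous hcont fun s => hsub (hmem s)).const_smul _)⟩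
  refine ⟨u, hεU ?_, fun s => ⟨hmem s, rfl⟩⟩
  rw [Metric.mem_ball]
  refine lt_of_le_of_lt ((ContinuousMap.dist_le (half_pos hε).le).mpr fun s => ?_) (half_lt_self hε)
  have hs := h12 ⟨Metric.ball_subset_ball ((min_le_right _ _).trans (min_le_left _ _)) (hmem s).2,
    hsub (hmem s)⟩
  refine max_le hs.1.le ?_
  change dist ((t₂ - t₁) • x' (t₁ + s * (t₂ - t₁))) 0 ≤ ε / 2
  rw [dist_zero_right, norm_smul, Real.norm_eq_abs]
  have d1 : |t₂ - t₁| ≤ 2 * (ε / (4 * C)) := by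
    have a1 := Metric.mem_ball.mp (Metric.ball_subset_ball
      ((min_le_right _ _).trans (min_le_right _ _)) h1.2 : t₁ ∈ Metric.ball t₀ (ε / (4 * C)))
    have a2 := Metric.mem_ball.mp (Metric.ball_subset_ball
      ((min_le_right _ _).trans (min_le_right _ _)) h2.2 : t₂ ∈ Metric.ball t₀ (ε / (4 * C)))
    rw [Real.dist_eq] at a1 a2
    rw [abs_lt] at a1 a2
    rw [abs_le]
    constructor <;> linarith
  calc |t₂ - t₁| * ‖x' (t₁ + s * (t₂ - t₁))‖ ≤ 2 * (ε / (4 * C)) * C :=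
        mul_le_mul d1 hs.2.le (norm_nonneg _) (by positivity)
    _ = ε / 2 := by field_simp; norm_num

/-- Solutions of `γ' = f((x, x'), γ)`, with `f` linear in `x'`, on short intervals around `t₀` depend
smoothly on their initial value. -/
theorem exists_local_transport [CompleteSpace E] {J : Set ℝ} {t₀ : ℝ} {x x' : ℝ → E} {ρ : ℝ}
    (hρ : 0 < ρ) (hJ : Convex ℝ J) (ht₀ : t₀ ∈ J) (hx : ContinuousOn x (J ∩ Metric.ball t₀ ρ))
    (hx' : ContinuousOn x' (J ∩ Metric.ball t₀ ρ)) {f : (E × E) × E → E} {y₀ : E}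
    (hf : SmoothNear f ((x t₀, 0), y₀))
    (hlin : ∀ x w y (r : ℝ), f ((x, r • w), y) = r • f ((x, w), y)) :
    ∃ δ > 0, δ ≤ ρ ∧ ∃ W ∈ 𝓝 y₀, ∀ t₁ ∈ J ∩ Metric.ball t₀ δ, ∀ t₂ ∈ J ∩ Metric.ball t₀ δ,
      ∃ g : E → E, (∀ y ∈ W, ContDiffAt ℝ ∞ g y) ∧
        ∀ γ : ℝ → E, (∀ s ∈ J ∩ Metric.ball t₀ δ, HasDerivWithinAt γ (f ((x s, x' s), γ s)) J s) →
          (∀ s ∈ J ∩ Metric.ball t₀ δ, ∀ r : ℝ, SmoothNear f ((x s, r • x' s), γ s)) →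
          γ t₁ ∈ W → γ t₂ = g (γ t₁) := by
  have hf0 : ∀ x y, f ((x, 0), y) = 0 := fun x y => by
    have := hlin x 0 y 0
    rwa [smul_zero, zero_smul] at this
  obtain ⟨S, hS, -, hsol⟩ := exists_local_flow hf (Eventually.of_forall fun y => hf0 _ y)
  obtain ⟨U, hU, W, hW, hUW⟩ := mem_nhds_prod_iff.mp (hS.and hsol)
  obtain ⟨δ, hδ, hδρ, hctl⟩ := exists_control hρ hJ ht₀ hx hx' hU
  refine ⟨δ, hδ, hδρ, W, hW, fun t₁ h1 t₂ h2 => ?_⟩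
  obtain ⟨u, huU, hu⟩ := hctl t₁ h1 t₂ h2
  refine ⟨fun y => S (u, y) 1, fun y hy => ?_, fun γ hγ hγf hγW => ?_⟩
  · have a1 : ContDiffAt ℝ ∞ S (u, y) := (hUW (mk_mem_prod huU hy)).1
    have a2 : ContDiffAt ℝ ∞ (fun y' => S (u, y')) y :=
      a1.comp y (contDiffAt_const.prodMk contDiffAt_id)
    exact (ContinuousMap.evalCLM (α := I) ℝ 1).contDiff.contDiffAt.comp y a2
  · obtain ⟨hs, hs0⟩ := (hUW (mk_mem_prod huU hγW)).2
    -- Here `h` may be negative or zero. Linearity of the field in the velocity for all real factors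
    -- treats both directions of time at once.
    set h := t₂ - t₁
    have key := ode_unique (f := f) (u := IccExtend zero_le_one u)
      (γ := fun s => γ (t₁ + s * h)) (η := IccExtend zero_le_one (S (u, γ t₁))) (a := 0) (b := 1)
      u.continuous.Icc_extend'.continuousOn ?_ ?_ ?_ ?_ ?_
    · have := key (right_mem_Icc.mpr zero_le_one)
      rw [IccExtend_of_mem _ _ (right_mem_Icc.mpr zero_le_one)] at this
      simpa [h] using this
    · intro s hs'
      obtain ⟨m1, m2⟩ := hu ⟨s, hs'⟩
      have b1 : HasDerivWithinAt (fun s : ℝ => t₁ + s * h) h (Icc 0 1) s := by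
        simpa using ((hasDerivAt_id s).mul_const h).const_add t₁ |>.hasDerivWithinAt
      have b2 := (hγ _ m1).scomp s b1 (fun s' hs'' => (hu ⟨s', hs''⟩).1.1)
      rw [IccExtend_of_mem _ _ hs', m2, hlin]
      exact b2
    · intro s hs'
      have := hs.hasDerivWithinAt hs'
      rwa [IccExtend_of_mem _ _ hs', IccExtend_of_mem _ _ hs']
    · intro s hs'
      obtain ⟨m1, m2⟩ := hu ⟨s, hs'⟩
      rw [IccExtend_of_mem _ _ hs', m2]
      exact hγf _ m1 _
    · intro s hs'
      rw [IccExtend_of_mem _ _ hs', IccExtend_of_mem _ _ hs']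
      exact hs.smooth _
    · simp only [zero_mul, add_zero]
      rw [IccExtend_of_mem _ _ (left_mem_Icc.mpr zero_le_one)]
      exact hs0.symm

end LocalTransport

/-! ### Smoothness, inversion and composition of parallel translations. -/

section Translation

variable {n : ℕ} {M : Type*} [TopologicalSpace M] [ChartedSpace (Coord n) M]
  [IsManifold (𝓡 n) ∞ M] (F : FinslerFunction n M)

theorem transportField_smul (x₀ : M) (x w y : Coord n) (r : ℝ) :
    transportField F x₀ ((x, r • w), y) = r • transportField F x₀ ((x, w), y) := by
  simp [transportField]

theorem curve_continuousWithinAt_deriv {c : ℝ → M} {a : ℝ} (ha : 0 < a)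
    (hc : ContMDiffOn 𝓘(ℝ, ℝ) (𝓡 n) ∞ c (Icc 0 a)) {t : ℝ} (ht : t ∈ Icc 0 a) {x₀ : M}
    (h0 : c t ∈ chartDom n x₀) :
    ContinuousWithinAt (derivWithin (fun s => extChartAt (𝓡 n) x₀ (c s)) (Icc 0 a))
      (Icc 0 a) t := by
  have h1 := (curve_contDiffWithinAt hc ht h0).fderivWithin_right (m := 0)
    (uniqueDiffOn_Icc ha) (by simp) ht
  exact h1.continuousWithinAt.clm_apply continuousWithinAt_const

/-- A family of parallel vector fields that depends smoothly on the parameter at one time does so at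
all times. -/
theorem contDiffAt_parallel {X : Type*} [NormedAddCommGroup X] [NormedSpace ℝ X] {c : ℝ → M} {a : ℝ}
    (ha : 0 < a) (hc : ContMDiffOn 𝓘(ℝ, ℝ) (𝓡 n) ∞ c (Icc 0 a)) {V : X → ℝ → Coord n} {v₀ : X}
    (hV : ∀ᶠ v in 𝓝 v₀, IsParallelVec F c a (V v) ∧ ∀ t ∈ Icc 0 a, V v t ≠ 0)
    (h0 : ContDiffAt ℝ ∞ (fun v => V v 0) v₀) {t : ℝ} (ht : t ∈ Icc 0 a) :
    ContDiffAt ℝ ∞ (fun v => V v t) v₀ := by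
  have key : ∀ t₀ ∈ Icc 0 a, ∃ δ > 0, ∀ t₁ ∈ Icc 0 a ∩ Metric.ball t₀ δ,
      ∀ t₂ ∈ Icc 0 a ∩ Metric.ball t₀ δ,
      ContDiffAt ℝ ∞ (fun v => V v t₁) v₀ → ContDiffAt ℝ ∞ (fun v => V v t₂) v₀ := by
    intro t₀ ht₀
    set x₀ := c t₀ with hx₀
    have hdom0 : c t₀ ∈ chartDom n x₀ := mem_chartDom_self (n := n) _
    obtain ⟨ρ, hρ, hdom⟩ := Metric.mem_nhdsWithin_iff.mp
      ((hc t₀ ht₀).continuousWithinAt.eventually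
        ((isOpen_extChartAt_source x₀).mem_nhds hdom0))
    have hdom' : ∀ s ∈ Icc 0 a ∩ Metric.ball t₀ ρ, c s ∈ chartDom n x₀ :=
      fun s hs => hdom ⟨hs.2, hs.1⟩
    obtain ⟨hV0, hV0'⟩ := hV.self_of_nhds
    have hran : ∀ s ∈ Icc 0 a ∩ Metric.ball t₀ ρ, extChartAt (𝓡 n) x₀ (c s) ∈ chartRan n x₀ :=
      fun s hs => (extChartAt (𝓡 n) x₀).map_source (hdom' s hs)
    have hm0 : t₀ ∈ Icc 0 a ∩ Metric.ball t₀ ρ := ⟨ht₀, Metric.mem_ball_self hρ⟩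
    obtain ⟨δ, hδ, hδρ, W, hW, htr⟩ := exists_local_transport hρ (convex_Icc 0 a) ht₀
      (x := fun s => extChartAt (𝓡 n) x₀ (c s))
      (x' := derivWithin (fun s => extChartAt (𝓡 n) x₀ (c s)) (Icc 0 a))
      (f := transportField F x₀) (y₀ := coordOf x₀ (c t₀) (V v₀ t₀))
      (fun s hs => (curve_contDiffWithinAt hc hs.1 (hdom' s hs)).continuousWithinAt.mono
        inter_subset_left)
      (fun s hs => (curve_continuousWithinAt_deriv ha hc hs.1 (hdom' s hs)).mono
        inter_subset_left)
      (smoothNear_transportField F (hran t₀ hm0) _ (coordOf_ne_zero hdom0 (hV0' t₀ ht₀)))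
      (transportField_smul F x₀)
    -- The radius is shrunk once more so that the reference solution at time `t₁` has `W` as a
    -- neighbourhood. Nearby members of the family then start in `W` too, and the local flow map
    -- applies to them.
    have hcv : ContinuousWithinAt (fun s => coordOf x₀ (c s) (V v₀ s)) (Icc 0 a) t₀ :=
      (hV0 t₀ ht₀ x₀ hdom0).continuousWithinAt
    obtain ⟨ε, hε, hWε⟩ := Metric.mem_nhdsWithin_iff.mp
      (hcv.eventually (eventually_mem_nhds_iff.mpr hW))
    refine ⟨min δ ε, lt_min hδ hε, fun t₁ h1 t₂ h2 hA => ?_⟩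
    have hsub : Icc 0 a ∩ Metric.ball t₀ (min δ ε) ⊆ Icc 0 a ∩ Metric.ball t₀ δ :=
      inter_subset_inter_right _ (Metric.ball_subset_ball (min_le_left _ _))
    have hsub' : Icc 0 a ∩ Metric.ball t₀ δ ⊆ Icc 0 a ∩ Metric.ball t₀ ρ :=
      inter_subset_inter_right _ (Metric.ball_subset_ball hδρ)
    obtain ⟨σ, hσ, hσγ⟩ := htr t₁ (hsub h1) t₂ (hsub h2)
    have hd1 := hdom' t₁ (hsub' (hsub h1))
    have hd2 := hdom' t₂ (hsub' (hsub h2))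
    have hW1 : W ∈ 𝓝 (coordOf x₀ (c t₁) (V v₀ t₁)) :=
      hWε ⟨Metric.ball_subset_ball (min_le_right _ _) h1.2, h1.1⟩
    have hA1 : ContDiffAt ℝ ∞ (fun v => coordOf x₀ (c t₁) (V v t₁)) v₀ :=
      (vecEquiv hd1).symm.contDiff.contDiffAt.comp v₀ hA
    have hA2 : ContDiffAt ℝ ∞ (fun v => σ (coordOf x₀ (c t₁) (V v t₁))) v₀ :=
      ContDiffAt.comp v₀ (hσ _ (mem_of_mem_nhds hW1)) hA1
    have hA3 : ContDiffAt ℝ ∞ (fun v => vecEquiv hd2 (σ (coordOf x₀ (c t₁) (V v t₁)))) v₀ :=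
      (vecEquiv hd2).contDiff.contDiffAt.comp v₀ hA2
    refine hA3.congr_of_eventuallyEq ?_
    filter_upwards [hV, hA1.continuousAt.eventually hW1] with v hv hvW
    have := hσγ (fun s => coordOf x₀ (c s) (V v s)) (fun s hs => hv.1 s hs.1 x₀ (hdom' s (hsub' hs)))
      (fun s hs r => smoothNear_transportField F (hran s (hsub' hs)) _
        (coordOf_ne_zero (hdom' s (hsub' hs)) (hv.2 s hs.1))) hvW
    rw [← this, vecEquiv_apply, vecOf_coordOf hd2]
  -- Smoothness passes between any two sufficiently close times in either direction, and so spreads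
  -- over the connected interval.
  refine isPreconnected_Icc.induction₂' (s := Icc 0 a)
    (fun t₁ t₂ => ContDiffAt ℝ ∞ (fun v => V v t₁) v₀ → ContDiffAt ℝ ∞ (fun v => V v t₂) v₀)
    (fun t₀ ht₀ => ?_) (fun _ _ _ _ _ _ h1 h2 h => h2 (h1 h)) (left_mem_Icc.mpr ha.le) ht h0
  obtain ⟨δ, hδ, h⟩ := key t₀ ht₀
  filter_upwards [self_mem_nhdsWithin, mem_nhdsWithin_of_mem_nhds (Metric.ball_mem_nhds t₀ hδ)]
    with s hs hs'
  exact ⟨h t₀ ⟨ht₀, Metric.mem_ball_self hδ⟩ s ⟨hs, hs'⟩, h s ⟨hs, hs'⟩ t₀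
    ⟨ht₀, Metric.mem_ball_self hδ⟩⟩

theorem IsTranslation.exists_parallelVec {c : ℝ → M} {a : ℝ} {q p : M}
    {τ : Indicatrix F q ≃ Indicatrix F p} (h : IsTranslation F c a τ) (y : Indicatrix F q) :
    ∃ v : ℝ → Coord n, IsParallelVec F c a v ∧ v 0 = y.1 ∧ v a = (τ y).1 := by
  obtain ⟨-, -, -, -, h⟩ := h
  obtain ⟨Y, hY, h0, ha⟩ := h y
  exact ⟨_, hY.isParallelVec F, congrArg (fun Z : TangentBundle (𝓡 n) M => (Z.2 : Coord n)) h0,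
    congrArg (fun Z : TangentBundle (𝓡 n) M => (Z.2 : Coord n)) ha⟩

theorem isTranslation_of_parallelVec {c : ℝ → M} {a : ℝ} (ha : 0 < a)
    (hc : ContMDiffOn 𝓘(ℝ, ℝ) (𝓡 n) ∞ c (Icc 0 a)) {q p : M} (h0 : c 0 = q) (h1 : c a = p)
    {τ : Indicatrix F q ≃ Indicatrix F p}
    (h : ∀ y : Indicatrix F q, ∃ v, IsParallelVec F c a v ∧ v 0 = y.1 ∧ v a = (τ y).1) :
    IsTranslation F c a τ := by
  refine ⟨ha, hc, h0, h1, fun y => ?_⟩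
  obtain ⟨v, hv, e0, e1⟩ := h y
  refine ⟨_, hv.isParallel F, ?_, ?_⟩
  · subst h0
    exact congrArg (fun w : Coord n => (⟨c 0, w⟩ : TangentBundle (𝓡 n) M)) e0
  · subst h1
    exact congrArg (fun w : Coord n => (⟨c a, w⟩ : TangentBundle (𝓡 n) M)) e1

theorem fib_homExt {q p : M} (g : Indicatrix F q → Indicatrix F p) (y : Coord n) :
    F.fib p (homExt F (fun u => (g u).1) y) = F.fib q y := by
  by_cases hy : y = 0
  · simp [homExt, hy, fib_zero]
  · simp only [homExt, hy, dite_false]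
    rw [fib_smul F _ (fib_pos F _ hy), (g _).2, mul_one]

theorem contDiffAt_fib (p : M) {y : Coord n} (hy : y ≠ 0) : ContDiffAt ℝ ∞ (F.fib p) y := by
  have h1 := contDiffAt_inChart F (x₀ := p) ((extChartAt (𝓡 n) p).map_source
    (mem_chartDom_self (n := n) p)) hy
  have h2 : ContDiffAt ℝ ∞ (fun y' => F.inChart p (extChartAt (𝓡 n) p p) y') y :=
    h1.comp y (contDiffAt_const.prodMk contDiffAt_id)
  refine h2.congr_of_eventuallyEq (Eventually.of_forall fun y' => ?_)
  have := inChart_extChartAt F (mem_chartDom_self (n := n) p) y'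
  rw [coordOf_self] at this
  exact this.symm

/-- Positive multiples of nonvanishing parallel fields are parallel, so the homogeneous extensions
at intermediate times form a family of parallel fields indexed by y ≠ 0. At time 0 this family is
the identity, and smoothness propagates to the end of the curve. -/
theorem IsTranslation.isSmooth {c : ℝ → M} {a : ℝ} {q p : M}
    {τ : Indicatrix F q ≃ Indicatrix F p} (h : IsTranslation F c a τ) :
    IsSmooth F fun u => (τ u).1 := by
  have ha := h.1
  have hc := h.2.1
  have h0 := h.2.2.1
  choose v hv hv0 hva using h.exists_parallelVec F
  have hvn : ∀ y, ∀ t ∈ Icc 0 a, v y t ≠ 0 := fun y t ht =>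
    (hv y).ne_zero F hc (by rw [hv0, h0]; exact y.2) ht
  intro y₀ hy₀
  have hev : ∀ᶠ y in 𝓝 y₀, y ≠ 0 := isOpen_ne.mem_nhds hy₀
  have hext : ∀ t, ∀ y (hy : y ≠ 0), homExt F (fun u => v u t) y
      = F.fib q y • v (normalize F q y hy) t := fun t y hy => by simp [homExt, hy]
  have hfin := contDiffAt_parallel F ha hc (V := fun y t => homExt F (fun u => v u t) y) (v₀ := y₀)
    (hev.mono fun y hy => ⟨?_, fun t ht => ?_⟩) ?_ (right_mem_Icc.mpr ha.le)
  · simp only [hva] at hfin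
    exact hfin.contDiffWithinAt
  · have := (hv (normalize F q y hy)).smul F (hvn _) (fib_pos F q hy)
    simp only [hext _ y hy]
    exact this
  · simp only [hext _ y hy]
    exact smul_ne_zero (fib_pos F q hy).ne' (hvn _ t ht)
  · simp only [hv0, homExt_id]
    exact contDiffAt_id

theorem IsParallelVec.reverse {c : ℝ → M} {a : ℝ} (ha : 0 < a)
    (hc : ContMDiffOn 𝓘(ℝ, ℝ) (𝓡 n) ∞ c (Icc 0 a)) {v : ℝ → Coord n} (h : IsParallelVec F c a v) :
    IsParallelVec F (fun t => c (a - t)) a fun t => v (a - t) := by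
  intro t ht x₀ h0
  have ht' : a - t ∈ Icc 0 a := ⟨by linarith [ht.2], by linarith [ht.1]⟩
  have hmaps : MapsTo (fun s : ℝ => a - s) (Icc 0 a) (Icc 0 a) := fun s hs =>
    ⟨by linarith [hs.2], by linarith [hs.1]⟩
  have b1 : HasDerivWithinAt (fun s : ℝ => a - s) (-1) (Icc 0 a) t :=
    ((hasDerivAt_id t).const_sub a).hasDerivWithinAt
  have hd := ((curve_contDiffWithinAt hc ht' h0).differentiableWithinAt
    (by simp)).hasDerivWithinAt
  have d1 : HasDerivWithinAt (fun s => extChartAt (𝓡 n) x₀ (c (a - s)))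
      ((-1 : ℝ) • derivWithin (fun s => extChartAt (𝓡 n) x₀ (c s)) (Icc 0 a) (a - t))
      (Icc 0 a) t :=
    HasDerivWithinAt.scomp (g₁ := fun s => extChartAt (𝓡 n) x₀ (c s)) t hd b1 hmaps
  have d2 := HasDerivWithinAt.scomp (g₁ := fun s => coordOf x₀ (c s) (v s)) t
    (h _ ht' x₀ h0) b1 hmaps
  rw [d1.derivWithin (uniqueDiffOn_Icc ha t ht), transportField_smul]
  exact d2

theorem IsTranslation.symm {c : ℝ → M} {a : ℝ} {q p : M}
    {τ : Indicatrix F q ≃ Indicatrix F p} (h : IsTranslation F c a τ) :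
    IsTranslation F (fun t => c (a - t)) a τ.symm := by
  refine isTranslation_of_parallelVec F h.1 ?_ (by simpa using h.2.2.2.1)
    (by simpa using h.2.2.1) fun y => ?_
  · refine h.2.1.comp (t := Icc 0 a) ?_ fun s hs => ⟨by linarith [hs.2], by linarith [hs.1]⟩
    exact ContDiff.contMDiff (f := fun s : ℝ => a - s) (by fun_prop) |>.contMDiffOn
  · obtain ⟨v, hv, h0, ha⟩ := h.exists_parallelVec F (τ.symm y)
    refine ⟨_, hv.reverse F h.1 h.2.1, ?_, ?_⟩
    · simpa using ha
    · simpa using h0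

theorem IsPiecewiseTranslation.single {c : ℝ → M} {a : ℝ} {q p : M}
    {τ : Indicatrix F q ≃ Indicatrix F p} (h : IsTranslation F c a τ) :
    IsPiecewiseTranslation F q p τ := by
  have := IsPiecewiseTranslation.step (IsPiecewiseTranslation.refl (F := F) q) h
  rwa [Equiv.refl_trans] at this

theorem IsPiecewiseTranslation.trans {q r p : M} {σ : Indicatrix F q ≃ Indicatrix F r}
    {τ : Indicatrix F r ≃ Indicatrix F p} (hσ : IsPiecewiseTranslation F q r σ)
    (hτ : IsPiecewiseTranslation F r p τ) : IsPiecewiseTranslation F q p (σ.trans τ) := by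
  induction hτ with
  | refl => rwa [Equiv.trans_refl]
  | step _ h ih => rw [← Equiv.trans_assoc]; exact .step (ih) h

theorem IsPiecewiseTranslation.symm {q p : M} {τ : Indicatrix F q ≃ Indicatrix F p}
    (hτ : IsPiecewiseTranslation F q p τ) : IsPiecewiseTranslation F p q τ.symm := by
  induction hτ with
  | refl => exact .refl _
  | step _ h ih => exact IsPiecewiseTranslation.trans F (.single F (h.symm F)) ih

theorem IsPiecewiseTranslation.isSmooth {q p : M} {τ : Indicatrix F q ≃ Indicatrix F p}
    (hτ : IsPiecewiseTranslation F q p τ) : IsSmooth F fun u => (τ u).1 := by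
  induction hτ with
  | refl => exact isSmooth_id F _
  | @step r p σ τ _ _ _ h ih => exact IsSmooth.comp F (f := τ) (g := σ) (h.isSmooth F) ih

/-- The holonomy group, as a group of permutations of the indicatrix. -/
def holPerm (p : M) : Subgroup (Equiv.Perm (Indicatrix F p)) :=
  (Hol F p).map (IndicatrixDiffeo F p).subtype

theorem IsPiecewiseTranslation.mem_holPerm {p : M} {τ : Equiv.Perm (Indicatrix F p)}
    (h : IsPiecewiseTranslation F p p τ) : τ ∈ holPerm F p :=
  ⟨⟨τ, h.isSmooth F, (h.symm F).isSmooth F⟩, Subgroup.subset_closure h, rfl⟩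

end Translation

/-! ### Parallel translation along coordinate segments -/

section Segment

open unitInterval

variable {n : ℕ} {M : Type*} [TopologicalSpace M] [ChartedSpace (Coord n) M]
  [IsManifold (𝓡 n) ∞ M] (F : FinslerFunction n M)

/-- `γ` gives the coordinates of a nonzero parallel vector field along the coordinate segment from
`x` to `x + w`. -/
structure SegmentParallel (x₀ : M) (x w : Coord n) (γ : ℝ → Coord n) : Prop where
  mem : ∀ s ∈ Icc (0 : ℝ) 1, x + s • w ∈ chartRan n x₀
  ne_zero : ∀ s ∈ Icc (0 : ℝ) 1, γ s ≠ 0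
  deriv : ∀ s ∈ Icc (0 : ℝ) 1,
    HasDerivWithinAt γ (transportField F x₀ ((x + s • w, w), γ s)) (Icc 0 1) s

variable {F} in
theorem SegmentParallel.unique {x₀ : M} {x w : Coord n} {γ η : ℝ → Coord n}
    (hγ : SegmentParallel F x₀ x w γ) (hη : SegmentParallel F x₀ x w η) (h : γ 0 = η 0) :
    EqOn γ η (Icc 0 1) :=
  ode_unique (f := transportField F x₀) (u := fun s => (x + s • w, w)) (by fun_prop)
    hγ.deriv hη.deriv
    (fun s hs => smoothNear_transportField F (hγ.mem s hs) w (hγ.ne_zero s hs))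
    (fun s hs => smoothNear_transportField F (hη.mem s hs) w (hη.ne_zero s hs)) h

variable {F} in
theorem SegmentParallel.smul {x₀ : M} {x w : Coord n} {γ : ℝ → Coord n}
    (h : SegmentParallel F x₀ x w γ) {r : ℝ} (hr : 0 < r) :
    SegmentParallel F x₀ x w fun s => r • γ s where
  mem := h.mem
  ne_zero s hs := smul_ne_zero hr.ne' (h.ne_zero s hs)
  deriv s hs := by
    refine ((h.deriv s hs).const_smul r).congr_deriv ?_
    simp only [transportField]
    rw [(finslerNear_inChart F (h.mem s hs)).conn_smul (h.ne_zero s hs) hr, smul_apply, smul_neg]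

variable {F} in
theorem SegmentParallel.reverse {x₀ : M} {x w : Coord n} {γ : ℝ → Coord n}
    (h : SegmentParallel F x₀ x w γ) :
    SegmentParallel F x₀ (x + w) (-w) fun s => γ (1 - s) := by
  have hmaps : MapsTo (fun s : ℝ => 1 - s) (Icc 0 1) (Icc 0 1) := fun s hs =>
    ⟨by linarith [hs.2], by linarith [hs.1]⟩
  have e : ∀ s : ℝ, x + w + s • -w = x + (1 - s) • w := fun s => by
    rw [sub_smul, one_smul, smul_neg]; abel
  refine ⟨fun s hs => ?_, fun s hs => h.ne_zero _ (hmaps hs), fun s hs => ?_⟩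
  · rw [e]; exact h.mem _ (hmaps hs)
  · have b1 : HasDerivWithinAt (fun s : ℝ => 1 - s) (-1) (Icc 0 1) s :=
      ((hasDerivAt_id s).const_sub 1).hasDerivWithinAt
    have b2 := HasDerivWithinAt.scomp (g₁ := γ) s (h.deriv _ (hmaps hs)) b1 hmaps
    rw [e, ← neg_one_smul ℝ w, transportField_smul]
    exact b2

open Classical in
/-- Parallel translation along the coordinate segment from `x` to `x + w`. -/
def segmentTransport (x₀ : M) (q : (Coord n × Coord n) × Coord n) : Coord n :=
  if h : ∃ γ, SegmentParallel F x₀ q.1.1 q.1.2 γ ∧ γ 0 = q.2 then h.choose 1 else q.2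

variable {F} in
theorem SegmentParallel.segmentTransport_eq {x₀ : M} {x w : Coord n} {γ : ℝ → Coord n}
    (h : SegmentParallel F x₀ x w γ) : segmentTransport F x₀ ((x, w), γ 0) = γ 1 := by
  have he : ∃ η, SegmentParallel F x₀ x w η ∧ η 0 = γ 0 := ⟨γ, h, rfl⟩
  rw [segmentTransport, dif_pos he]
  exact he.choose_spec.1.unique h he.choose_spec.2 (right_mem_Icc.mpr zero_le_one)

theorem segmentTransport_smul (x₀ : M) (z : Coord n × Coord n) (y : Coord n) {r : ℝ} (hr : 0 < r) :
    segmentTransport F x₀ (z, r • y) = r • segmentTransport F x₀ (z, y) := by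
  by_cases h : ∃ γ, SegmentParallel F x₀ z.1 z.2 γ ∧ γ 0 = y
  · obtain ⟨γ, hγ, rfl⟩ := h
    rw [hγ.segmentTransport_eq]
    exact (hγ.smul hr).segmentTransport_eq
  -- If no solution starts at y, none starts at r y, and the default value is homogeneous as well.
  · have h' : ¬ ∃ γ, SegmentParallel F x₀ z.1 z.2 γ ∧ γ 0 = r • y := by
      rintro ⟨γ, hγ, h0⟩
      refine h ⟨_, hγ.smul (inv_pos.mpr hr), ?_⟩
      simp only [h0]
      rw [smul_smul, inv_mul_cancel₀ hr.ne', one_smul]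
    rw [segmentTransport, dif_neg h', segmentTransport, dif_neg h]

theorem segmentTransport_zero (x₀ : M) (x y : Coord n) :
    segmentTransport F x₀ ((x, 0), y) = y := by
  by_cases h : ∃ γ, SegmentParallel F x₀ x 0 γ ∧ γ 0 = y
  · obtain ⟨γ, hγ, rfl⟩ := h
    have h0 := hγ.ne_zero 0 (left_mem_Icc.mpr zero_le_one)
    have hc : SegmentParallel F x₀ x 0 fun _ => γ 0 :=
      ⟨hγ.mem, fun _ _ => h0, fun s _ => by
        simpa [transportField] using hasDerivWithinAt_const s (Icc (0 : ℝ) 1) (γ 0)⟩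
    exact hc.segmentTransport_eq
  · rw [segmentTransport, dif_neg h]

/-- The segment from `x` to `x + w`, with its velocity. -/
def segmentControl (n : ℕ) : Coord n × Coord n →L[ℝ] C(I, Coord n × Coord n) :=
  LinearMap.mkContinuous
    { toFun := fun z => ⟨fun s => (z.1 + (s : ℝ) • z.2, z.2), by fun_prop⟩
      map_add' := fun z z' => by
        ext1 s
        simp only [ContinuousMap.coe_mk, ContinuousMap.add_apply, Prod.fst_add, Prod.snd_add,
          smul_add, Prod.mk_add_mk]
        congr 1; abel
      map_smul' := fun r z => by
        ext1 s
        simp only [ContinuousMap.coe_mk, ContinuousMap.smul_apply, Prod.smul_fst, Prod.smul_snd,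
          RingHom.id_apply, Prod.smul_mk, smul_add]
        rw [smul_comm r] } 2 fun z => by
    refine (ContinuousMap.norm_le _ (by positivity)).mpr fun s => ?_
    have h1 := norm_fst_le z
    have h2 := norm_snd_le z
    have hs : ‖(s : ℝ)‖ ≤ 1 := by
      rw [Real.norm_eq_abs, abs_le]; constructor <;> linarith [s.2.1, s.2.2]
    have h3 : ‖z.2‖ ≤ 2 * ‖z‖ := by linarith [norm_nonneg z]
    refine max_le ((norm_add_le _ _).trans ?_) h3
    rw [norm_smul]
    have := mul_le_mul hs h2 (norm_nonneg _) zero_le_one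
    linarith

theorem segmentControl_apply (z : Coord n × Coord n) (s : I) :
    segmentControl n z s = (z.1 + (s : ℝ) • z.2, z.2) := rfl

/-- The transport field vanishes at zero velocity, so `exists_local_flow` applies at the constant
control (x, 0). Short segments depend linearly on their data, hence give a smooth family of
controls. -/
theorem eventually_segmentTransport {x₀ : M} {x y : Coord n} (hx : x ∈ chartRan n x₀)
    (hy : y ≠ 0) :
    ∀ᶠ q in 𝓝 ((((x, 0), y)) : (Coord n × Coord n) × Coord n),
      (∃ γ, SegmentParallel F x₀ q.1.1 q.1.2 γ ∧ γ 0 = q.2) ∧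
        ContDiffAt ℝ ∞ (segmentTransport F x₀) q := by
  have hf := smoothNear_transportField F hx 0 hy
  obtain ⟨S, hS, hS0, hsol⟩ := exists_local_flow hf
    (Eventually.of_forall fun y => by simp [transportField])
  let ι : (Coord n × Coord n) × Coord n → C(I, Coord n × Coord n) × Coord n :=
    fun q => (segmentControl n q.1, q.2)
  have hι0 : ι ((x, 0), y) = (.const I (x, 0), y) := by
    refine Prod.ext (ContinuousMap.ext fun s => ?_) rfl
    simp [ι, segmentControl_apply]
  have hι : ContDiff ℝ ∞ ι :=
    ((segmentControl n).contDiff.comp contDiff_fst).prodMk contDiff_snd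
  have hιt : Tendsto ι (𝓝 ((x, 0), y)) (𝓝 (.const I (x, 0), y)) := by
    rw [← hι0]; exact hι.continuous.continuousAt
  have hU : ∀ᶠ u : C(I, Coord n × Coord n) in 𝓝 (.const I (x, 0)), ∀ s, (u s).1 ∈ chartRan n x₀ := by
    have hO : IsOpen (Prod.fst ⁻¹' chartRan n x₀ : Set (Coord n × Coord n)) :=
      (isOpen_chartRan x₀).preimage continuous_fst
    have := (ContinuousMap.isOpen_setOfPred_mapsTo (isCompact_univ (X := I)) hO).mem_nhds
      (x := .const I (x, 0)) (fun s _ => hx)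
    filter_upwards [this] with u hu s using hu (mem_univ s)
  have hV : ∀ᶠ g : C(I, Coord n) in 𝓝 (.const I y), ∀ s, g s ≠ 0 := by
    have := (ContinuousMap.isOpen_setOfPred_mapsTo (isCompact_univ (X := I))
      (isOpen_compl_singleton (x := (0 : Coord n)))).mem_nhds
      (x := .const I y) (fun s _ => hy)
    filter_upwards [this] with g hg s using hg (mem_univ s)
  have hSc : Tendsto S (𝓝 (.const I (x, 0), y)) (𝓝 (.const I y)) := by
    have := hS.continuousAt
    rwa [ContinuousAt, hS0] at this
  have hall : ∀ᶠ q in 𝓝 ((((x, 0), y)) : (Coord n × Coord n) × Coord n),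
      SegmentParallel F x₀ q.1.1 q.1.2 (IccExtend zero_le_one (S (ι q))) ∧ S (ι q) 0 = q.2 ∧
        ContDiffAt ℝ ∞ S (ι q) := by
    filter_upwards [hιt.eventually hsol, hιt.eventually hS,
      hιt.eventually (continuousAt_fst.eventually hU),
      hιt.eventually (hSc.eventually hV)] with q h1 h2 h3 h4
    refine ⟨⟨fun s hs => h3 ⟨s, hs⟩, fun s hs => ?_, fun s hs => ?_⟩, h1.2, h2⟩
    · rw [IccExtend_of_mem _ _ hs]; exact h4 _
    · have := h1.1.hasDerivWithinAt hs
      rw [IccExtend_of_mem _ _ hs]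
      exact this
  have hval : ∀ᶠ q in 𝓝 ((((x, 0), y)) : (Coord n × Coord n) × Coord n),
      segmentTransport F x₀ q = S (ι q) 1 := by
    filter_upwards [hall] with q hq
    have h0 : IccExtend zero_le_one (S (ι q)) 0 = q.2 :=
      (IccExtend_of_mem _ _ (left_mem_Icc.mpr zero_le_one)).trans hq.2.1
    have h1 := hq.1.segmentTransport_eq
    rw [h0, IccExtend_of_mem _ _ (right_mem_Icc.mpr zero_le_one)] at h1
    exact h1
  filter_upwards [hall, hval.eventually_nhds] with q hq hq'
  refine ⟨⟨_, hq.1, (IccExtend_of_mem _ _ (left_mem_Icc.mpr zero_le_one)).trans hq.2.1⟩, ?_⟩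
  have a1 : ContDiffAt ℝ ∞ (fun q => S (ι q)) q := hq.2.2.comp q hι.contDiffAt
  let ev : C(I, Coord n) →L[ℝ] Coord n := ContinuousMap.evalCLM ℝ (1 : I)
  have a2 : ContDiffAt ℝ ∞ (fun q => S (ι q) 1) q := ev.contDiff.contDiffAt.comp q a1
  exact a2.congr_of_eventuallyEq hq'

/-- One neighbourhood of (x, 0) works for all nonzero y at once: on the unit sphere by compactness,
elsewhere by homogeneity of the transport. -/
theorem eventually_forall_segmentTransport {x₀ : M} {x : Coord n} (hx : x ∈ chartRan n x₀) :
    ∀ᶠ z in 𝓝 ((x, 0) : Coord n × Coord n), ∀ y : Coord n, y ≠ 0 →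
      (∃ γ, SegmentParallel F x₀ z.1 z.2 γ ∧ γ 0 = y) ∧
        ContDiffAt ℝ ∞ (segmentTransport F x₀) (z, y) := by
  have h1 : ∀ᶠ z in 𝓝 ((x, 0) : Coord n × Coord n), ∀ y ∈ Metric.sphere (0 : Coord n) 1,
      (∃ γ, SegmentParallel F x₀ z.1 z.2 γ ∧ γ 0 = y) ∧
        ContDiffAt ℝ ∞ (segmentTransport F x₀) (z, y) := by
    refine (isCompact_sphere (0 : Coord n) 1).eventually_forall_of_forall_eventually fun y hy => ?_
    exact eventually_segmentTransport F hx (ne_zero_of_mem_unit_sphere ⟨y, hy⟩)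
  filter_upwards [h1] with z hz y hy
  have hr : 0 < ‖y‖ := norm_pos_iff.mpr hy
  obtain ⟨⟨γ, hγ, h0⟩, hs⟩ := hz (‖y‖⁻¹ • y) (by simp [norm_smul, hr.ne'])
  have hback : ‖y‖ • ‖y‖⁻¹ • y = y := by rw [smul_smul, mul_inv_cancel₀ hr.ne', one_smul]
  refine ⟨⟨_, hγ.smul hr, by simp only [h0, hback]⟩, ?_⟩
  have h2 : segmentTransport F x₀ = fun q => ‖y‖ • segmentTransport F x₀ (q.1, ‖y‖⁻¹ • q.2) := by
    funext q
    rw [segmentTransport_smul F x₀ q.1 q.2 (inv_pos.mpr hr), smul_smul, mul_inv_cancel₀ hr.ne',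
      one_smul]
  rw [h2]
  exact ContDiffAt.const_smul _ (hs.comp ((z, y) : (Coord n × Coord n) × Coord n)
    (f := fun q : (Coord n × Coord n) × Coord n => (q.1, ‖y‖⁻¹ • q.2)) (by fun_prop))

/-- Smoothness already provides some derivative in t. It is identified by a scaling argument:
translation along the part r T u of one fixed segment T u is the value at r of a single solution,
whose derivative at 0 is given by the equation. -/
theorem hasDerivAt_segmentTransport {x₀ : M} {x y : Coord n} (hx : x ∈ chartRan n x₀) (hy : y ≠ 0)
    (u : Coord n) :
    HasDerivAt (fun t : ℝ => segmentTransport F x₀ ((x, t • u), y))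
      (-(conn (F.inChart x₀) x y u)) 0 := by
  have hev := eventually_segmentTransport F hx hy
  have hd : DifferentiableAt ℝ (segmentTransport F x₀) ((x, 0), y) :=
    hev.self_of_nhds.2.differentiableAt (by simp)
  have hline : ∀ t : ℝ, HasDerivAt (fun t : ℝ => (((x, t • u), y) : (Coord n × Coord n) × Coord n))
      ((0, u), 0) t := fun t => by
    have h1 : HasDerivAt (fun t : ℝ => t • u) u t := by
      simpa using (hasDerivAt_id t).smul_const u
    exact ((hasDerivAt_const t x).prodMk h1).prodMk (hasDerivAt_const t y)
  have hlim : Tendsto (fun t : ℝ => (((x, t • u), y) : (Coord n × Coord n) × Coord n)) (𝓝 0)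
      (𝓝 ((x, 0), y)) := by
    have := (hline 0).continuousAt.tendsto
    simpa using this
  obtain ⟨δ, hδ, hball⟩ := Metric.eventually_nhds_iff_ball.mp (hlim.eventually hev)
  have hdiff : HasDerivAt (fun t : ℝ => segmentTransport F x₀ ((x, t • u), y))
      (fderiv ℝ (segmentTransport F x₀) ((x, 0), y) ((0, u), 0)) 0 := by
    have h0 := hline 0
    have hd' : HasFDerivAt (segmentTransport F x₀) (fderiv ℝ (segmentTransport F x₀) ((x, 0), y))
        ((x, (0 : ℝ) • u), y) := by rw [zero_smul]; exact hd.hasFDerivAt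
    exact hd'.comp_hasDerivAt 0 h0
  -- along one fixed segment the transport is the solution of the differential equation
  set T := δ / 2 with hT
  have hTpos : 0 < T := half_pos hδ
  have hTball : T ∈ Metric.ball (0 : ℝ) δ := by
    rw [Metric.mem_ball, dist_zero_right, Real.norm_eq_abs, abs_of_pos hTpos]
    exact half_lt_self hδ
  obtain ⟨⟨γ, hγ, hγ0⟩, -⟩ := hball T hTball
  have hscale : ∀ r ∈ Icc (0 : ℝ) 1,
      segmentTransport F x₀ ((x, (r * T) • u), y) = γ r := by
    intro r hr
    have hm : ∀ s ∈ Icc (0 : ℝ) 1, s * r ∈ Icc (0 : ℝ) 1 := fun s hs =>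
      ⟨mul_nonneg hs.1 hr.1, mul_le_one₀ hs.2 hr.1 hr.2⟩
    have e : ∀ s : ℝ, x + s • (r * T) • u = x + (s * r) • T • u := fun s => by
      simp only [smul_smul, mul_assoc]
    have hsol : SegmentParallel F x₀ x ((r * T) • u) fun s => γ (s * r) := by
      refine ⟨fun s hs => ?_, fun s hs => hγ.ne_zero _ (hm s hs), fun s hs => ?_⟩
      · rw [e]; exact hγ.mem _ (hm s hs)
      · have b1 : HasDerivWithinAt (fun s : ℝ => s * r) r (Icc 0 1) s := by
          simpa using ((hasDerivAt_id s).mul_const r).hasDerivWithinAt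
        have b2 := HasDerivWithinAt.scomp (g₁ := γ) s (hγ.deriv _ (hm s hs)) b1 (fun s hs => hm s hs)
        rw [e, mul_smul r T u, transportField_smul]
        exact b2
    have h1 := hsol.segmentTransport_eq
    simp only [zero_mul, one_mul, hγ0] at h1
    exact h1
  have hγd := hγ.deriv 0 (left_mem_Icc.mpr zero_le_one)
  have hγd' : HasDerivWithinAt γ (T • fderiv ℝ (segmentTransport F x₀) ((x, 0), y) ((0, u), 0))
      (Icc 0 1) 0 := by
    have b1 : HasDerivAt (fun r : ℝ => r * T) T 0 := by
      simpa using (hasDerivAt_id (0 : ℝ)).mul_const T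
    have hdiff' : HasDerivAt (fun t : ℝ => segmentTransport F x₀ ((x, t • u), y))
      (fderiv ℝ (segmentTransport F x₀) ((x, 0), y) ((0, u), 0)) (0 * T) := by rwa [zero_mul]
    have b2 : HasDerivAt (fun r : ℝ => segmentTransport F x₀ ((x, (r * T) • u), y))
        (T • fderiv ℝ (segmentTransport F x₀) ((x, 0), y) ((0, u), 0)) 0 :=
      HasDerivAt.scomp (g₁ := fun t : ℝ => segmentTransport F x₀ ((x, t • u), y)) (0 : ℝ) hdiff' b1
    exact b2.hasDerivWithinAt.congr_of_mem
      (fun r hr => (hscale r hr).symm) (left_mem_Icc.mpr zero_le_one)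
  have huniq := (uniqueDiffOn_Icc (zero_lt_one' ℝ) 0 (left_mem_Icc.mpr zero_le_one)).eq_deriv _
    hγd' hγd
  simp only [zero_smul, add_zero, hγ0] at huniq
  rw [transportField_smul] at huniq
  have := smul_right_injective _ hTpos.ne' huniq
  rw [this] at hdiff
  exact hdiff

end Segment

/-! ### Translations between fibres over one chart, in coordinates. -/

section ChartTranslation

variable {n : ℕ} {M : Type*} [TopologicalSpace M] [ChartedSpace (Coord n) M]
  [IsManifold (𝓡 n) ∞ M] (F : FinslerFunction n M)

theorem homExt_of_ne {p : M} (f : Indicatrix F p → Coord n) {y : Coord n} (hy : y ≠ 0) :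
    homExt F f y = F.fib p y • f (normalize F p y hy) := by
  simp [homExt, hy]

/-- `f` is the parallel translation along some piecewise smooth curve from the point with coordinates
`x` to the point with coordinates `x'`, in the coordinates of the chart around `x₀`. -/
def ChartTranslation (x₀ : M) (x x' : Coord n) (f : Coord n → Coord n) : Prop :=
  x ∈ chartRan n x₀ ∧ x' ∈ chartRan n x₀ ∧
    ∃ τ : Indicatrix F (pointOf x₀ x) ≃ Indicatrix F (pointOf x₀ x'),
      IsPiecewiseTranslation F _ _ τ ∧ ∀ y, y ≠ 0 → f y = coordOf x₀ (pointOf x₀ x')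
        (homExt F (fun u => (τ u).1) (vecOf x₀ (pointOf x₀ x) y))

variable {F}

theorem ChartTranslation.ne_zero {x₀ : M} {x x' : Coord n} {f : Coord n → Coord n}
    (h : ChartTranslation F x₀ x x' f) {y : Coord n} (hy : y ≠ 0) : f y ≠ 0 := by
  obtain ⟨hx, hx', τ, -, hf⟩ := h
  rw [hf y hy]
  exact coordOf_ne_zero (pointOf_mem hx') (homExt_ne_zero F τ (vecOf_ne_zero (pointOf_mem hx) hy))

theorem ChartTranslation.comp {x₀ : M} {x x' x'' : Coord n} {f g : Coord n → Coord n}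
    (hg : ChartTranslation F x₀ x' x'' g) (hf : ChartTranslation F x₀ x x' f) :
    ChartTranslation F x₀ x x'' fun y => g (f y) := by
  have hf' := hf
  obtain ⟨hx', hx'', τ, hτ, hgτ⟩ := hg
  obtain ⟨hx, -, ρ, hρ, hfρ⟩ := hf
  refine ⟨hx, hx'', ρ.trans τ, hρ.trans F hτ, fun y hy => ?_⟩
  refine (hgτ _ (hf'.ne_zero hy)).trans ?_
  rw [hfρ y hy, vecOf_coordOf (pointOf_mem hx')]
  exact congrArg _ (homExt_comp F τ ρ _).symm

theorem chartTranslation_id {x₀ : M} {x : Coord n} (hx : x ∈ chartRan n x₀) :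
    ChartTranslation F x₀ x x fun y => y := by
  refine ⟨hx, hx, Equiv.refl _, .refl _, fun y _ => ?_⟩
  have := homExt_id F (p := pointOf x₀ x) (y := vecOf x₀ (pointOf x₀ x) y)
  simp only [Equiv.refl_apply]
  rw [this, coordOf_vecOf (pointOf_mem hx)]

theorem contMDiffOn_segment {x₀ : M} {x w : Coord n}
    (h : ∀ s ∈ Icc (0 : ℝ) 1, x + s • w ∈ chartRan n x₀) :
    ContMDiffOn 𝓘(ℝ, ℝ) (𝓡 n) ∞ (fun s : ℝ => pointOf x₀ (x + s • w)) (Icc 0 1) := by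
  have h1 : ContMDiffOn 𝓘(ℝ, ℝ) 𝓘(ℝ, Coord n) ∞ (fun s : ℝ => x + s • w) (Icc 0 1) :=
    (ContDiff.contMDiff (by fun_prop)).contMDiffOn
  exact (contMDiffOn_extChartAt_symm (I := 𝓡 n) (n := ∞) x₀).comp h1 h

theorem SegmentParallel.isParallelVec {x₀ : M} {x w : Coord n} {γ : ℝ → Coord n}
    (h : SegmentParallel F x₀ x w γ) :
    IsParallelVec F (fun s : ℝ => pointOf x₀ (x + s • w)) 1
      fun s => vecOf x₀ (pointOf x₀ (x + s • w)) (γ s) := by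
  have hdom := fun s hs => pointOf_mem (h.mem s hs)
  refine IsParallelVec.of_chart F one_pos x₀ (contMDiffOn_segment h.mem) hdom
    (fun s hs => vecOf_ne_zero (hdom s hs) (h.ne_zero s hs)) fun s hs => ?_
  have e1 : ∀ s ∈ Icc (0 : ℝ) 1,
      extChartAt (𝓡 n) x₀ (pointOf x₀ (x + s • w)) = x + s • w :=
    fun s hs => extChartAt_pointOf (h.mem s hs)
  have e2 : ∀ s ∈ Icc (0 : ℝ) 1, coordOf x₀ (pointOf x₀ (x + s • w))
      (vecOf x₀ (pointOf x₀ (x + s • w)) (γ s)) = γ s :=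
    fun s hs => coordOf_vecOf (hdom s hs) _
  have d1 : HasDerivWithinAt (fun s : ℝ => x + s • w) w (Icc 0 1) s := by
    simpa using (((hasDerivAt_id s).smul_const w).const_add x).hasDerivWithinAt
  rw [(d1.congr_of_mem e1 hs).derivWithin (uniqueDiffOn_Icc one_pos s hs), e1 s hs, e2 s hs]
  exact (h.deriv s hs).congr_of_mem e2 hs

theorem SegmentParallel.inChart_eq_one {x₀ : M} {x w : Coord n} {γ : ℝ → Coord n}
    (h : SegmentParallel F x₀ x w γ) (h0 : F.inChart x₀ x (γ 0) = 1) :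
    F.inChart x₀ (x + w) (γ 1) = 1 := by
  have := h.isParallelVec.fib_eq_one F (contMDiffOn_segment h.mem)
    (by simp only [zero_smul, add_zero]; exact h0) 1 (right_mem_Icc.mpr zero_le_one)
  simp only [one_smul] at this
  exact this

theorem SegmentParallel.reverse_transport {x₀ : M} {x w : Coord n} {γ : ℝ → Coord n}
    (h : SegmentParallel F x₀ x w γ) :
    segmentTransport F x₀ ((x + w, -w), segmentTransport F x₀ ((x, w), γ 0)) = γ 0 := by
  have h1 := h.reverse.segmentTransport_eq
  simp only [sub_zero, sub_self] at h1
  rw [h.segmentTransport_eq, h1]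

/-- Translation along the reversed segment inverts the transport, so transport restricts to a
bijection of indicatrices. This is why solutions along both orientations are assumed. -/
theorem chartTranslation_segment {x₀ : M} {x w : Coord n}
    (h1 : ∀ y : Coord n, y ≠ 0 → ∃ γ, SegmentParallel F x₀ x w γ ∧ γ 0 = y)
    (h2 : ∀ y : Coord n, y ≠ 0 → ∃ γ, SegmentParallel F x₀ (x + w) (-w) γ ∧ γ 0 = y)
    (hx : x ∈ chartRan n x₀) (hxw : x + w ∈ chartRan n x₀) :
    ChartTranslation F x₀ x (x + w) fun y => segmentTransport F x₀ ((x, w), y) := by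
  set z := pointOf x₀ x
  set z' := pointOf x₀ (x + w)
  have hz : z ∈ chartDom n x₀ := pointOf_mem hx
  have hzd' : z' ∈ chartDom n x₀ := pointOf_mem hxw
  have hc0 : ∀ y : Indicatrix F z, coordOf x₀ z y.1 ≠ 0 :=
    fun y => coordOf_ne_zero hz (indicatrix_ne_zero F y)
  choose γ hγ hγ0 using fun y : Indicatrix F z => h1 (coordOf x₀ z y.1) (hc0 y)
  have hin : ∀ y : Indicatrix F z, F.inChart x₀ x (γ y 0) = 1 := fun y => by
    rw [hγ0]
    change F.fib z (vecOf x₀ z (coordOf x₀ z y.1)) = 1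
    rw [vecOf_coordOf hz]
    exact y.2
  let f : Indicatrix F z → Indicatrix F z' := fun y =>
    ⟨vecOf x₀ z' (γ y 1), (hγ y).inChart_eq_one (hin y)⟩
  have hf : ∀ y, (f y).1 = vecOf x₀ z' (segmentTransport F x₀ ((x, w), coordOf x₀ z y.1)) :=
    fun y => by
      rw [← hγ0, (hγ y).segmentTransport_eq]
  have hinj : Function.Injective f := by
    intro y y' h
    have e1 : vecOf x₀ z' (γ y 1) = vecOf x₀ z' (γ y' 1) := congrArg Subtype.val h
    have e2 : γ y 1 = γ y' 1 := (vecEquiv hzd').injective e1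
    have r1 := (hγ y).reverse_transport
    have r2 := (hγ y').reverse_transport
    rw [(hγ y).segmentTransport_eq, hγ0] at r1
    rw [(hγ y').segmentTransport_eq, hγ0] at r2
    rw [e2, r2] at r1
    exact Subtype.ext ((vecEquiv hz).symm.injective r1).symm
  have hsurj : Function.Surjective f := by
    intro y'
    obtain ⟨η, hη, hη0⟩ := h2 (coordOf x₀ z' y'.1) (coordOf_ne_zero hzd' (indicatrix_ne_zero F y'))
    have hη1 : F.inChart x₀ x (η 1) = 1 := by
      have := hη.inChart_eq_one (by
        rw [hη0]
        change F.fib z' (vecOf x₀ z' (coordOf x₀ z' y'.1)) = 1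
        rw [vecOf_coordOf hzd']
        exact y'.2)
      rwa [add_neg_cancel_right] at this
    refine ⟨⟨vecOf x₀ z (η 1), hη1⟩, Subtype.ext ?_⟩
    refine (hf _).trans ?_
    change vecOf x₀ z' (segmentTransport F x₀ ((x, w), coordOf x₀ z (vecOf x₀ z (η 1)))) = y'.1
    rw [coordOf_vecOf hz]
    have r := hη.reverse_transport
    rw [add_neg_cancel_right, neg_neg, hη.segmentTransport_eq, hη0] at r
    rw [r, vecOf_coordOf hzd']
  refine ⟨hx, hxw, Equiv.ofBijective f ⟨hinj, hsurj⟩, .single F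
    (c := fun s : ℝ => pointOf x₀ (x + s • w)) (a := 1) ?_, fun y hy => ?_⟩
  · have hmem : ∀ s ∈ Icc (0 : ℝ) 1, x + s • w ∈ chartRan n x₀ := by
      -- In dimension 0 there are no nonzero vectors from which to read off that the segment stays
      -- in the chart, but then the segment is a point.
      by_cases hn : ∃ y : Coord n, y ≠ 0
      · obtain ⟨y, hy⟩ := hn
        obtain ⟨γ, hγ, -⟩ := h1 y hy
        exact hγ.mem
      · push Not at hn
        intro s _
        rw [hn w, smul_zero, add_zero]
        exact hx
    refine isTranslation_of_parallelVec F one_pos (contMDiffOn_segment hmem) (by simp)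
      (by simp) fun y => ⟨_, (hγ y).isParallelVec, ?_, ?_⟩
    · simp only [zero_smul, add_zero]
      rw [hγ0]
      exact vecOf_coordOf hz _
    · simp only [one_smul]
      rfl
  · have hv : vecOf x₀ z y ≠ 0 := vecOf_ne_zero hz hy
    have hF := fib_pos F z hv
    have e1 : homExt F (fun u => (f u).1) (vecOf x₀ z y) = F.fib z (vecOf x₀ z y) •
        vecOf x₀ z' (segmentTransport F x₀ ((x, w),
          coordOf x₀ z ((F.fib z (vecOf x₀ z y))⁻¹ • vecOf x₀ z y))) :=
      (homExt_of_ne F _ hv).trans (congrArg _ (hf _))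
    have e2 : coordOf x₀ z' (homExt F (fun u => (f u).1) (vecOf x₀ z y))
        = segmentTransport F x₀ ((x, w), y) := by
      rw [e1, coordOf_smul, coordOf_smul, coordOf_vecOf hzd', coordOf_vecOf hz,
        segmentTransport_smul F x₀ _ _ (inv_pos.mpr hF), smul_smul, mul_inv_cancel₀ hF.ne', one_smul]
    exact e2.symm

end ChartTranslation

/-! ### Families of admissible maps and their leading coefficients -/

section LeadFamily

variable {P E : Type} [NormedAddCommGroup P] [NormedSpace ℝ P]
  [NormedAddCommGroup E] [NormedSpace ℝ E]

/-- `Adm x x' f` says that `f` is an admissible map from the fibre over `x` to the fibre over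
`x'`. -/
structure IsTransportLaw (Adm : P → P → (E → E) → Prop) (x₀ : P) : Prop where
  comp : ∀ {x x' x'' f g}, Adm x' x'' g → Adm x x' f → Adm x x'' fun y => g (f y)
  ne_zero : ∀ {x x' f y}, Adm x x' f → y ≠ 0 → f y ≠ 0
  id : ∀ᶠ x in 𝓝 x₀, Adm x x fun y => y

theorem eventually_shift {Q : ℝ × P → Prop} {x₀ : P} (u : P) (h : ∀ᶠ q in 𝓝 ((0 : ℝ), x₀), Q q) :
    ∀ᶠ q in 𝓝 ((0 : ℝ), x₀), Q (q.1, q.2 + q.1 • u) := by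
  have h1 : Continuous fun q : ℝ × P => (q.1, q.2 + q.1 • u) := by fun_prop
  have h2 := h1.tendsto ((0 : ℝ), x₀)
  simp only [zero_smul, add_zero] at h2
  exact h2.eventually h

theorem eventually_ne_zero_fibre {Q : P → E → Prop} {x₀ : P}
    (h : ∀ᶠ x in 𝓝 x₀, ∀ y, y ≠ 0 → Q x y) :
    ∀ᶠ x in 𝓝 x₀, ∀ y, y ≠ 0 → ∀ᶠ z in 𝓝 (x, y), Q z.1 z.2 := by
  filter_upwards [h.eventually_nhds] with x hx y hy
  filter_upwards [continuousAt_fst.eventually hx,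
    continuousAt_snd.eventually (isOpen_ne.mem_nhds hy)] with z h1 h2 using h1 _ h2

theorem eventually_ne_zero_state {Q : ℝ → P → E → Prop} {x₀ : P}
    (h : ∀ᶠ q in 𝓝 ((0 : ℝ), x₀), ∀ y, y ≠ 0 → Q q.1 q.2 y) :
    ∀ᶠ x in 𝓝 x₀, ∀ y, y ≠ 0 → ∀ᶠ p in 𝓝 ((0 : ℝ), (x, y)), Q p.1 p.2.1 p.2.2 := by
  have h1 : ∀ᶠ x in 𝓝 x₀, ∀ᶠ q in 𝓝 ((0 : ℝ), x), ∀ y, y ≠ 0 → Q q.1 q.2 y :=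
    (Continuous.prodMk_right (0 : ℝ)).continuousAt.eventually h.eventually_nhds
  filter_upwards [h1] with x hx y hy
  have h2 : ContinuousAt (fun p : ℝ × (P × E) => (p.1, p.2.1)) (0, (x, y)) := by fun_prop
  have h3 : ContinuousAt (fun p : ℝ × (P × E) => p.2.2) (0, (x, y)) := by fun_prop
  filter_upwards [h2.eventually hx, h3.eventually (isOpen_ne.mem_nhds hy)] with p h4 h5
    using h4 _ h5

/-- A family of admissible maps from the fibre over `x` to the fibre over `x + t u`, smooth for
`(t, x)` near `(0, x₀)`. -/
structure SmoothFamily (Adm : P → P → (E → E) → Prop) (x₀ u : P) (Φ : ℝ × (P × E) → E) : Prop where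
  smooth : ∀ᶠ q in 𝓝 ((0 : ℝ), x₀), ∀ y, y ≠ 0 → ContDiffAt ℝ ∞ Φ (q.1, (q.2, y))
  adm : ∀ᶠ q in 𝓝 ((0 : ℝ), x₀), Adm q.2 (q.2 + q.1 • u) fun y => Φ (q.1, (q.2, y))

/-- The composition of `Φ` with the family `Ψ` of displacement `u`. -/
def composeFamily (u : P) (Φ Ψ : ℝ × (P × E) → E) (p : ℝ × (P × E)) : E :=
  Φ (p.1, (p.2.1 + p.1 • u, Ψ p))

theorem SmoothFamily.comp {Adm : P → P → (E → E) → Prop} {x₀ u u' : P} {Φ Φ' : ℝ × (P × E) → E}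
    (hA : IsTransportLaw Adm x₀) (h : SmoothFamily Adm x₀ u Φ) (h' : SmoothFamily Adm x₀ u' Φ') :
    SmoothFamily Adm x₀ (u + u') (composeFamily u' Φ Φ') where
  smooth := by
    filter_upwards [eventually_shift u' h.smooth, h'.smooth, h'.adm] with q h1 h2 h3 y hy
    have h4 := h1 _ (hA.ne_zero h3 hy)
    have h5 : ContDiffAt ℝ ∞ (fun p : ℝ × (P × E) => (p.1, (p.2.1 + p.1 • u', Φ' p)))
        (q.1, (q.2, y)) := by
      have e1 : ContDiffAt ℝ ∞ (fun p : ℝ × (P × E) => p.2.1 + p.1 • u') (q.1, (q.2, y)) := by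
        fun_prop
      exact contDiffAt_fst.prodMk (e1.prodMk (h2 y hy))
    exact ContDiffAt.comp (q.1, (q.2, y)) h4 h5
  adm := by
    filter_upwards [eventually_shift u' h.adm, h'.adm] with q h1 h2
    have h3 := hA.comp h1 h2
    rw [add_assoc, ← smul_add, add_comm u' u] at h3
    exact h3

/-- Two families that are inverse to each other. -/
structure InversePair (Adm : P → P → (E → E) → Prop) (x₀ u : P) (Φ Ψ : ℝ × (P × E) → E) :
    Prop where
  fwd : SmoothFamily Adm x₀ u Φ
  bwd : SmoothFamily Adm x₀ (-u) Ψ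
  fwd_bwd : ∀ᶠ q in 𝓝 ((0 : ℝ), x₀), ∀ y, y ≠ 0 →
    composeFamily (-u) Φ Ψ (q.1, (q.2, y)) = y
  bwd_fwd : ∀ᶠ q in 𝓝 ((0 : ℝ), x₀), ∀ y, y ≠ 0 → composeFamily u Ψ Φ (q.1, (q.2, y)) = y

theorem InversePair.symm {Adm : P → P → (E → E) → Prop} {x₀ u : P} {Φ Ψ : ℝ × (P × E) → E}
    (h : InversePair Adm x₀ u Φ Ψ) : InversePair Adm x₀ (-u) Ψ Φ where
  fwd := h.bwd
  bwd := by rw [neg_neg]; exact h.fwd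
  fwd_bwd := by rw [neg_neg]; exact h.bwd_fwd
  bwd_fwd := h.fwd_bwd

/-- In the inverse of a composition, the second factor starts at the base point reached by the
first. The hypothesis on `Φ'` is therefore used over the shifted point x - t u. -/
theorem eventually_composeFamily_inverse {Adm : P → P → (E → E) → Prop} {x₀ u u' : P}
    {Φ Ψ Φ' Ψ' : ℝ × (P × E) → E} (hA : IsTransportLaw Adm x₀) (hΨ : SmoothFamily Adm x₀ (-u) Ψ)
    (h : ∀ᶠ q in 𝓝 ((0 : ℝ), x₀), ∀ y, y ≠ 0 → composeFamily (-u) Φ Ψ (q.1, (q.2, y)) = y)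
    (h' : ∀ᶠ q in 𝓝 ((0 : ℝ), x₀), ∀ y, y ≠ 0 →
      composeFamily (-u') Φ' Ψ' (q.1, (q.2, y)) = y) :
    ∀ᶠ q in 𝓝 ((0 : ℝ), x₀), ∀ y, y ≠ 0 → composeFamily (-(u + u')) (composeFamily u' Φ Φ')
      (composeFamily (-u) Ψ' Ψ) (q.1, (q.2, y)) = y := by
  filter_upwards [h, eventually_shift (-u) h', hΨ.adm] with q h1 h2 h3 y hy
  have h4 := h2 _ (hA.ne_zero h3 hy)
  have h5 := h1 y hy
  simp only [composeFamily] at h4 h5 ⊢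
  have e1 : q.2 + q.1 • -(u + u') = q.2 + q.1 • -u + q.1 • -u' := by
    simp only [smul_neg, smul_add]; abel
  have e2 : q.2 + q.1 • -u + q.1 • -u' + q.1 • u' = q.2 + q.1 • -u := by
    simp only [smul_neg]; abel
  rw [e1, h4, e2, h5]

theorem InversePair.comp {Adm : P → P → (E → E) → Prop} {x₀ u u' : P} {Φ Ψ Φ' Ψ' : ℝ × (P × E) → E}
    (hA : IsTransportLaw Adm x₀) (h : InversePair Adm x₀ u Φ Ψ) (h' : InversePair Adm x₀ u' Φ' Ψ') :
    InversePair Adm x₀ (u + u') (composeFamily u' Φ Φ') (composeFamily (-u) Ψ' Ψ) where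
  fwd := h.fwd.comp hA h'.fwd
  bwd := by
    rw [neg_add_rev]
    exact h'.bwd.comp hA h.bwd
  fwd_bwd := eventually_composeFamily_inverse hA h.bwd h.fwd_bwd h'.fwd_bwd
  bwd_fwd := by
    have h1 := eventually_composeFamily_inverse (u := -u') (u' := -u) hA h'.symm.bwd
      h'.symm.fwd_bwd h.symm.fwd_bwd
    simpa only [neg_add_rev, neg_neg] using h1

/-- The map `(x, y) ↦ (x + t u, Φ(t, x, y))`. -/
def stateMap (u : P) (Φ : ℝ × (P × E) → E) (p : ℝ × (P × E)) : P × E := (p.2.1 + p.1 • u, Φ p)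

/-- A family of admissible maps, with its inverse, such that the family of maps
`(x, y) ↦ (x + t u, Φ(t, x, y))` is `id + t ^ k (v, ζ) + o(t ^ k)`. -/
structure LeadFamily (Adm : P → P → (E → E) → Prop) (x₀ u v : P) (k : ℕ) (ζ : P × E → E)
    (Φ Ψ : ℝ × (P × E) → E) : Prop where
  pair : InversePair Adm x₀ u Φ Ψ
  pos : 1 ≤ k
  order : ∀ᶠ x in 𝓝 x₀, ∀ y, y ≠ 0 → HasOrderAt (stateMap u Φ) k (v, ζ (x, y)) (x, y)

variable {Adm : P → P → (E → E) → Prop} {x₀ u v u' v' : P} {k l : ℕ} {ζ η : P × E → E}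
  {Φ Ψ Φ' Ψ' : ℝ × (P × E) → E}

theorem SmoothFamily.smoothNear (h : SmoothFamily Adm x₀ u Φ) :
    ∀ᶠ x in 𝓝 x₀, ∀ y, y ≠ 0 → SmoothNear Φ (0, (x, y)) := by
  filter_upwards [eventually_ne_zero_state (Q := fun t x y => ContDiffAt ℝ ∞ Φ (t, (x, y)))
    h.smooth] with x hx y hy using hx y hy

theorem SmoothNear.stateMap {z : ℝ × (P × E)} (h : SmoothNear Φ z) :
    SmoothNear (stateMap u Φ) z :=
  SmoothNear.prodMk (smoothNear_of_contDiff (by fun_prop) _) h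

theorem LeadFamily.apply_zero [CompleteSpace P] [CompleteSpace E]
    (h : LeadFamily Adm x₀ u v k ζ Φ Ψ) :
    ∀ᶠ x in 𝓝 x₀, ∀ y, y ≠ 0 → Φ (0, (x, y)) = y ∧ Ψ (0, (x, y)) = y := by
  have h1 : ∀ᶠ x in 𝓝 x₀, ∀ y, y ≠ 0 → composeFamily u Ψ Φ (0, (x, y)) = y :=
    (Continuous.prodMk_right (0 : ℝ)).continuousAt.eventually h.pair.bwd_fwd
  filter_upwards [h.pair.fwd.smoothNear, h.order, h1] with x h1 h2 h3 y hy
  have h4 : Φ (0, (x, y)) = y := congrArg Prod.snd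
    ((h2 y hy).apply_zero h.pos (SmoothNear.stateMap (u := u) (h1 y hy)).continuousAt)
  have h5 := h3 y hy
  simp only [composeFamily, zero_smul, add_zero, h4] at h5
  exact ⟨h4, h5⟩

/-- The coefficient is the restriction to t = 0 of the smooth remainder factor given by Hadamard's
lemma. -/
theorem LeadFamily.smooth_lead [CompleteSpace P] [CompleteSpace E]
    (h : LeadFamily Adm x₀ u v k ζ Φ Ψ) :
    ∀ᶠ x in 𝓝 x₀, ∀ y, y ≠ 0 → SmoothNear ζ (x, y) := by
  filter_upwards [h.pair.fwd.smoothNear, eventually_ne_zero_fibre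
    (Q := fun x y => HasOrderAt (Finsler.stateMap u Φ) k (v, ζ (x, y)) (x, y)) h.order]
    with x h1 h2 y hy
  obtain ⟨A, hA, -, hAζ⟩ := exists_smooth_coeff (α := fun z => (v, ζ z))
    (SmoothNear.stateMap (u := u) (h1 y hy)) (h2 y hy)
  have h3 : SmoothNear (fun z => (A (0, z)).2) (x, y) :=
    SmoothNear.comp (g := Prod.snd) (smoothNear_of_contDiff contDiff_snd _)
      (SmoothNear.comp (g := A) (f := fun z => (0, z)) hA
        (smoothNear_of_contDiff (by fun_prop) _))
  exact h3.congr (hAζ.mono fun z hz => (congrArg Prod.snd hz).symm)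

/-- The second component of the bracket of `(v, ζ)` and `(v', η)`. -/
def leadComm (v : P) (ζ : P × E → E) (v' : P) (η : P × E → E) (z : P × E) : E :=
  fderiv ℝ ζ z (v', η z) - fderiv ℝ η z (v, ζ z)

theorem HasOrderAt.congr_eventually {Z : Type} [NormedAddCommGroup Z] [NormedSpace ℝ Z]
    {a b : ℝ × Z → Z} {k : ℕ} {v z : Z} (h : HasOrderAt a k v z) (hab : ∀ t, b (t, z) = a (t, z)) :
    HasOrderAt b k v z := by
  simpa only [HasOrderAt, hab] using h

/-- The displacements u, u', -u, -u' add up to zero, so the commutator maps each fibre to itself.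
The base components v and v' of the coefficients are constant, so the bracket has zero base
component. Two segment families give parallelograms in this way. -/
theorem LeadFamily.comm [CompleteSpace P] [CompleteSpace E] (hA : IsTransportLaw Adm x₀)
    (h : LeadFamily Adm x₀ u v k ζ Φ Ψ) (h' : LeadFamily Adm x₀ u' v' l η Φ' Ψ') :
    ∃ Φ₁ Ψ₁, LeadFamily Adm x₀ 0 0 (k + l) (leadComm v ζ v' η) Φ₁ Ψ₁ := by
  have hp := h.pair.comp hA (h'.pair.comp hA (h.pair.symm.comp hA h'.pair.symm))
  have e0 : u + (u' + (-u + -u')) = 0 := by abel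
  rw [e0] at hp
  refine ⟨_, _, hp, h.pos.trans (Nat.le_add_right _ _), ?_⟩
  filter_upwards [h.smooth_lead, h'.smooth_lead, h.apply_zero, h'.apply_zero,
    h.pair.fwd.smoothNear, h.pair.bwd.smoothNear, h'.pair.fwd.smoothNear, h'.pair.bwd.smoothNear,
    eventually_ne_zero_fibre
      (Q := fun x y => HasOrderAt (Finsler.stateMap u Φ) k (v, ζ (x, y)) (x, y)) h.order,
    eventually_ne_zero_fibre
      (Q := fun x y => HasOrderAt (Finsler.stateMap u' Φ') l (v', η (x, y)) (x, y)) h'.order,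
    eventually_ne_zero_state
      (Q := fun t x y => composeFamily (-u) Φ Ψ (t, (x, y)) = y) h.pair.fwd_bwd,
    eventually_ne_zero_state
      (Q := fun t x y => composeFamily (-u') Φ' Ψ' (t, (x, y)) = y) h'.pair.fwd_bwd]
    with x s1 s2 a1 a2 f1 b1 f2 b2 o1 o2 c1 c2 y hy
  have key := commutator_hasOrderAt (a := Finsler.stateMap u Φ) (a' := Finsler.stateMap (-u) Ψ)
    (b := Finsler.stateMap u' Φ') (b' := Finsler.stateMap (-u') Ψ') (α := fun z => (v, ζ z))
    (β := fun z => (v', η z)) h.pos h'.pos (f1 y hy).stateMap (f2 y hy).stateMap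
    (SmoothNear.stateMap (b1 y hy)).continuousAt (SmoothNear.stateMap (b2 y hy)).continuousAt
    (by simp [Finsler.stateMap, (a1 y hy).2]) (by simp [Finsler.stateMap, (a2 y hy).2])
    ((c1 y hy).mono fun p hp => ?_) ((c2 y hy).mono fun p hp => ?_) (o1 y hy) (o2 y hy)
  · have d1 : fderiv ℝ (fun z => (v, ζ z)) (x, y) = (0 : P × E →L[ℝ] P).prod (fderiv ℝ ζ (x, y)) :=
      ((hasFDerivAt_const v _).prodMk (s1 y hy).differentiableAt.hasFDerivAt).fderiv
    have d2 : fderiv ℝ (fun z => (v', η z)) (x, y)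
        = (0 : P × E →L[ℝ] P).prod (fderiv ℝ η (x, y)) :=
      ((hasFDerivAt_const v' _).prodMk (s2 y hy).differentiableAt.hasFDerivAt).fderiv
    rw [d1, d2] at key
    have e1 : ((0 : P), leadComm v ζ v' η (x, y))
        = (0 : P × E →L[ℝ] P).prod (fderiv ℝ ζ (x, y)) (v', η (x, y))
          - (0 : P × E →L[ℝ] P).prod (fderiv ℝ η (x, y)) (v, ζ (x, y)) := by
      simp [leadComm]
    rw [e1]
    refine key.congr_eventually fun t => ?_
    -- The intermediate base points are the vertices of a parallelogram; these identities match the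
    -- two ways of writing them.
    have w1 : ∀ w : P, x + t • (-u + w) = x + t • w + t • -u := fun w => by
      rw [smul_add]; abel
    have w2 : x + t • (u' + (-u + -u')) = x + t • -u' + t • -u + t • u' := by
      simp only [smul_add]; abel
    have w3 : x + t • (0 : P) = x + t • -u' + t • -u + t • u' + t • u := by
      simp only [smul_neg, smul_zero]; abel
    simp only [Finsler.stateMap, composeFamily, w1, w2, w3]
  · refine Prod.ext ?_ hp
    simp only [Finsler.stateMap, smul_neg]
    abel
  · refine Prod.ext ?_ hp
    simp only [Finsler.stateMap, smul_neg]
    abel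

end LeadFamily

/-! ### The module generated by leading coefficients of loop families. -/

section LeadSpan

variable {P E : Type} [NormedAddCommGroup P] [NormedSpace ℝ P] [CompleteSpace P]
  [NormedAddCommGroup E] [NormedSpace ℝ E] [CompleteSpace E]

/-- The span, over the smooth functions on the base, of the leading coefficients of families of
admissible self-maps of the fibres over a neighbourhood of `x₀`. -/
inductive LeadSpan (Adm : P → P → (E → E) → Prop) (x₀ : P) : (P × E → E) → Prop
  | lead {k : ℕ} {ζ Φ Ψ} : LeadFamily Adm x₀ 0 0 k ζ Φ Ψ → LeadSpan Adm x₀ ζ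
  | zero : LeadSpan Adm x₀ 0
  | add {ζ η} : LeadSpan Adm x₀ ζ → LeadSpan Adm x₀ η → LeadSpan Adm x₀ fun z => ζ z + η z
  | smul {c : P → ℝ} {ζ} : SmoothNear c x₀ → LeadSpan Adm x₀ ζ →
      LeadSpan Adm x₀ fun z => c z.1 • ζ z
  | congr {ζ η} : LeadSpan Adm x₀ ζ → (∀ᶠ x in 𝓝 x₀, ∀ y, y ≠ 0 → η (x, y) = ζ (x, y)) →
      LeadSpan Adm x₀ η

variable {Adm : P → P → (E → E) → Prop} {x₀ v v' u' : P} {ζ η : P × E → E}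

theorem SmoothNear.fst_smul {c : P → ℝ} {z : P × E} (hc : SmoothNear c z.1) (hζ : SmoothNear ζ z) :
    SmoothNear (fun z => c z.1 • ζ z) z := by
  filter_upwards [SmoothNear.comp (g := c) (f := Prod.fst) hc
    (smoothNear_of_contDiff contDiff_fst z), hζ] with z' h1 h2 using h1.smul h2

theorem LeadSpan.smooth (h : LeadSpan Adm x₀ ζ) :
    ∀ᶠ x in 𝓝 x₀, ∀ y, y ≠ 0 → SmoothNear ζ (x, y) := by
  induction h with
  | lead h => exact h.smooth_lead
  | zero => exact Eventually.of_forall fun x y _ => smoothNear_of_contDiff contDiff_const _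
  | add _ _ h1 h2 =>
    filter_upwards [h1, h2] with x a1 a2 y hy
    filter_upwards [a1 y hy, a2 y hy] with z b1 b2 using b1.add b2
  | smul hc _ h =>
    filter_upwards [hc.eventually, h] with x a1 a2 y hy using
      SmoothNear.fst_smul (z := (x, y)) a1 (a2 y hy)
  | @congr ζ η _ he h =>
    filter_upwards [h, eventually_ne_zero_fibre (Q := fun x y => η (x, y) = ζ (x, y)) he]
      with x a1 a2 y hy using (a1 y hy).congr (a2 y hy)

theorem LeadSpan.neg (h : LeadSpan Adm x₀ ζ) : LeadSpan Adm x₀ fun z => -ζ z :=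
  (h.smul (c := fun _ => -1) (smoothNear_of_contDiff contDiff_const _)).congr
    (Eventually.of_forall fun x y _ => by simp)

theorem LeadSpan.sum {ι : Type*} (s : Finset ι) {ζ : ι → P × E → E}
    (h : ∀ i ∈ s, LeadSpan Adm x₀ (ζ i)) : LeadSpan Adm x₀ fun z => ∑ i ∈ s, ζ i z := by
  classical
  induction s using Finset.induction_on with
  | empty => exact LeadSpan.zero.congr (Eventually.of_forall fun x y _ => by simp)
  | insert i s hi ih =>
    exact ((h i (Finset.mem_insert_self i s)).add
      (ih fun j hj => h j (Finset.mem_insert_of_mem hj))).congr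
      (Eventually.of_forall fun x y _ => by rw [Finset.sum_insert hi])

/-- Induction on ζ by the Leibniz rule. A factor c(x) passes through the vertical derivative of η,
and differentiating it along (v', η) yields (Dc·v') ζ, which is again in the module. This is why the
coefficients may depend on x but not on y. -/
theorem LeadSpan.comm_of_lead (hζ : LeadSpan Adm x₀ ζ)
    (hlead : ∀ (k : ℕ) (ζ : P × E → E) (Φ Ψ : ℝ × (P × E) → E),
      LeadFamily Adm x₀ 0 0 k ζ Φ Ψ → LeadSpan Adm x₀ (leadComm 0 ζ v' η)) :
    LeadSpan Adm x₀ (leadComm 0 ζ v' η) := by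
  induction hζ with
  | lead h => exact hlead _ _ _ _ h
  | zero =>
    refine LeadSpan.zero.congr (Eventually.of_forall fun x y _ => ?_)
    simp only [leadComm, Pi.zero_apply, Pi.zero_def, fderiv_fun_const, zero_apply, zero_sub]
    exact neg_eq_zero.mpr (map_zero (fderiv ℝ η (x, y)))
  | add h1 h2 i1 i2 =>
    refine (i1.add i2).congr ?_
    filter_upwards [h1.smooth, h2.smooth] with x a1 a2 y hy
    have e1 := ((a1 y hy).differentiableAt.hasFDerivAt.add
      (a2 y hy).differentiableAt.hasFDerivAt).fderiv
    have e2 : ∀ a b : E, fderiv ℝ η (x, y) (0, a + b)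
        = fderiv ℝ η (x, y) (0, a) + fderiv ℝ η (x, y) (0, b) := fun a b => by
      rw [← map_add]; simp
    simp only [leadComm]
    erw [e1, e2]
    simp only [add_apply]
    abel
  | @smul c ζ hc h i =>
    have hdc : SmoothNear (fun x => fderiv ℝ c x v') x₀ := by
      filter_upwards [hc.fderiv] with x hx using hx.clm_apply contDiffAt_const
    refine ((i.smul hc).add (h.smul hdc)).congr ?_
    filter_upwards [hc.eventually, h.smooth] with x a1 a2 y hy
    have d1 : HasFDerivAt (fun z : P × E => c z.1) ((fderiv ℝ c x).comp (.fst ℝ P E)) (x, y) :=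
      a1.differentiableAt.hasFDerivAt.comp (x, y) hasFDerivAt_fst
    have e1 := (d1.smul (a2 y hy).differentiableAt.hasFDerivAt).fderiv
    have e2 : ∀ a : E, fderiv ℝ η (x, y) (0, c x • a) = c x • fderiv ℝ η (x, y) (0, a) :=
      fun a => by rw [← map_smul]; simp
    simp only [leadComm]
    erw [e1]
    rw [e2]
    simp only [add_apply, smul_apply, ContinuousLinearMap.smulRight_apply,
      ContinuousLinearMap.comp_apply, ContinuousLinearMap.coe_fst', smul_sub]
    abel
  | @congr ζ ζ' h he i =>
    refine i.congr ?_
    filter_upwards [eventually_ne_zero_fibre (Q := fun x y => ζ' (x, y) = ζ (x, y)) he]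
      with x a y hy
    have e : ζ' =ᶠ[𝓝 (x, y)] ζ := a y hy
    simp only [leadComm, e.fderiv_eq, e.eq_of_nhds]

theorem LeadSpan.comm_lead {u' : P} {l : ℕ} {Φ Ψ : ℝ × (P × E) → E} (hA : IsTransportLaw Adm x₀)
    (hζ : LeadSpan Adm x₀ ζ) (hη : LeadFamily Adm x₀ u' v' l η Φ Ψ) :
    LeadSpan Adm x₀ (leadComm 0 ζ v' η) :=
  hζ.comm_of_lead fun _ _ _ _ h => by
    obtain ⟨_, _, h'⟩ := h.comm hA hη
    exact .lead h'

/-- The first argument is reduced to a leading coefficient; antisymmetry then exchanges the roles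
and `LeadSpan.comm_lead` reduces the second. -/
theorem LeadSpan.comm (hA : IsTransportLaw Adm x₀) (hζ : LeadSpan Adm x₀ ζ)
    (hη : LeadSpan Adm x₀ η) : LeadSpan Adm x₀ (leadComm 0 ζ 0 η) :=
  hζ.comm_of_lead fun _ _ _ _ h =>
    (hη.comm_lead hA h).neg.congr (Eventually.of_forall fun x y _ => by simp [leadComm])

end LeadSpan

/-! ### C¹ families of self-maps of one fibre with prescribed velocity. -/

section OneParameterFamily

variable {P E : Type} [NormedAddCommGroup P] [NormedSpace ℝ P]
  [NormedAddCommGroup E] [NormedSpace ℝ E]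

/-- A `C¹` family of admissible self-maps of the fibre over `x₀` that starts at the identity with
velocity `f`. -/
structure OneParameterFamily (Adm : P → P → (E → E) → Prop) (x₀ : P) (f : E → E) (φ : ℝ × E → E) :
    Prop where
  smooth : ∀ᶠ t in 𝓝 (0 : ℝ), ∀ y, y ≠ 0 → ContDiffAt ℝ 1 φ (t, y)
  adm : ∀ᶠ t in 𝓝 (0 : ℝ), Adm x₀ x₀ fun y => φ (t, y)
  zero : ∀ y, y ≠ 0 → φ (0, y) = y
  deriv : ∀ y, y ≠ 0 → HasDerivAt (fun t => φ (t, y)) (f y) 0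

variable {Adm : P → P → (E → E) → Prop} {x₀ : P} {f g : E → E} {φ ψ : ℝ × E → E}

/-- Since φ(0, ·) is the identity, its derivative in y at t = 0 is the identity too, and the chain
rule adds the two velocities. -/
theorem OneParameterFamily.comp (hA : IsTransportLaw Adm x₀) (hφ : OneParameterFamily Adm x₀ f φ)
    (hψ : OneParameterFamily Adm x₀ g ψ) :
    OneParameterFamily Adm x₀ (fun y => f y + g y) fun p => φ (p.1, ψ p) where
  smooth := by
    filter_upwards [hφ.smooth, hψ.smooth, hψ.adm] with t h1 h2 h3 y hy
    exact ContDiffAt.comp (t, y) (f := fun p : ℝ × E => (p.1, ψ p)) (h1 _ (hA.ne_zero h3 hy))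
      (contDiffAt_fst.prodMk (h2 y hy))
  adm := by
    filter_upwards [hφ.adm, hψ.adm] with t h1 h2 using hA.comp h1 h2
  zero y hy := by rw [hψ.zero y hy, hφ.zero y hy]
  deriv y hy := by
    have hd : HasFDerivAt φ (fderiv ℝ φ (0, y)) (0, y) :=
      ((hφ.smooth.self_of_nhds y hy).differentiableAt one_ne_zero).hasFDerivAt
    have e1 : fderiv ℝ φ (0, y) (1, 0) = f y := by
      have h1 : HasDerivAt (fun t : ℝ => (t, y)) ((1 : ℝ), (0 : E)) 0 :=
        (hasDerivAt_id (0 : ℝ)).prodMk (hasDerivAt_const 0 y)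
      exact (hd.comp_hasDerivAt (0 : ℝ) h1).unique (hφ.deriv y hy)
    have e2 : ∀ w, fderiv ℝ φ (0, y) (0, w) = w := fun w => by
      rw [← fderiv_partial_snd hd.differentiableAt]
      have h1 : (fun y' => φ (0, y')) =ᶠ[𝓝 y] id := by
        filter_upwards [isOpen_ne.mem_nhds hy] with y' hy' using hφ.zero y' hy'
      rw [h1.fderiv_eq]
      simp
    have h2 : HasDerivAt (fun t : ℝ => (t, ψ (t, y))) ((1 : ℝ), g y) 0 :=
      (hasDerivAt_id (0 : ℝ)).prodMk (hψ.deriv y hy)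
    have hd' : HasFDerivAt φ (fderiv ℝ φ (0, y)) (0, ψ (0, y)) := by rwa [hψ.zero y hy]
    refine (hd'.comp_hasDerivAt (0 : ℝ) h2).congr_deriv ?_
    have e3 : ((1 : ℝ), g y) = (1, 0) + (0, g y) := by simp
    rw [e3, map_add, e1, e2]

theorem OneParameterFamily.rescale (hφ : OneParameterFamily Adm x₀ f φ) (r : ℝ) :
    OneParameterFamily Adm x₀ (fun y => r • f y) fun p => φ (r * p.1, p.2) := by
  have ht : Tendsto (fun t : ℝ => r * t) (𝓝 0) (𝓝 0) := by
    have : Continuous fun t : ℝ => r * t := by fun_prop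
    simpa using this.tendsto 0
  refine ⟨?_, ht.eventually hφ.adm, fun y hy => by rw [mul_zero]; exact hφ.zero y hy, fun y hy => ?_⟩
  · filter_upwards [ht.eventually hφ.smooth] with t h1 y hy
    exact ContDiffAt.comp (t, y) (f := fun p : ℝ × E => (r * p.1, p.2)) (h1 y hy) (by fun_prop)
  · have h1 : HasDerivAt (fun t : ℝ => r * t) r 0 := by
      simpa using (hasDerivAt_id (0 : ℝ)).const_mul r
    have h2 : HasDerivAt (fun t => φ (t, y)) (f y) (r * 0) := by rw [mul_zero]; exact hφ.deriv y hy
    exact HasDerivAt.scomp (g₁ := fun t => φ (t, y)) 0 h2 h1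

variable [CompleteSpace P] [CompleteSpace E]

/-- The family and its inverse, restricted to the fibre over `x₀`, have opposite coefficients of the
same order. They are the two halves of one C¹ family in the parameter ±tᵏ. -/
theorem LeadFamily.oneParameterFamily {k : ℕ} {ζ : P × E → E} {Φ Ψ : ℝ × (P × E) → E}
    (h : LeadFamily Adm x₀ 0 0 k ζ Φ Ψ) :
    OneParameterFamily Adm x₀ (fun y => ζ (x₀, y))
      (rootFamily (fun p => Φ (p.1, (x₀, p.2))) (fun p => Ψ (p.1, (x₀, p.2))) k) := by
  set Φ' : ℝ × E → E := fun p => Φ (p.1, (x₀, p.2)) with hΦ'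
  set Ψ' : ℝ × E → E := fun p => Ψ (p.1, (x₀, p.2)) with hΨ'
  have hslice : Tendsto (fun t : ℝ => (t, x₀)) (𝓝 0) (𝓝 (0, x₀)) :=
    (Continuous.prodMk_left x₀).tendsto 0
  have hroot : Tendsto (absRoot k) (𝓝 0) (𝓝 0) := by
    have := (continuous_absRoot (k := k)).tendsto 0
    rwa [absRoot_zero h.pos] at this
  have hι : ContDiff ℝ ∞ fun p : ℝ × E => (p.1, (x₀, p.2)) := by fun_prop
  have sΦ : ∀ y, y ≠ 0 → SmoothNear Φ' (0, y) := fun y hy =>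
    SmoothNear.comp (g := Φ) (f := fun p : ℝ × E => (p.1, (x₀, p.2)))
      (h.pair.fwd.smoothNear.self_of_nhds y hy) (smoothNear_of_contDiff hι _)
  have sΨ : ∀ y, y ≠ 0 → SmoothNear Ψ' (0, y) := fun y hy =>
    SmoothNear.comp (g := Ψ) (f := fun p : ℝ × E => (p.1, (x₀, p.2)))
      (h.pair.bwd.smoothNear.self_of_nhds y hy) (smoothNear_of_contDiff hι _)
  have oΦ : ∀ y, y ≠ 0 → HasOrderAt Φ' k (ζ (x₀, y)) y := fun y hy => by
    have h1 := h.order.self_of_nhds y hy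
    exact ((continuous_snd.tendsto _).comp h1)
  have oΦ' : ∀ y, y ≠ 0 → ∀ᶠ y' in 𝓝 y, HasOrderAt Φ' k (ζ (x₀, y')) y' := fun y hy => by
    filter_upwards [isOpen_ne.mem_nhds hy] with y' hy' using oΦ y' hy'
  have h0 : ∀ y, y ≠ 0 → Φ' (0, y) = y ∧ Ψ' (0, y) = y := fun y hy =>
    h.apply_zero.self_of_nhds y hy
  have oΨ : ∀ y, y ≠ 0 → HasOrderAt Ψ' k (-ζ (x₀, y)) y := fun y hy => by
    have c : ∀ᶠ p in 𝓝 ((0 : ℝ), y), Φ' (p.1, Ψ' p) = p.2 := by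
      have c1 := hslice.eventually h.pair.fwd_bwd
      filter_upwards [continuousAt_fst.eventually c1,
        continuousAt_snd.eventually (isOpen_ne.mem_nhds hy)] with p h1 h2
      have := h1 p.2 h2
      simpa [composeFamily] using this
    exact HasOrderAt.inverse (α := fun y => ζ (x₀, y)) (sΦ y hy) (sΨ y hy).continuousAt (h0 y hy).2 c
      (oΦ' y hy)
  have oΨ' : ∀ y, y ≠ 0 → ∀ᶠ y' in 𝓝 y, HasOrderAt Ψ' k (-ζ (x₀, y')) y' := fun y hy => by
    filter_upwards [isOpen_ne.mem_nhds hy] with y' hy' using oΨ y' hy'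
  have key := fun y (hy : y ≠ 0) => contDiffAt_rootFamily (ζ := fun y => ζ (x₀, y)) h.pos (sΦ y hy)
    (sΨ y hy) (oΦ' y hy) (oΨ' y hy)
  refine ⟨?_, ?_, fun y hy => ?_, fun y hy => (key y hy).2⟩
  · filter_upwards [hroot.eventually (hslice.eventually h.pair.fwd.smooth),
      hroot.eventually (hslice.eventually h.pair.bwd.smooth)] with t h1 h2 y hy
    rcases eq_or_ne t 0 with rfl | ht
    · exact (key y hy).1
    · refine (contDiffAt_rootFamily_of_ne (p := (t, y)) ht ?_ ?_).of_le (by simp)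
      · exact ContDiffAt.comp (absRoot k t, y) (f := fun p : ℝ × E => (p.1, (x₀, p.2)))
          (h1 y hy) hι.contDiffAt
      · exact ContDiffAt.comp (absRoot k t, y) (f := fun p : ℝ × E => (p.1, (x₀, p.2)))
          (h2 y hy) hι.contDiffAt
  · filter_upwards [hroot.eventually (hslice.eventually h.pair.fwd.adm),
      hroot.eventually (hslice.eventually h.pair.bwd.adm)] with t h1 h2
    simp only [neg_zero, smul_zero, add_zero] at h1 h2
    by_cases ht : 0 ≤ t
    · simpa only [rootFamily, ht, if_true] using h1
    · simpa only [rootFamily, ht, if_false] using h2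
  · simp only [rootFamily, le_refl, if_true, absRoot_zero h.pos]
    exact (h0 y hy).1

/-- On a single fibre the smooth coefficients become real numbers c(x₀), so compositions and linear
changes of the parameter realize every combination. Leading coefficients of different orders can be
added because each has first been brought to order one. -/
theorem LeadSpan.exists_oneParameterFamily {ζ : P × E → E} (hA : IsTransportLaw Adm x₀)
    (h : LeadSpan Adm x₀ ζ) : ∃ φ, OneParameterFamily Adm x₀ (fun y => ζ (x₀, y)) φ := by
  induction h with
  | lead h => exact ⟨_, h.oneParameterFamily⟩
  | zero =>
    exact ⟨Prod.snd, Eventually.of_forall fun t y _ => contDiffAt_snd,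
      Eventually.of_forall fun t => hA.id.self_of_nhds, fun y _ => rfl,
      fun y _ => hasDerivAt_const _ _⟩
  | add _ _ h1 h2 =>
    obtain ⟨φ, hφ⟩ := h1
    obtain ⟨ψ, hψ⟩ := h2
    exact ⟨_, hφ.comp hA hψ⟩
  | @smul c _ _ _ h =>
    obtain ⟨φ, hφ⟩ := h
    exact ⟨_, hφ.rescale (c x₀)⟩
  | congr _ he h =>
    obtain ⟨φ, hφ⟩ := h
    exact ⟨φ, hφ.smooth, hφ.adm, hφ.zero, fun y hy => by
      rw [he.self_of_nhds y hy]; exact hφ.deriv y hy⟩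

end OneParameterFamily

/-! ### Curvature and Berwald derivatives as leading coefficients. -/

section ChartSpan

variable {n : ℕ} {M : Type*} [TopologicalSpace M] [ChartedSpace (Coord n) M]
  [IsManifold (𝓡 n) ∞ M] {F : FinslerFunction n M} {x₀ : M} {x : Coord n}

theorem isTransportLaw_chartTranslation (hx : x ∈ chartRan n x₀) :
    IsTransportLaw (ChartTranslation F x₀) x where
  comp hg hf := hg.comp hf
  ne_zero hf hy := hf.ne_zero hy
  id := by
    filter_upwards [(isOpen_chartRan x₀).mem_nhds hx] with x' hx' using chartTranslation_id hx'

variable (F) in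
/-- Parallel translation from `x` to `x + t u` along the coordinate segment. -/
def segmentFamily (x₀ : M) (u : Coord n) (p : ℝ × (Coord n × Coord n)) : Coord n :=
  segmentTransport F x₀ ((p.2.1, p.1 • u), p.2.2)

theorem eventually_segment {Q : Coord n × Coord n → Prop} (u : Coord n)
    (h : ∀ᶠ z in 𝓝 (x, (0 : Coord n)), Q z) :
    ∀ᶠ q in 𝓝 ((0 : ℝ), x), Q (q.2, q.1 • u) := by
  have h1 : Continuous fun q : ℝ × Coord n => (q.2, q.1 • u) := by fun_prop
  have h2 := h1.tendsto ((0 : ℝ), x)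
  simp only [zero_smul] at h2
  exact h2.eventually h

theorem smoothFamily_segmentFamily (hx : x ∈ chartRan n x₀) (u : Coord n) :
    SmoothFamily (ChartTranslation F x₀) x u (segmentFamily F x₀ u) where
  smooth := by
    filter_upwards [eventually_segment u (eventually_forall_segmentTransport F hx)] with q hq y hy
    exact ContDiffAt.comp (q.1, (q.2, y))
      (f := fun p : ℝ × (Coord n × Coord n) => ((p.2.1, p.1 • u), p.2.2)) (hq y hy).2 (by fun_prop)
  adm := by
    have hR : ∀ᶠ q in 𝓝 ((0 : ℝ), x), q.2 ∈ chartRan n x₀ :=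
      continuousAt_snd.eventually ((isOpen_chartRan x₀).mem_nhds hx)
    have h1 := eventually_segment u (eventually_forall_segmentTransport F hx)
    have h2 := eventually_shift (Q := fun q => ∀ y : Coord n, y ≠ 0 →
      (∃ γ, SegmentParallel F x₀ q.2 (q.1 • -u) γ ∧ γ 0 = y) ∧
        ContDiffAt ℝ ∞ (segmentTransport F x₀) ((q.2, q.1 • -u), y)) u
      (eventually_segment (-u) (eventually_forall_segmentTransport F hx))
    filter_upwards [h1, h2, hR, eventually_shift u hR] with q a1 a2 a3 a4
    exact chartTranslation_segment (fun y hy => (a1 y hy).1)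
      (fun y hy => by rw [← smul_neg]; exact (a2 y hy).1) a3 a4

theorem composeFamily_segmentFamily (hx : x ∈ chartRan n x₀) (u : Coord n) :
    ∀ᶠ q in 𝓝 ((0 : ℝ), x), ∀ y, y ≠ 0 →
      composeFamily u (segmentFamily F x₀ (-u)) (segmentFamily F x₀ u) (q.1, (q.2, y)) = y := by
  filter_upwards [eventually_segment u (eventually_forall_segmentTransport F hx)] with q hq y hy
  obtain ⟨⟨γ, hγ, rfl⟩, -⟩ := hq y hy
  have := hγ.reverse_transport
  simpa only [composeFamily, segmentFamily, smul_neg] using this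

/-- The basic family: segment translation in the direction u is of order 1 and its coefficient is
the horizontal lift of u. All others arise from it by commutators. -/
theorem leadFamily_segmentFamily (hx : x ∈ chartRan n x₀) (u : Coord n) :
    LeadFamily (ChartTranslation F x₀) x u u 1 (fun z => -connMap (F.inChart x₀) z u)
      (segmentFamily F x₀ u) (segmentFamily F x₀ (-u)) where
  pair :=
    { fwd := smoothFamily_segmentFamily hx u
      bwd := smoothFamily_segmentFamily hx (-u)
      fwd_bwd := by
        have := composeFamily_segmentFamily (F := F) hx (-u)
        rwa [neg_neg] at this
      bwd_fwd := composeFamily_segmentFamily hx u }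
  pos := le_rfl
  order := by
    filter_upwards [(isOpen_chartRan x₀).mem_nhds hx] with x' hx' y hy
    have h1 := hasDerivAt_segmentTransport F hx' hy u
    have h2 : HasDerivAt (fun t : ℝ => x' + t • u) u 0 := by
      simpa using (((hasDerivAt_id (0 : ℝ)).smul_const u).const_add x')
    have h3 := hasDerivAt_iff_tendsto_slope_zero.mp (h2.prodMk h1)
    simp only [zero_add, zero_smul, add_zero, segmentTransport_zero] at h3
    simpa only [HasOrderAt, pow_one, stateMap, segmentFamily, connMap] using h3

/-- The bracket of a vertical coefficient with a horizontal lift is the Berwald derivative;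
geometrically, loops are conjugated along a segment and compared with loops at the end point. -/
theorem LeadSpan.berwald_const {ζ : Coord n × Coord n → Coord n} (hx : x ∈ chartRan n x₀)
    (h : LeadSpan (ChartTranslation F x₀) x ζ) (u : Coord n) :
    LeadSpan (ChartTranslation F x₀) x
      fun z => berwald (F.inChart x₀) (fun x y => ζ (x, y)) z.1 z.2 u := by
  refine (h.comm_lead (isTransportLaw_chartTranslation hx) (leadFamily_segmentFamily hx u)).congr ?_
  filter_upwards [h.smooth, (isOpen_chartRan x₀).mem_nhds hx] with x' h1 hx' y hy
  have hL := finslerNear_inChart F hx'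
  have hC := (hL.smooth_conn hy).differentiableAt
  rw [hL.berwald_eq hy (h1 y hy).differentiableAt, leadComm, fderiv_fun_neg, neg_apply,
    fderiv_apply_const hC, sub_neg_eq_add]
  rfl

/-- Infinitesimal parallelograms. The segment in the direction `w` comes first in the commutator,
which gives the curvature with the right sign. -/
theorem leadSpan_curv_const (hx : x ∈ chartRan n x₀) (u w : Coord n) :
    LeadSpan (ChartTranslation F x₀) x fun z => curv (F.inChart x₀) z.1 z.2 u w := by
  obtain ⟨Φ, Ψ, h⟩ := (leadFamily_segmentFamily (F := F) hx w).comm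
    (isTransportLaw_chartTranslation hx) (leadFamily_segmentFamily hx u)
  refine (LeadSpan.lead h).congr ?_
  filter_upwards [(isOpen_chartRan x₀).mem_nhds hx] with x' hx' y hy
  have hL := finslerNear_inChart F hx'
  have hC := (hL.smooth_conn hy).differentiableAt
  rw [hL.curv_eq hy, leadComm, fderiv_fun_neg, fderiv_fun_neg, neg_apply, neg_apply,
    fderiv_apply_const hC, fderiv_apply_const hC]
  simp only [connMap]
  abel

theorem sum_smul_basisVec (u : Coord n) : ∑ i, u i • basisVec i = u := by
  simpa [basisVec] using (EuclideanSpace.basisFun (Fin n) ℝ).sum_repr u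

theorem SmoothNear.coord {X : Coord n → Coord n} (hX : SmoothNear X x) (i : Fin n) :
    SmoothNear (fun x => X x i) x :=
  SmoothNear.comp (g := fun v : Coord n => v i) (smoothNear_of_contDiff (by fun_prop) _) hX

/-- The field X is expanded as Xⁱ ∂/∂xⁱ; the smooth coefficients Xⁱ(x) are the reason for taking the
span over functions of the base point. -/
theorem LeadSpan.of_linear {X : Coord n → Coord n} (hX : SmoothNear X x)
    {T : Coord n × Coord n → Coord n → Coord n}
    (hT : ∀ u, LeadSpan (ChartTranslation F x₀) x fun z => T z u)
    (hlin : ∀ᶠ x' in 𝓝 x, ∀ y, y ≠ 0 → ∃ l : Coord n →L[ℝ] Coord n, ∀ u, T (x', y) u = l u) :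
    LeadSpan (ChartTranslation F x₀) x fun z => T z (X z.1) := by
  refine (LeadSpan.sum Finset.univ fun i _ => (hT (basisVec i)).smul (hX.coord i)).congr ?_
  filter_upwards [hlin] with x' h1 y hy
  obtain ⟨l, hl⟩ := h1 y hy
  simp only [hl]
  conv_lhs => rw [← sum_smul_basisVec (X x'), map_sum]
  simp only [map_smul]

theorem LeadSpan.berwald {ζ : Coord n × Coord n → Coord n} (hx : x ∈ chartRan n x₀)
    (h : LeadSpan (ChartTranslation F x₀) x ζ) {X : Coord n → Coord n} (hX : SmoothNear X x) :
    LeadSpan (ChartTranslation F x₀) x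
      fun z => Finsler.berwald (F.inChart x₀) (fun x y => ζ (x, y)) z.1 z.2 (X z.1) := by
  refine LeadSpan.of_linear hX (h.berwald_const hx) ?_
  filter_upwards [h.smooth, (isOpen_chartRan x₀).mem_nhds hx] with x' h1 hx' y hy
  refine ⟨(fderiv ℝ ζ (x', y)).comp ((ContinuousLinearMap.id ℝ _).prod
    (-conn (F.inChart x₀) x' y)) + fderiv ℝ (connMap (F.inChart x₀)) (x', y) (0, ζ (x', y)),
    fun u => ?_⟩
  exact (finslerNear_inChart F hx').berwald_eq hy (h1 y hy).differentiableAt u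

theorem exists_linear_curv (hx : x ∈ chartRan n x₀) {y : Coord n} (hy : y ≠ 0) (w : Coord n) :
    ∃ l : Coord n →L[ℝ] Coord n, ∀ u, curv (F.inChart x₀) x y u w = l u := by
  refine ⟨fderiv ℝ (connMap (F.inChart x₀)) (x, y) (w, -conn (F.inChart x₀) x y w)
    - ((fderiv ℝ (connMap (F.inChart x₀)) (x, y)).comp ((ContinuousLinearMap.id ℝ _).prod
      (-conn (F.inChart x₀) x y))).flip w, fun u => ?_⟩
  exact (finslerNear_inChart F hx).curv_eq hy u w

theorem leadSpan_curv (hx : x ∈ chartRan n x₀) {X Y : Coord n → Coord n} (hX : SmoothNear X x)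
    (hY : SmoothNear Y x) : LeadSpan (ChartTranslation F x₀) x
      fun z => curv (F.inChart x₀) z.1 z.2 (X z.1) (Y z.1) := by
  refine LeadSpan.of_linear (T := fun z w => curv (F.inChart x₀) z.1 z.2 (X z.1) w) hY (fun w => ?_)
    ?_
  · refine LeadSpan.of_linear (T := fun z u => curv (F.inChart x₀) z.1 z.2 u w) hX
      (fun u => leadSpan_curv_const hx u w) ?_
    filter_upwards [(isOpen_chartRan x₀).mem_nhds hx] with x' hx' y hy
      using exists_linear_curv hx' hy w
  · filter_upwards [(isOpen_chartRan x₀).mem_nhds hx] with x' hx' y hy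
    obtain ⟨l, hl⟩ := exists_linear_curv (F := F) hx' hy (X x')
    refine ⟨-l, fun w => ?_⟩
    rw [neg_apply, ← hl, (finslerNear_inChart F hx').curv_eq hy,
      (finslerNear_inChart F hx').curv_eq hy, neg_sub]

end ChartSpan

/-! ### Vertical fields in charts -/

section VerticalField

variable {n : ℕ} {M : Type*} [TopologicalSpace M] [ChartedSpace (Coord n) M]
  [IsManifold (𝓡 n) ∞ M] {F : FinslerFunction n M} {x₀ : M} {x : Coord n}

theorem homExt_smul {p : M} (f : Indicatrix F p → Coord n) {r : ℝ} (hr : 0 < r) (y : Coord n) :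
    homExt F f (r • y) = r • homExt F f y := by
  by_cases hy : y = 0
  · simp [homExt, hy]
  · have hry := smul_ne_zero hr.ne' hy
    have hn : normalize F p (r • y) hry = normalize F p y hy := by
      apply Subtype.ext
      change (F.fib p (r • y))⁻¹ • r • y = (F.fib p y)⁻¹ • y
      rw [fib_smul F p hr, mul_inv, smul_smul, mul_assoc, mul_comm, mul_assoc, mul_inv_cancel₀ hr.ne',
        mul_one]
    rw [homExt_of_ne F f hry, homExt_of_ne F f hy, hn, fib_smul F p hr, mul_smul]

theorem homExt_add {p : M} (f g : Indicatrix F p → Coord n) (y : Coord n) :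
    homExt F (f + g) y = homExt F f y + homExt F g y := by
  by_cases hy : y = 0
  · simp [homExt, hy]
  · simp [homExt, hy]

theorem homExt_const_smul {p : M} (r : ℝ) (f : Indicatrix F p → Coord n) (y : Coord n) :
    homExt F (r • f) y = r • homExt F f y := by
  by_cases hy : y = 0
  · simp [homExt, hy]
  · simp [homExt, hy, smul_comm r]

theorem homExt_zero {p : M} (y : Coord n) : homExt F (0 : Indicatrix F p → Coord n) y = 0 := by
  simp [homExt]

theorem homExt_restrict {p : M} {g : Coord n → Coord n}
    (hg : ∀ (r : ℝ) (y : Coord n), 0 < r → y ≠ 0 → g (r • y) = r • g y) {y : Coord n} (hy : y ≠ 0) :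
    homExt F (fun u : Indicatrix F p => g u.1) y = g y := by
  have h := fib_pos F p hy
  rw [homExt_of_ne F _ hy]
  change F.fib p y • g ((F.fib p y)⁻¹ • y) = g y
  rw [hg _ _ (inv_pos.mpr h) hy, smul_smul, mul_inv_cancel₀ h.ne', one_smul]

theorem homExt_apply {p : M} (f : Indicatrix F p → Coord n) (u : Indicatrix F p) :
    homExt F f u.1 = f u := by
  have hn : normalize F p u.1 (indicatrix_ne_zero F u) = u := by
    apply Subtype.ext
    change (F.fib p u.1)⁻¹ • u.1 = u.1
    rw [u.2, inv_one, one_smul]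
  rw [homExt_of_ne F f (indicatrix_ne_zero F u), hn, u.2, one_smul]

theorem fderiv_smul_of_homogeneous {f : Coord n → Coord n} {r : ℝ} (hr : 0 < r)
    (hf : ∀ y, f (r • y) = r • f y) (y : Coord n) : fderiv ℝ f (r • y) = fderiv ℝ f y := by
  have h1 := fderiv_comp_smul (𝕜 := ℝ) (f := f) (x := y) r
  have h2 : (fun y => f (r • y)) = r • f := funext hf
  rw [h2, fderiv_const_smul_field] at h1
  exact (smul_right_injective _ hr.ne' h1).symm

/-- The Jacobian of a 1-homogeneous field is 0-homogeneous, so the bracket of two such fields is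
1-homogeneous and is recovered from its values on the indicatrix. -/
theorem homExt_bracket {p : M} (ξ η : Indicatrix F p → Coord n) {y : Coord n} (hy : y ≠ 0) :
    homExt F (bracket F ξ η) y = VectorField.lieBracket ℝ (homExt F ξ) (homExt F η) y := by
  refine homExt_restrict (g := VectorField.lieBracket ℝ (homExt F ξ) (homExt F η))
    (fun r y hr _ => ?_) hy
  simp only [VectorField.lieBracket]
  rw [fderiv_smul_of_homogeneous hr (homExt_smul ξ hr), fderiv_smul_of_homogeneous hr
    (homExt_smul η hr), homExt_smul _ hr, homExt_smul _ hr, map_smul, map_smul, smul_sub]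

theorem lieBracket_conj (A : Coord n ≃L[ℝ] Coord n) (V W : Coord n → Coord n) (y : Coord n) :
    VectorField.lieBracket ℝ (fun y => A (V (A.symm y))) (fun y => A (W (A.symm y))) y
      = A (VectorField.lieBracket ℝ V W (A.symm y)) := by
  have h : ∀ V : Coord n → Coord n, fderiv ℝ (fun y => A (V (A.symm y))) y
      = (A : Coord n →L[ℝ] Coord n).comp ((fderiv ℝ V (A.symm y)).comp
        (A.symm : Coord n →L[ℝ] Coord n)) := fun V => by
    have h1 := A.comp_fderiv (f := V ∘ A.symm) (x := y)
    rw [A.symm.comp_right_fderiv] at h1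
    exact h1
  simp only [VectorField.lieBracket, h]
  simp

theorem fieldInChart_of_pointOf_eq (ξ : VertField F) {w : M} (h : pointOf x₀ x = w) (y : Coord n) :
    fieldInChart F ξ x₀ x y = coordOf x₀ w (homExt F (ξ w) (vecOf x₀ w y)) := by
  subst h
  rfl

theorem fieldInChart_smul (ξ : VertField F) {r : ℝ} (hr : 0 < r) (x y : Coord n) :
    fieldInChart F ξ x₀ x (r • y) = r • fieldInChart F ξ x₀ x y := by
  rw [fieldInChart, vecOf_smul, homExt_smul _ hr, coordOf_smul, fieldInChart]

theorem fieldInChart_bracket (ξ η : VertField F) (hx : x ∈ chartRan n x₀) {y : Coord n}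
    (hy : y ≠ 0) :
    fieldInChart F (fun x => bracket F (ξ x) (η x)) x₀ x y
      = VectorField.lieBracket ℝ (fieldInChart F ξ x₀ x) (fieldInChart F η x₀ x) y := by
  have hz := pointOf_mem hx
  have h1 := lieBracket_conj (vecEquiv hz).symm (homExt F (ξ (pointOf x₀ x)))
    (homExt F (η (pointOf x₀ x))) y
  have h2 := homExt_bracket (ξ (pointOf x₀ x)) (η (pointOf x₀ x)) (vecOf_ne_zero hz hy)
  change coordOf x₀ (pointOf x₀ x) (homExt F (bracket F (ξ (pointOf x₀ x)) (η (pointOf x₀ x)))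
    (vecOf x₀ (pointOf x₀ x) y)) = _
  rw [h2]
  exact h1.symm

/-- The vector field `X` on `M` in the chart around `x₀`. -/
def baseInChart (X : ∀ x : M, TangentSpace (𝓡 n) x) (x₀ : M) (x : Coord n) : Coord n :=
  coordOf x₀ (pointOf x₀ x) (X (pointOf x₀ x))

theorem smoothNear_baseInChart {X : ∀ x : M, TangentSpace (𝓡 n) x} (hX : IsSmoothOnBase X)
    (hx : x ∈ chartRan n x₀) : SmoothNear (baseInChart X x₀) x := by
  filter_upwards [(isOpen_chartRan x₀).mem_nhds hx] with x' hx'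
  have hmem : pointOf x₀ x' ∈ (trivializationAt (Coord n) (TangentSpace (𝓡 n)) x₀).baseSet := by
    have := pointOf_mem hx'
    rw [chartDom, extChartAt_source] at this
    simpa using this
  have h1 : ContMDiffAt (𝓡 n) 𝓘(ℝ, Coord n) ∞ (fun z => coordOf x₀ z (X z)) (pointOf x₀ x') :=
    ((trivializationAt (Coord n) (TangentSpace (𝓡 n)) x₀).contMDiffAt_section_iff hmem).mp
      (hX (pointOf x₀ x'))
  have h2 : ContMDiffAt 𝓘(ℝ, Coord n) (𝓡 n) ∞ (pointOf (n := n) x₀) x' :=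
    (contMDiffOn_extChartAt_symm (I := 𝓡 n) (n := ∞) x₀).contMDiffAt
      ((isOpen_chartRan x₀).mem_nhds hx')
  exact (h1.comp x' h2).contDiffAt

/-- The fields `curvField` and `covDeriv` are evaluated at z in the chart centred at z. Comparison
with a fixed chart takes place at that centre, where the differential of the chart change is
`coordOf`. -/
theorem chart_center {z : M} (hz : z ∈ chartDom n x₀) :
    IsFinslerChange (chartChange n z x₀) (F.inChart z) (F.inChart x₀) (extChartAt (𝓡 n) z z) ∧
      chartChange n z x₀ (extChartAt (𝓡 n) z z) = extChartAt (𝓡 n) x₀ z ∧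
      ∀ v, fderiv ℝ (chartChange n z x₀) (extChartAt (𝓡 n) z z) v = coordOf x₀ z v := by
  have hd := mem_chartDom_self (n := n) z
  have ha : extChartAt (𝓡 n) z z ∈ chartRan n z := (extChartAt (𝓡 n) z).map_source hd
  have hp : pointOf z (extChartAt (𝓡 n) z z) = z := pointOf_extChartAt hd
  refine ⟨isFinslerChange_chartChange F ha (by rwa [hp]), ?_, fun v => ?_⟩
  · rw [chartChange_apply, hp]
  · have := coordOf_chartChange ha (x₀ := x₀) (by rwa [hp]) v
    rwa [hp, coordOf_self] at this

theorem fieldInChart_curv (X Y : ∀ x : M, TangentSpace (𝓡 n) x) (hx : x ∈ chartRan n x₀)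
    {y : Coord n} (hy : y ≠ 0) :
    fieldInChart F (curvField F X Y) x₀ x y
      = curv (F.inChart x₀) x y (baseInChart X x₀ x) (baseInChart Y x₀ x) := by
  have hz := pointOf_mem hx
  have hv := vecOf_ne_zero hz hy
  obtain ⟨hch, h1, h2⟩ := chart_center (F := F) hz
  set z := pointOf x₀ x with hzdef
  have e1 : homExt F (curvField F X Y z) (vecOf x₀ z y)
      = curv (F.inChart z) (extChartAt (𝓡 n) z z) (vecOf x₀ z y) (X z) (Y z) :=
    homExt_restrict (g := fun y => curv (F.inChart z) (extChartAt (𝓡 n) z z) y (X z) (Y z))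
      (fun r y hr hy => hch.source.curv_smul hy hr _ _) hv
  have h3 := fun u w : Coord n => hch.curv_eq hv u w
  simp only [h2, h1, coordOf_vecOf hz] at h3
  have h4 : extChartAt (𝓡 n) x₀ z = x := extChartAt_pointOf hx
  simp only [h4] at h3
  change coordOf x₀ z (homExt F (curvField F X Y z) (vecOf x₀ z y)) = _
  rw [e1]
  exact h3 (X z) (Y z)

theorem fieldInChart_change (ξ : VertField F) {x₁ : M} (hx : x ∈ chartRan n x₁)
    (h0 : pointOf x₁ x ∈ chartDom n x₀) (y : Coord n) :
    fderiv ℝ (chartChange n x₁ x₀) x (fieldInChart F ξ x₁ x y)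
      = fieldInChart F ξ x₀ (chartChange n x₁ x₀ x) (fderiv ℝ (chartChange n x₁ x₀) x y) := by
  have hp : pointOf x₀ (chartChange n x₁ x₀ x) = pointOf x₁ x := pointOf_extChartAt h0
  rw [fieldInChart_of_pointOf_eq ξ hp, vecOf_chartChange hx h0, fieldInChart,
    coordOf_chartChange hx h0]

/-- Differentiability of ξ is assumed in all charts because the derivative is taken in the chart
around each point z and then transferred to the chart around `x₀`. -/
theorem fieldInChart_covDeriv (X : ∀ x : M, TangentSpace (𝓡 n) x) {ξ : VertField F}
    (hξ : ∀ (x₀ : M) (x : Coord n), x ∈ chartRan n x₀ → ∀ y, y ≠ 0 →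
      DifferentiableAt ℝ (fun p : Coord n × Coord n => fieldInChart F ξ x₀ p.1 p.2) (x, y))
    (hx : x ∈ chartRan n x₀) {y : Coord n} (hy : y ≠ 0) :
    fieldInChart F (covDeriv F X ξ) x₀ x y
      = berwald (F.inChart x₀) (fieldInChart F ξ x₀) x y (baseInChart X x₀ x) := by
  have hz := pointOf_mem hx
  have hv := vecOf_ne_zero hz hy
  obtain ⟨hch, h1, h2⟩ := chart_center (F := F) hz
  set z := pointOf x₀ x with hzdef
  have ha : extChartAt (𝓡 n) z z ∈ chartRan n z :=
    (extChartAt (𝓡 n) z).map_source (mem_chartDom_self (n := n) z)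
  have hp : pointOf z (extChartAt (𝓡 n) z z) = z := pointOf_extChartAt (mem_chartDom_self (n := n) z)
  have h4 : extChartAt (𝓡 n) x₀ z = x := extChartAt_pointOf hx
  have e1 : homExt F (covDeriv F X ξ z) (vecOf x₀ z y)
      = berwald (F.inChart z) (fieldInChart F ξ z) (extChartAt (𝓡 n) z z) (vecOf x₀ z y) (X z) :=
    homExt_restrict
      (g := fun y => berwald (F.inChart z) (fieldInChart F ξ z) (extChartAt (𝓡 n) z z) y (X z))
      (fun r y hr hy => hch.source.berwald_smul hy (fun y hy => hξ z _ ha y hy) hr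
        (fun x y => fieldInChart_smul ξ hr x y) _) hv
  have h3 := fun u : Coord n => hch.berwald_eq hv (ξ := fieldInChart F ξ z) (ξ' := fieldInChart F ξ x₀)
    (hξ z _ ha _ hv) (by rw [h1, h2, h4, coordOf_vecOf hz]; exact hξ x₀ x hx y hy)
    (by
      filter_upwards [continuousAt_fst.eventually (eventually_pointOf_mem ha
        (x₀ := x₀) (by rw [hp]; exact hz))] with p hp'
      exact fieldInChart_change ξ hp'.1 hp'.2 p.2) u
  simp only [h2, h1, coordOf_vecOf hz, h4] at h3
  change coordOf x₀ z (homExt F (covDeriv F X ξ z) (vecOf x₀ z y)) = _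
  rw [e1]
  exact h3 (X z)

/-- Each rule generating the algebra matches a closure property of the span. The statement is made
in all charts simultaneously, since the step for the Berwald derivative uses the induction
hypothesis in charts other than the given one. -/
theorem FibredHolonomyAlgebra.leadSpan {ξ : VertField F} (h : FibredHolonomyAlgebra F ξ) :
    ∀ (x₀ : M) (x : Coord n), x ∈ chartRan n x₀ →
      LeadSpan (ChartTranslation F x₀) x fun z => fieldInChart F ξ x₀ z.1 z.2 := by
  induction h with
  | @curv X Y hX hY =>
    intro x₀ x hx
    refine (leadSpan_curv hx (smoothNear_baseInChart hX hx) (smoothNear_baseInChart hY hx)).congr ?_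
    filter_upwards [(isOpen_chartRan x₀).mem_nhds hx] with x' hx' y hy
      using fieldInChart_curv X Y hx' hy
  | @cov X ξ hX _ ih =>
    intro x₀ x hx
    refine ((ih x₀ x hx).berwald hx (smoothNear_baseInChart hX hx)).congr ?_
    filter_upwards [(isOpen_chartRan x₀).mem_nhds hx] with x' hx' y hy
    exact fieldInChart_covDeriv X (fun x₀ x hx y hy =>
      ((ih x₀ x hx).smooth.self_of_nhds y hy).differentiableAt) hx' hy
  | zero =>
    intro x₀ x hx
    refine LeadSpan.zero.congr (Eventually.of_forall fun x y _ => ?_)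
    have h1 : homExt F ((0 : VertField F) (pointOf x₀ x)) (vecOf x₀ (pointOf x₀ x) y) = 0 :=
      homExt_zero _
    simp only [fieldInChart, h1]
    exact map_zero (tangentCoordChange (𝓡 n) (pointOf x₀ x) x₀ (pointOf x₀ x))
  | @add ξ η _ _ ih1 ih2 =>
    intro x₀ x hx
    refine ((ih1 x₀ x hx).add (ih2 x₀ x hx)).congr (Eventually.of_forall fun x y _ => ?_)
    have h1 : ∀ w v, homExt F ((ξ + η) w) v = homExt F (ξ w) v + homExt F (η w) v := fun w v =>
      homExt_add _ _ v
    simp only [fieldInChart, h1]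
    exact map_add (tangentCoordChange (𝓡 n) (pointOf x₀ x) x₀ (pointOf x₀ x)) _ _
  | @smul r ξ _ ih =>
    intro x₀ x hx
    refine ((ih x₀ x hx).smul (c := fun _ => r) (smoothNear_of_contDiff contDiff_const _)).congr
      (Eventually.of_forall fun x y _ => ?_)
    have h1 : ∀ w v, homExt F ((r • ξ) w) v = r • homExt F (ξ w) v := fun w v =>
      homExt_const_smul r _ v
    simp only [fieldInChart, h1, coordOf_smul]
  | @bracket ξ η _ _ ih1 ih2 =>
    intro x₀ x hx
    -- The order is reversed because `VectorField.lieBracket` of ξ and η is Dη·ξ - Dξ·η, whereas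
    -- `leadComm` differentiates its first field with a plus sign.
    refine ((ih2 x₀ x hx).comm (isTransportLaw_chartTranslation hx) (ih1 x₀ x hx)).congr ?_
    filter_upwards [(isOpen_chartRan x₀).mem_nhds hx, (ih1 x₀ x hx).smooth, (ih2 x₀ x hx).smooth]
      with x' hx' h1 h2 y hy
    rw [fieldInChart_bracket ξ η hx' hy, VectorField.lieBracket, leadComm,
      ← fderiv_partial_snd (h1 y hy).differentiableAt, ← fderiv_partial_snd (h2 y hy).differentiableAt]

end VerticalField

/-! ### The holonomy algebra at a point -/

section Holonomy

variable {n : ℕ} {M : Type*} [TopologicalSpace M] [ChartedSpace (Coord n) M]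
  [IsManifold (𝓡 n) ∞ M] {F : FinslerFunction n M}

variable (F) in
/-- `f` is the homogeneous extension of an element of the holonomy group at `p`. -/
def HolonomyMap (p : M) (_ _ : Coord n) (f : Coord n → Coord n) : Prop :=
  ∃ φ ∈ holPerm F p, ∀ y, y ≠ 0 → f y = homExt F (fun u => (φ u).1) y

/-- Over the single fibre at p the base point is a dummy parameter, so the results on leading
coefficients apply with families constant in x. -/
theorem isTransportLaw_holonomyMap (p : M) (x : Coord n) :
    IsTransportLaw (HolonomyMap F p) x where
  comp := by
    rintro _ _ _ f g ⟨ψ, hψ, hg⟩ ⟨φ, hφ, hf⟩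
    refine ⟨ψ * φ, mul_mem hψ hφ, fun y hy => ?_⟩
    have h1 : f y ≠ 0 := by rw [hf y hy]; exact homExt_ne_zero F φ hy
    have h2 := homExt_comp F ψ φ y
    rw [← hf y hy, ← hg _ h1] at h2
    exact h2.symm
  ne_zero := by
    rintro _ _ f y ⟨φ, -, hf⟩ hy
    rw [hf y hy]
    exact homExt_ne_zero F φ hy
  id := Eventually.of_forall fun _ => ⟨1, one_mem _, fun _ _ => (homExt_id F).symm⟩

/-- The point of M with the coordinates of q equals q only propositionally. The statement is
generalized to a point `w` with `w = q` so that the equality can be eliminated in the types. -/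
theorem ChartTranslation.at_center {q : M} {f : Coord n → Coord n}
    (h : ChartTranslation F q (extChartAt (𝓡 n) q q) (extChartAt (𝓡 n) q q) f) :
    ∃ φ : Equiv.Perm (Indicatrix F q), IsPiecewiseTranslation F q q φ ∧
      ∀ y, y ≠ 0 → f y = homExt F (fun u => (φ u).1) y := by
  obtain ⟨-, -, h⟩ := h
  have key : ∀ w : M, w = q → (∃ τ : Indicatrix F w ≃ Indicatrix F w,
      IsPiecewiseTranslation F w w τ ∧ ∀ y, y ≠ 0 → f y = coordOf q w
        (homExt F (fun u => (τ u).1) (vecOf q w y))) →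
      ∃ φ : Equiv.Perm (Indicatrix F q), IsPiecewiseTranslation F q q φ ∧
        ∀ y, y ≠ 0 → f y = homExt F (fun u => (φ u).1) y := by
    rintro w rfl ⟨τ, hτ, hf⟩
    refine ⟨τ, hτ, fun y hy => ?_⟩
    have := hf y hy
    rwa [vecOf_self, coordOf_self] at this
  exact key _ (pointOf_extChartAt (mem_chartDom_self (n := n) q)) h

theorem homExt_symm_apply {p q : M} (τ : Indicatrix F q ≃ Indicatrix F p) (y : Coord n) :
    homExt F (fun u => (τ u).1) (homExt F (fun u => (τ.symm u).1) y) = y := by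
  rw [← homExt_comp F τ τ.symm y]
  simp only [Equiv.apply_symm_apply]
  exact homExt_id F

theorem IsSmooth.contDiffAt {p : M} {f : Indicatrix F p → Coord n} (h : IsSmooth F f) {y : Coord n}
    (hy : y ≠ 0) : ContDiffAt ℝ ∞ (homExt F f) y :=
  ContDiffOn.contDiffAt h (isOpen_compl_singleton.mem_nhds hy)

variable {p q : M} {τ : Indicatrix F q ≃ Indicatrix F p}

/-- The conjugate by `τ` of a family of self-maps of the fibre over `q`. -/
def conjFamily (τ : Indicatrix F q ≃ Indicatrix F p) (Φ : ℝ × (Coord n × Coord n) → Coord n)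
    (z : ℝ × (Coord n × Coord n)) : Coord n :=
  homExt F (fun u => (τ u).1)
    (Φ (z.1, (extChartAt (𝓡 n) q q, homExt F (fun u => (τ.symm u).1) z.2.2)))

theorem eventually_center {Q : ℝ → Prop} {P : Type*} [TopologicalSpace P] {x₀ : P}
    (h : ∀ᶠ t in 𝓝 (0 : ℝ), Q t) : ∀ᶠ r in 𝓝 ((0 : ℝ), x₀), Q r.1 :=
  continuousAt_fst.eventually h

/-- A loop at q, preceded and followed by the curve joining p and q, is a loop at p. Thus τ ∘ Φ ∘
τ⁻¹ consists of elements of the holonomy group at p. -/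
theorem SmoothFamily.conj (hτ : IsPiecewiseTranslation F q p τ)
    {Φ : ℝ × (Coord n × Coord n) → Coord n}
    (h : SmoothFamily (ChartTranslation F q) (extChartAt (𝓡 n) q q) 0 Φ) (x₀ : Coord n) :
    SmoothFamily (HolonomyMap F p) x₀ 0 (conjFamily τ Φ) := by
  have hslice : Tendsto (fun t : ℝ => (t, extChartAt (𝓡 n) q q)) (𝓝 0)
      (𝓝 (0, extChartAt (𝓡 n) q q)) := (Continuous.prodMk_left _).tendsto 0
  have hadm : ∀ᶠ t in 𝓝 (0 : ℝ), ∃ φ : Equiv.Perm (Indicatrix F q), IsPiecewiseTranslation F q q φ ∧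
      ∀ y, y ≠ 0 → Φ (t, (extChartAt (𝓡 n) q q, y)) = homExt F (fun u => (φ u).1) y := by
    filter_upwards [hslice.eventually h.adm] with t ht
    simp only [smul_zero, add_zero] at ht
    exact ht.at_center
  have hT := fun y (hy : y ≠ 0) => (hτ.isSmooth F).contDiffAt hy
  have hT' := fun y (hy : y ≠ 0) => ((hτ.symm F).isSmooth F).contDiffAt hy
  constructor
  · filter_upwards [eventually_center (hslice.eventually h.smooth), eventually_center hadm]
      with r h1 h2 y hy
    obtain ⟨φ, -, hφ⟩ := h2
    have hy' := homExt_ne_zero F τ.symm hy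
    have c1 : ContDiffAt ℝ ∞ (fun z : ℝ × (Coord n × Coord n) =>
        homExt F (fun u => (τ.symm u).1) z.2.2) (r.1, (r.2, y)) :=
      ContDiffAt.comp (r.1, (r.2, y)) (f := fun z : ℝ × (Coord n × Coord n) => z.2.2) (hT' y hy)
        (by fun_prop)
    have c2 : ContDiffAt ℝ ∞ (fun z : ℝ × (Coord n × Coord n) =>
        Φ (z.1, (extChartAt (𝓡 n) q q, homExt F (fun u => (τ.symm u).1) z.2.2))) (r.1, (r.2, y)) :=
      ContDiffAt.comp (r.1, (r.2, y)) (f := fun z : ℝ × (Coord n × Coord n) =>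
        (z.1, (extChartAt (𝓡 n) q q, homExt F (fun u => (τ.symm u).1) z.2.2))) (h1 _ hy')
        (contDiffAt_fst.prodMk (contDiffAt_const.prodMk c1))
    refine ContDiffAt.comp (r.1, (r.2, y)) (hT _ ?_) c2
    simp only [hφ _ hy']
    exact homExt_ne_zero F φ hy'
  · filter_upwards [eventually_center hadm] with r h2
    obtain ⟨φ, hφ, hφΦ⟩ := h2
    refine ⟨(τ.symm.trans (φ.trans τ)),
      (((hτ.symm F).trans F (hφ.trans F hτ))).mem_holPerm F, fun y hy => ?_⟩
    simp only [conjFamily]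
    rw [hφΦ _ (homExt_ne_zero F τ.symm hy), ← homExt_comp F φ τ.symm y]
    exact (homExt_comp F τ (τ.symm.trans φ) y).symm

theorem eventually_composeFamily_conj {Φ Ψ : ℝ × (Coord n × Coord n) → Coord n}
    (h : ∀ᶠ r in 𝓝 ((0 : ℝ), extChartAt (𝓡 n) q q), ∀ y, y ≠ 0 →
      composeFamily 0 Φ Ψ (r.1, (r.2, y)) = y) (x₀ : Coord n) :
    ∀ᶠ r in 𝓝 ((0 : ℝ), x₀), ∀ y, y ≠ 0 →
      composeFamily 0 (conjFamily τ Φ) (conjFamily τ Ψ) (r.1, (r.2, y)) = y := by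
  have hslice : Tendsto (fun t : ℝ => (t, extChartAt (𝓡 n) q q)) (𝓝 0)
      (𝓝 (0, extChartAt (𝓡 n) q q)) := (Continuous.prodMk_left _).tendsto 0
  filter_upwards [eventually_center (hslice.eventually h)] with r h1 y hy
  have h2 := h1 _ (homExt_ne_zero F τ.symm hy)
  have h3 := homExt_symm_apply τ.symm (F := F)
  simp only [Equiv.symm_symm] at h3
  simp only [composeFamily, smul_zero, add_zero, conjFamily] at h2 ⊢
  rw [h3, h2, homExt_symm_apply]

theorem HasOrderAt.conj {T : Coord n → Coord n} {a b : ℝ → Coord n} {k : ℕ} {v y : Coord n}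
    (hk : 1 ≤ k) (hT : DifferentiableAt ℝ T y) (hb : ∀ t, b t = T (a t))
    (ha : Tendsto (fun t : ℝ => (t ^ k)⁻¹ • (a t - y)) (𝓝[≠] 0) (𝓝 v)) :
    Tendsto (fun t : ℝ => (t ^ k)⁻¹ • (b t - T y)) (𝓝[≠] 0) (𝓝 (fderiv ℝ T y v)) := by
  have hd : Tendsto (fun t : ℝ => a t - y) (𝓝[≠] 0) (𝓝 0) := by
    have h0 : Tendsto (fun t : ℝ => t ^ k) (𝓝[≠] 0) (𝓝 0) := by
      have := (continuous_pow (M := ℝ) k).tendsto 0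
      rw [zero_pow (by omega)] at this
      exact this.mono_left nhdsWithin_le_nhds
    have h1 := h0.smul ha
    rw [zero_smul] at h1
    refine h1.congr' ?_
    filter_upwards [self_mem_nhdsWithin] with t ht
    rw [smul_smul, mul_inv_cancel₀ (pow_ne_zero k ht), one_smul]
  have h2 := (hasFDerivWithinAt_univ.mpr hT.hasFDerivAt).lim hd
    (Eventually.of_forall fun _ => mem_univ _) ha
  refine h2.congr fun t => ?_
  rw [hb, add_sub_cancel]

/-- Conjugation keeps the order k and pushes the coefficient forward by the differential of τ, by
the chain rule `HasOrderAt.conj`. -/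
theorem LeadFamily.conj (hτ : IsPiecewiseTranslation F q p τ) {k : ℕ}
    {ζ : Coord n × Coord n → Coord n} {Φ Ψ : ℝ × (Coord n × Coord n) → Coord n}
    (h : LeadFamily (ChartTranslation F q) (extChartAt (𝓡 n) q q) 0 0 k ζ Φ Ψ) (x₀ : Coord n) :
    LeadFamily (HolonomyMap F p) x₀ 0 0 k
      (fun z => fderiv ℝ (homExt F fun u => (τ u).1) (homExt F (fun u => (τ.symm u).1) z.2)
        (ζ (extChartAt (𝓡 n) q q, homExt F (fun u => (τ.symm u).1) z.2)))
      (conjFamily τ Φ) (conjFamily τ Ψ) where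
  pair :=
    { fwd := h.pair.fwd.conj hτ x₀
      bwd := by
        have := h.pair.bwd
        rw [neg_zero] at this ⊢
        exact this.conj hτ x₀
      fwd_bwd := by
        have := h.pair.fwd_bwd
        rw [neg_zero] at this ⊢
        exact eventually_composeFamily_conj this x₀
      bwd_fwd := eventually_composeFamily_conj h.pair.bwd_fwd x₀ }
  pos := h.pos
  order := by
    refine Eventually.of_forall fun x y hy => ?_
    have hy' := homExt_ne_zero F τ.symm hy
    have h1 := h.order.self_of_nhds _ hy'
    have h2 := (continuous_snd.tendsto _).comp h1
    have h3 := HasOrderAt.conj h.pos (((hτ.isSmooth F).contDiffAt hy').differentiableAt (by simp))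
      (fun _ => rfl) h2
    rw [homExt_symm_apply] at h3
    have h4 : Tendsto (fun _ : ℝ => (0 : Coord n)) (𝓝[≠] 0) (𝓝 0) := tendsto_const_nhds
    refine (h4.prodMk_nhds h3).congr fun t => ?_
    simp [stateMap, conjFamily]

theorem LeadSpan.conj (hτ : IsPiecewiseTranslation F q p τ) {ζ : Coord n × Coord n → Coord n}
    (h : LeadSpan (ChartTranslation F q) (extChartAt (𝓡 n) q q) ζ) (x₀ : Coord n) :
    LeadSpan (HolonomyMap F p) x₀ fun z =>
      fderiv ℝ (homExt F fun u => (τ u).1) (homExt F (fun u => (τ.symm u).1) z.2)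
        (ζ (extChartAt (𝓡 n) q q, homExt F (fun u => (τ.symm u).1) z.2)) := by
  induction h with
  | lead h => exact .lead (h.conj hτ x₀)
  | zero => exact LeadSpan.zero.congr (Eventually.of_forall fun x y _ => map_zero _)
  | add _ _ h1 h2 => exact (h1.add h2).congr (Eventually.of_forall fun x y _ => map_add _ _ _)
  | @smul c ζ _ _ h =>
    -- Only the fibre over q is conjugated, so the coefficient function is replaced by its value at
    -- q.
    exact (h.smul (c := fun _ => c (extChartAt (𝓡 n) q q))
      (smoothNear_of_contDiff contDiff_const _)).congr
      (Eventually.of_forall fun x y _ => map_smul _ _ _)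
  | congr _ he h =>
    refine h.congr (Eventually.of_forall fun x y hy => ?_)
    rw [he.self_of_nhds _ (homExt_ne_zero F τ.symm hy)]

/-- The differential of the 1-homogeneous extension of τ is constant along rays, so the formula on
the indicatrix extends unchanged to all nonzero vectors. -/
theorem homExt_berwaldTranslate (τ : Indicatrix F q ≃ Indicatrix F p) (ξ : Indicatrix F q → Coord n)
    {y : Coord n} (hy : y ≠ 0) :
    homExt F (berwaldTranslate F τ ξ) y
      = fderiv ℝ (homExt F fun u => (τ u).1) (homExt F (fun u => (τ.symm u).1) y)
        (homExt F ξ (homExt F (fun u => (τ.symm u).1) y)) := by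
  have h := fib_pos F p hy
  rw [homExt_of_ne F _ hy, homExt_of_ne F (fun u => (τ.symm u).1) hy,
    fderiv_smul_of_homogeneous h (homExt_smul _ h), homExt_smul _ h, homExt_apply, map_smul]
  rfl

/-- The generators lie in the span at p by conjugation. Brackets of translates from different points
q are covered because all families now act on the same fibre, where the span is closed under
commutators. -/
theorem leadSpan_of_mem_holonomyAlgebra {ξ : Indicatrix F p → Coord n}
    (hξ : ξ ∈ holonomyAlgebra F p) :
    LeadSpan (HolonomyMap F p) 0 fun z => homExt F ξ z.2 := by
  change LieHull F _ ξ at hξ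
  induction hξ with
  | of h =>
    obtain ⟨q, τ, _, hτ, ⟨ξ, hξ, rfl⟩, rfl⟩ := h
    have hd := mem_chartDom_self (n := n) q
    refine ((hξ.leadSpan q _ ((extChartAt (𝓡 n) q).map_source hd)).conj hτ 0).congr
      (Eventually.of_forall fun x y hy => ?_)
    simp only [fieldInChart_of_pointOf_eq ξ (pointOf_extChartAt hd), coordOf_self, vecOf_self]
    exact homExt_berwaldTranslate τ (ξ q) hy
  | zero => exact LeadSpan.zero.congr (Eventually.of_forall fun x y _ => homExt_zero y)
  | add _ _ h1 h2 => exact (h1.add h2).congr (Eventually.of_forall fun x y _ => homExt_add _ _ y)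
  | smul r _ h =>
    exact (h.smul (c := fun _ => r) (smoothNear_of_contDiff contDiff_const _)).congr
      (Eventually.of_forall fun x y _ => homExt_const_smul r _ y)
  | @bracket ξ η _ _ h1 h2 =>
    refine (h2.comm (isTransportLaw_holonomyMap p 0) h1).congr ?_
    filter_upwards [h1.smooth, h2.smooth] with x s1 s2 y hy
    rw [homExt_bracket ξ η hy, VectorField.lieBracket, leadComm,
      ← fderiv_partial_snd (s1 y hy).differentiableAt,
      ← fderiv_partial_snd (s2 y hy).differentiableAt]

theorem isTangentTo_of_leadSpan {ξ : Indicatrix F p → Coord n}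
    (h : LeadSpan (HolonomyMap F p) 0 fun z => homExt F ξ z.2) : IsTangentTo F (Hol F p) ξ := by
  obtain ⟨φ, hφ⟩ := h.exists_oneParameterFamily (isTransportLaw_holonomyMap p 0)
  refine ⟨⟨fun y hy => ?_, fun y => ?_⟩, ?_⟩
  · exact ((h.smooth.self_of_nhds y hy).contDiffAt.comp y
      (f := fun y : Coord n => ((0 : Coord n), y)) (by fun_prop)).contDiffWithinAt
  -- Tangency to the indicatrix: holonomy maps preserve F, so F is constant along the curve t ↦ φ(t,
  -- y), whose velocity at 0 is ξ(y).
  · have hy := indicatrix_ne_zero F y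
    have hd : HasFDerivAt (F.fib p) (fderiv ℝ (F.fib p) y.1) (φ (0, y.1)) := by
      rw [hφ.zero _ hy]
      exact ((contDiffAt_fib F p hy).differentiableAt (by simp)).hasFDerivAt
    have h1 := hd.comp_hasDerivAt 0 (hφ.deriv _ hy)
    rw [homExt_apply] at h1
    refine h1.unique ((hasDerivAt_const (0 : ℝ) (F.fib p y.1)).congr_of_eventuallyEq ?_)
    filter_upwards [hφ.adm] with t ht
    obtain ⟨ψ, -, hψ⟩ := ht
    have h2 := hψ _ hy
    simp only at h2
    rw [Function.comp_apply, h2, fib_homExt F ψ]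
  · obtain ⟨ε, hε, hball⟩ := Metric.eventually_nhds_iff_ball.mp (hφ.smooth.and hφ.adm)
    have hIoo : ∀ t ∈ Ioo (-ε) ε, t ∈ Metric.ball (0 : ℝ) ε := fun t ht => by
      rw [Metric.mem_ball, dist_zero_right, Real.norm_eq_abs, abs_lt]
      exact ht
    -- The group elements are chosen separately for each t. At t = 0 the identity is selected
    -- explicitly, since `φ 0 = 1` is required in the group; outside the interval the value is
    -- irrelevant.
    have hex : ∀ t : ℝ, ∃ ψ : IndicatrixDiffeo F p, (t ∈ Ioo (-ε) ε → ψ ∈ Hol F p ∧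
        ∀ y, y ≠ 0 → φ (t, y) = homExt F (fun u => (ψ.1 u).1) y) ∧ (t = 0 → ψ = 1) := by
      intro t
      rcases eq_or_ne t 0 with rfl | ht0
      · exact ⟨1, fun _ => ⟨one_mem _, fun y hy =>
          (hφ.zero y hy).trans (homExt_id F).symm⟩, fun _ => rfl⟩
      · by_cases ht : t ∈ Ioo (-ε) ε
        · obtain ⟨_, ⟨ψ, hψ, rfl⟩, hψφ⟩ := (hball t (hIoo t ht)).2
          exact ⟨ψ, fun _ => ⟨hψ, hψφ⟩, fun h0 => absurd h0 ht0⟩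
        · exact ⟨1, fun h0 => absurd h0 ht, fun _ => rfl⟩
    choose ψ hψ hψ0 using hex
    refine ⟨ε, hε, ψ, fun t ht => (hψ t ht).1, hψ0 0 rfl, ?_, fun y => ?_⟩
    · have h1 : ContDiffOn ℝ 1 φ (Ioo (-ε) ε ×ˢ {0}ᶜ) := fun z hz =>
        ((hball z.1 (hIoo _ hz.1)).1 z.2 hz.2).contDiffWithinAt
      exact h1.congr fun z hz => ((hψ z.1 hz.1).2 z.2 hz.2).symm
    · have hy := indicatrix_ne_zero F y
      have h1 := hφ.deriv _ hy
      rw [homExt_apply] at h1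
      refine h1.congr_of_eventuallyEq ?_
      filter_upwards [Ioo_mem_nhds (neg_lt_zero.mpr hε) hε] with t ht
      rw [(hψ t ht).2 _ hy]
      exact (homExt_apply (fun u => ((ψ t).1 u).1) y).symm

end Holonomy

end Finsler

end

theorem mainTheorem1 (n : ℕ) (M : Type*) [TopologicalSpace M] [T2Space M]
    [SecondCountableTopology M] [ChartedSpace (EuclideanSpace ℝ (Fin n)) M]
    [IsManifold (𝓡 n) ∞ M] (F : Finsler.FinslerFunction n M) (p : M) :
    ∀ ξ ∈ Finsler.holonomyAlgebra F p, Finsler.IsTangentTo F (Finsler.Hol F p) ξ :=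
  fun _ hξ => Finsler.isTangentTo_of_leadSpan (Finsler.leadSpan_of_mem_holonomyAlgebra hξ)
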